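/- **Proposition 1.4.** Let $X$ be a complex algebraic variety (a reduced separated scheme of finite type over $\mathbb C$) and let $r\ge 0$ be an integer. A closed point $x\in X$ is called a *quadratic singularity of rank $\rho$* if a neighbourhood of $x$ in $X$ is isomorphic to a hypersurface $\{f=0\}$ in a smooth complex variety $Y$ and, in local coordinates $z_1,\dots,z_n$ on $Y$ at (the point corresponding to) $x$, one has $$f=q_2(z_1,\dots,z_n)+(\text{terms of order}\ge 3),$$ where $q_2\neq 0$ is a quadratic form of rank $\rho$. We say that a complex scheme has *at most quadratic singularities of rank at least $r$* if every closed point is either non-singular or a quadratic singularity of some rank $\rho\ge r$. We write $\operatorname{codim}(Z\subset X)$ for the infimum of $\dim\mathcal O_{X,z}$ over $z\in Z$, so that $\operatorname{codim}(\emptyset\subset X)=\infty$. Assume that $X$ has at most quadratic singularities of rank at least $r$ and that $$\operatorname{codim}(\operatorname{Sing}X\subset X)\ge r.$$ Then for every irreducible closed subvariety $B\subset X$ there is a Zariski open subset $U\subset X$, which can be taken affine, such that $U\cap B\neq\emptyset$ and the blow-up $\widetilde U\to U$ along the subvariety $B_U=B\cap U$ (with its reduced structure) has at most quadratic singularities of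 rank at least $r$, and moreover $$\operatorname{codim}(\operatorname{Sing}\widetilde U\subset\widetilde U)\ge r.$$ -/

import Mathlib

open AlgebraicGeometry CategoryTheory TopologicalSpace

namespace QuadraticSingularities

universe u

/-! ### The blow-up of an affine scheme along an ideal -/

section Rees

open Polynomial

variable {R : Type u} [CommRing R] (I : Ideal R)

/-- The degree `n` part `Iⁿ tⁿ` of the Rees algebra `R[It] = ⨁ₙ Iⁿ tⁿ`. -/
def reesPiece (n : ℕ) : Submodule R (reesAlgebra I) where
  carrier := {p | ∀ m, m ≠ n → (p : R[X]).coeff m = 0}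
  add_mem' {p q} hp hq m hm := by simp [hp m hm, hq m hm]
  zero_mem' m _ := by simp
  smul_mem' c p hp m hm := by simp [hp m hm]

theorem mem_reesPiece {n : ℕ} {p : reesAlgebra I} :
    p ∈ reesPiece I n ↔ ∀ m, m ≠ n → (p : R[X]).coeff m = 0 := Iff.rfl

/-- The homogeneous component of degree `n` of an element of the Rees algebra. -/
noncomputable def reesComponent (n : ℕ) (p : reesAlgebra I) : reesPiece I n :=
  ⟨⟨monomial n ((p : R[X]).coeff n), reesAlgebra.monomial_mem.mpr (p.2 n)⟩,
    fun _ hm => coeff_monomial_of_ne _ hm⟩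

theorem coe_reesComponent (n : ℕ) (p : reesAlgebra I) :
    ((reesComponent I n p : reesAlgebra I) : R[X]) = monomial n ((p : R[X]).coeff n) := rfl

theorem coe_eq_monomial {n : ℕ} (p : reesPiece I n) :
    ((p : reesAlgebra I) : R[X]) = monomial n (((p : reesAlgebra I) : R[X]).coeff n) := by
  ext m
  rw [coeff_monomial]
  split_ifs with h
  · subst h
    rfl
  · exact p.2 m (Ne.symm h)

instance reesPiece_gradedMonoid : SetLike.GradedMonoid (reesPiece I) where
  one_mem m hm := by simp [coeff_one, hm]
  mul_mem a b p q hp hq m hm := by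
    have hp' := coe_eq_monomial I ⟨p, hp⟩
    have hq' := coe_eq_monomial I ⟨q, hq⟩
    simp only at hp' hq'
    rw [MulMemClass.coe_mul, hp', hq', monomial_mul_monomial, coeff_monomial_of_ne _ hm]

/-- The coefficients of a finite sum of homogeneous elements. -/
theorem coeff_coeAddMonoidHom (x : DirectSum ℕ fun n => reesPiece I n) (n : ℕ) :
    ((DirectSum.coeAddMonoidHom (reesPiece I) x : reesAlgebra I) : R[X]).coeff n =
      ((x n : reesAlgebra I) : R[X]).coeff n := by
  induction x using DirectSum.induction_on with
  | zero => simp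
  | of i y =>
    rw [DirectSum.coeAddMonoidHom_of]
    by_cases h : n = i
    · subst h
      rw [DirectSum.of_eq_same]
    · rw [DirectSum.of_eq_of_ne _ _ _ h, y.2 n h]
      simp
  | add x y hx hy => simp [hx, hy]

open Classical in
/-- The grading of the Rees algebra by the exponent of `t`. -/
noncomputable instance reesPiece_decomposition : DirectSum.Decomposition (reesPiece I) where
  decompose' p := DirectSum.mk _ (p : R[X]).support fun n => reesComponent I n p
  left_inv p := by
    apply Subtype.ext
    ext n
    rw [coeff_coeAddMonoidHom]
    by_cases h : n ∈ (p : R[X]).support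
    · rw [DirectSum.mk_apply_of_mem h, coe_reesComponent, coeff_monomial_same]
    · rw [DirectSum.mk_apply_of_notMem h, notMem_support_iff.mp h]
      simp
  right_inv x := by
    refine DFinsupp.ext fun n => ?_
    apply Subtype.ext
    apply Subtype.ext
    set p := DirectSum.coeAddMonoidHom (reesPiece I) x with hp
    have key : (p : R[X]).coeff n = ((x n : reesAlgebra I) : R[X]).coeff n :=
      coeff_coeAddMonoidHom I x n
    rw [coe_eq_monomial I (x n), ← key]
    by_cases h : n ∈ (p : R[X]).support
    · rw [DirectSum.mk_apply_of_mem h, coe_reesComponent]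
    · rw [DirectSum.mk_apply_of_notMem h, notMem_support_iff.mp h]
      simp

noncomputable instance reesPiece_gradedAlgebra : GradedAlgebra (reesPiece I) where

/-- The blow-up of `Spec R` along the closed subscheme defined by the ideal `I`,
that is, `Proj (⨁ₙ Iⁿ)`. -/
noncomputable def affineBlowup : Scheme.{u} := Proj (reesPiece I)

/-- The blow-up morphism `Proj (⨁ₙ Iⁿ) ⟶ Spec R`. -/
noncomputable def affineBlowupToSpec : affineBlowup I ⟶ Spec (.of R) :=
  Proj.toSpecZero (reesPiece I) ≫ Spec.map (CommRingCat.ofHom (algebraMap R (reesPiece I 0)))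

end Rees

/-! ### Blowing up a closed subset over an affine open subset -/

section Blowup

variable {X : Scheme.{u}} (B : Closeds X) (U : X.affineOpens)

/-- The ideal in `Γ(X, U)` of the functions vanishing on `B ∩ U`, i.e. the ideal of the closed
subset `B ∩ U` of `U` with its reduced structure. -/
noncomputable def subvarietyIdeal : Ideal Γ(X, U) :=
  (Scheme.IdealSheafData.vanishingIdeal B).ideal U

/-- The blow-up of the affine open subset `U ⊆ X` along `B ∩ U`. -/
noncomputable def blowup : Scheme.{u} := affineBlowup (subvarietyIdeal B U)

/-- The blow-up morphism, followed by the inclusion of `U ≅ Spec Γ(X, U)` into `X`. -/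
noncomputable def blowupMap : blowup B U ⟶ X :=
  affineBlowupToSpec (subvarietyIdeal B U) ≫ U.2.fromSpec

end Blowup

/-! ### Singularities of complex schemes -/

/-- `z₁, …, zₙ` are local coordinates at the point of `Spec A` given by the maximal ideal `m`:
they lie in `m` and their classes form a basis of the cotangent space `m / m²` over `ℂ`. -/
structure IsLocalCoordinates {A : Type} [CommRing A] [Algebra ℂ A] (m : Ideal A) {n : ℕ}
    (z : Fin n → A) : Prop where
  mem : ∀ i, z i ∈ m
  existsUnique : ∀ a ∈ m, ∃! c : Fin n → ℂ, a - ∑ i, c i • z i ∈ m ^ 2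

/-- In suitable local coordinates at the point `m`, one has
`f = q₂(z₁, …, zₙ) + (terms of order at least 3)`, where `q₂ ≠ 0` is a quadratic form with
symmetric matrix `M` of rank `ρ`. -/
def HasQuadraticInitialForm {A : Type} [CommRing A] [Algebra ℂ A] (m : Ideal A) (f : A)
    (ρ : ℕ) : Prop :=
  ∃ (n : ℕ) (z : Fin n → A) (M : Matrix (Fin n) (Fin n) ℂ),
    IsLocalCoordinates m z ∧ M.IsSymm ∧ M ≠ 0 ∧ M.rank = ρ ∧
      f - ∑ i, ∑ j, M i j • (z i * z j) ∈ m ^ 3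

variable {X : Scheme.{0}} (s : X ⟶ Spec (.of ℂ))

/-- The point `x` of the complex scheme `X` is a quadratic singularity of rank `ρ`:
a neighbourhood of `x` in `X` is isomorphic over `ℂ` to a hypersurface `{f = 0}` in a smooth
affine scheme `Spec A`, and at the (closed) point corresponding to `x` the expansion of `f` starts
with a quadratic form of rank `ρ`. -/
def IsQuadraticSingularity (x : X) (ρ : ℕ) : Prop :=
  ∃ (A : Type) (_ : CommRing A) (_ : Algebra ℂ A) (f : A)
    (j : Spec (.of (A ⧸ Ideal.span {f})) ⟶ X) (y : Spec (.of (A ⧸ Ideal.span {f}))),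
    Algebra.Smooth ℂ A ∧ IsOpenImmersion j ∧
    j ≫ s = Spec.map (CommRingCat.ofHom (algebraMap ℂ (A ⧸ Ideal.span {f}))) ∧
    j y = x ∧
    (y.asIdeal.comap (Ideal.Quotient.mk (Ideal.span {f}))).IsMaximal ∧
    HasQuadraticInitialForm (y.asIdeal.comap (Ideal.Quotient.mk (Ideal.span {f}))) f ρ

/-- `X` is non-singular at `x`: it is smooth over `ℂ` in a neighbourhood of `x`. -/
def IsNonsingularAt (x : X) : Prop :=
  ∃ V : X.Opens, x ∈ V ∧ Smooth (V.ι ≫ s)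

/-- The singular locus `Sing X`. -/
def singularLocus : Set X := {x | ¬ IsNonsingularAt s x}

/-- `X` has at most quadratic singularities of rank at least `r`: every closed point is either
non-singular or a quadratic singularity of some rank `ρ ≥ r`. -/
def HasAtMostQuadraticSingularities (r : ℕ) : Prop :=
  ∀ x : X, IsClosed ({x} : Set X) →
    IsNonsingularAt s x ∨ ∃ ρ, r ≤ ρ ∧ IsQuadraticSingularity s x ρ

/-- The codimension of a subset `Z` of a scheme `X`: the infimum of the codimensions of the points
of `Z`, where the codimension of `x` (i.e. of its closure) is the supremum of the lengths of chains
of generizations of `x`, equivalently the Krull dimension of the local ring at `x`.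
The empty set has codimension `⊤`. -/
noncomputable def codim (Z : Set X) : ℕ∞ := ⨅ x ∈ Z, Order.coheight x

end QuadraticSingularities

namespace QuadraticSingularities

universe u

/-! ### Derivations and heights of prime ideals -/

section DerivationHeight

/-! Both conditions are combined in `IsAdmissibleAt`, a condition on a single point that open
immersions preserve and reflect, so it can be tested on charts of the blow-up. Off the exceptional
divisor `E` a chart of the blow-up is locally an open piece of `X` and inherits admissibility. Only
points of `E` need work.

Choice of `U`. If `B` is not contained in `Sing X`, take a smooth neighbourhood of a nonsingular
point of `B` and shrink it until `B` is smooth; the blow-up of a smooth variety along a smooth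
centre is smooth. If `B ⊆ Sing X`, take a closed point of `B`. Near it `X` is `{f = 0}`, and the
Hessian of `f` has a minor of positive size at least `r` that is invertible near the point. Shrink
again so that `B` is smooth and its ideal `J` is generated by some members `x_i` of a coordinate
system (`exists_isCoordinateSystem_adapted`). This may lose the chosen point, but the minor stays
invertible. As `X` is singular along `B`, `f` and all its derivatives lie in `J`, so `f = ∑ a_ij x_i
x_j` with `a` symmetric (`exists_isSymm_eq_sum`). Comparing with the Hessian at a point of `B`
(`rank_hessian_le`) gives a minor of `a` of some size `n ≥ r`, invertible after one last shrinking.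

Computation on a chart `x_l = y_l`, `x_i = y_l y_i`. The strict transform is `F = ∑ a_ij w_i w_j`
with `w_l = 1` and `w_i = y_i` otherwise. Functions coming from `A` are constant to first order
along the fibres of `E` (`pderiv_algebraMap_mem`), so `∂F/∂y_i ≡ 2 ∑_j a_ij w_j` modulo `y_l` for `i
≠ l`. At a point of `E` where `F` and its derivatives vanish, `a w = 0` with `w_l = 1`, so some
nonzero `n × n` minor of `a` avoids row and column `l`. Two things follow. The second derivatives of
`F` in these directions are `2 a_ij`, so the initial form has rank at least `n`
(`exists_hasQuadraticInitialForm`). Also `y_l` and `n` of the functions `∑_j a_ij w_j` have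
independent differentials, so the point has height at least `n + 1` in the ambient chart
(`succ_le_height`), hence at least `n` in `{F = 0}`.

The ambient charts come from affine space by étale base change (`exists_isBlowupChart`);
`exists_awayEquiv` recognises a ring as a chart of `Proj` of the Rees algebra from ring-theoretic
properties alone. -/

theorem derivation_mem_pow {k A : Type*} [CommRing k] [CommRing A] [Algebra k A]
    (D : Derivation k A A) (I : Ideal A) (n : ℕ) {a : A} (ha : a ∈ I ^ (n + 1)) :
    D a ∈ I ^ n := by
  induction n generalizing a with
  | zero => simp
  | succ n ih =>
    rw [pow_succ'] at ha
    induction ha using Submodule.mul_induction_on' with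
    | mem_mul_mem x hx y hy =>
      rw [Derivation.leibniz, smul_eq_mul, smul_eq_mul]
      refine add_mem ?_ (Ideal.mul_mem_right _ _ hy)
      rw [pow_succ']
      exact Ideal.mul_mem_mul hx (ih hy)
    | add x _ y _ hx hy =>
      rw [map_add]
      exact add_mem hx hy

/-- If no such product vanished, the multiplicative set generated by `g` and the complement of `q`
would miss `0`. A prime disjoint from it would lie in `q` without containing `g`, against
minimality. -/
theorem exists_mul_pow_eq_zero_of_mem_minimalPrimes {A : Type*} [CommRing A] {q : Ideal A}
    (hq : q ∈ minimalPrimes A) {g : A} (hg : g ∈ q) :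
    ∃ s ∉ q, ∃ n : ℕ, s * g ^ n = 0 := by
  have hqp : q.IsPrime := hq.1.1
  by_contra! H
  obtain ⟨p, hp, -, hdisj⟩ := Ideal.exists_le_prime_disjoint (⊥ : Ideal A)
    (q.primeCompl ⊔ Submonoid.powers g) (by
      rw [Set.disjoint_left]
      rintro x (rfl : x = 0) hx
      obtain ⟨s, hs, t, ⟨n, rfl⟩, h⟩ := Submonoid.mem_sup.mp hx
      exact H s hs n h)
  rw [Set.disjoint_right] at hdisj
  have hpq : p ≤ q := by
    intro x hx
    by_contra hxq
    exact hdisj (SetLike.mem_coe.mpr (Submonoid.mem_sup_left (show x ∈ q.primeCompl from hxq))) hx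
  have hqle : q ≤ p := hq.2 ⟨hp, bot_le⟩ hpq
  exact hdisj (SetLike.mem_coe.mpr (Submonoid.mem_sup_right (Submonoid.mem_powers g))) (hqle hg)

/-- Differentiating `s g^(n+1) = 0` and multiplying by `s` removes the term with `D s` and leaves
`(n+1) s² (D g) g^n = 0`. In characteristic zero the exponent of `g` thus drops to `0` while the
cofactor stays outside `q`, which is absurd. -/
theorem notMem_minimalPrimes_of_derivation {k A : Type*} [Field k] [CharZero k] [CommRing A]
    [Algebra k A] (D : Derivation k A A) {q : Ideal A} {g : A} (hg : g ∈ q) (hD : D g ∉ q) :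
    q ∉ minimalPrimes A := by
  intro hq
  have hqp : q.IsPrime := hq.1.1
  obtain ⟨s, hs, n, h⟩ := exists_mul_pow_eq_zero_of_mem_minimalPrimes hq hg
  induction n generalizing s with
  | zero => 
    rw [pow_zero, mul_one] at h
    exact hs (h ▸ q.zero_mem)
  | succ n ih =>
    have h1 : D (s * g ^ (n + 1)) = 0 := by rw [h, map_zero]
    rw [Derivation.leibniz, Derivation.leibniz_pow] at h1
    simp only [add_tsub_cancel_right, smul_eq_mul, nsmul_eq_mul] at h1
    have h2 : ((n + 1 : ℕ) : k) • (s * s * D g * g ^ n) = 0 := by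
      rw [Algebra.smul_def, map_natCast]
      linear_combination s * h1 - D s * h
    have h3 : s * s * D g * g ^ n = 0 := by
      have := congrArg (fun y => (((n + 1 : ℕ) : k)⁻¹) • y) h2
      simpa only [smul_smul, inv_mul_cancel₀ (Nat.cast_ne_zero.mpr n.succ_ne_zero : ((n+1:ℕ):k) ≠ 0),
        one_smul, smul_zero] using this
    exact ih (s * s * D g)
      (hqp.mul_notMem (hqp.mul_notMem hs hs) hD) h3

/-- Induction by killing `g 0`. The other derivations annihilate `g 0`, so they descend to `A / (g
0)` and give a chain of primes there. Its pullback starts at a prime containing `g 0` but not `D 0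
(g 0)`, which is therefore not minimal, so the chain extends downwards by one step. No regularity of
`A` enters. -/
theorem le_height_of_derivation_diagonal {k : Type*} [Field k] [CharZero k] (n : ℕ) :
    ∀ {A : Type*} [CommRing A] [Algebra k A] (p : Ideal A) [p.IsPrime]
      (D : Fin n → Derivation k A A) (g : Fin n → A), (∀ i, g i ∈ p) →
      (∀ i j, i ≠ j → D i (g j) = 0) → (∀ i, D i (g i) ∉ p) → (n : ℕ∞) ≤ p.height := by
  induction n with
  | zero => intros; simp
  | succ n ih =>
    intro A _ _ p _ D g hg hD0 hD
    let π := Ideal.Quotient.mkₐ k (Ideal.span {g 0})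
    have hπ : Function.Surjective π := Ideal.Quotient.mkₐ_surjective _ _
    have hker : RingHom.ker (π : A →+* A ⧸ Ideal.span {g 0}) ≤ p := by
      rw [show RingHom.ker (π : A →+* A ⧸ Ideal.span {g 0}) = Ideal.span {g 0} from
        Ideal.mk_ker]
      simpa [Ideal.span_le] using hg 0
    have hprime : (p.map (π : A →+* A ⧸ Ideal.span {g 0})).IsPrime :=
      Ideal.map_isPrime_of_surjective (f := (π : A →+* A ⧸ Ideal.span {g 0})) hπ hker
    have hcomap : (p.map (π : A →+* A ⧸ Ideal.span {g 0})).comap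
        (π : A →+* A ⧸ Ideal.span {g 0}) = p :=
      Ideal.comap_map_of_surjective' (π : A →+* A ⧸ Ideal.span {g 0}) hπ p |>.trans
        (sup_eq_left.mpr hker)
    have hdesc : ∀ i : Fin n, ∀ x, π x = 0 → π (D i.succ x) = 0 := by
      intro i x hx
      obtain ⟨y, rfl⟩ := Ideal.mem_span_singleton'.mp (Ideal.Quotient.eq_zero_iff_mem.mp hx)
      refine Ideal.Quotient.eq_zero_iff_mem.mpr ?_
      rw [Derivation.leibniz, hD0 _ _ (Fin.succ_ne_zero i), smul_zero, zero_add, smul_eq_mul]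
      exact Ideal.mul_mem_right _ _ (Ideal.mem_span_singleton_self _)
    have hn := ih (p.map (π : A →+* A ⧸ Ideal.span {g 0}))
      (fun i => Derivation.liftOfSurjective (f := π) hπ (hdesc i)) (fun i => π (g i.succ))
      (fun i => Ideal.mem_map_of_mem _ (hg _))
      (fun i j hij => by
        rw [Derivation.liftOfSurjective_apply, hD0 _ _ (by simpa using hij), map_zero])
      (fun i h => by
        rw [Derivation.liftOfSurjective_apply] at h
        refine hD i.succ ?_
        rw [← hcomap]
        exact h)
    have hheight : ∀ {B : Type _} [CommRing B] (I : Ideal B) (hI : I.IsPrime),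
        I.height = Order.height (⟨I, hI⟩ : PrimeSpectrum B) :=
      fun I hI => PrimeSpectrum.height_eq_orderHeight ⟨I, hI⟩
    rw [hheight _ inferInstance] at hn ⊢
    obtain ⟨c, hc, hlen⟩ := Order.exists_series_of_le_height _ hn
    let c' : LTSeries (PrimeSpectrum A) := c.map (PrimeSpectrum.comap
      (π : A →+* A ⧸ Ideal.span {g 0})) (by
        intro a b hab
        refine lt_of_le_of_ne (Ideal.comap_mono hab.le) fun h => hab.ne ?_
        exact PrimeSpectrum.comap_injective_of_surjective _ hπ h)
    have hlast : c'.last = ⟨p, inferInstance⟩ := by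
      ext1
      change c.last.asIdeal.comap _ = p
      rw [hc]
      exact hcomap
    have hhead : g 0 ∈ c'.head.asIdeal := by
      change π (g 0) ∈ c.head.asIdeal
      rw [show π (g 0) = 0 from
        Ideal.Quotient.eq_zero_iff_mem.mpr (Ideal.mem_span_singleton_self _)]
      exact zero_mem _
    have hle : c'.head.asIdeal ≤ p := by
      have := c'.head_le_last
      rw [hlast] at this
      exact this
    have hnm := notMem_minimalPrimes_of_derivation (D 0) hhead (fun h => hD 0 (hle h))
    obtain ⟨q, hq, hqle⟩ := Ideal.exists_minimalPrimes_le (bot_le : ⊥ ≤ c'.head.asIdeal)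
    have hqlt : (⟨q, hq.1.1⟩ : PrimeSpectrum A) < c'.head := by
      refine lt_of_le_of_ne hqle fun h => hnm ?_
      rw [← h]
      exact hq
    let d := c'.cons ⟨q, hq.1.1⟩ hqlt
    have hd : d.last = ⟨p, inferInstance⟩ := by rw [← hlast]; exact RelSeries.last_cons _ _ _
    have := Order.length_le_height_last (p := d)
    rw [hd] at this
    refine le_trans ?_ this
    have : d.length = n + 1 := by
      rw [RelSeries.cons_length, ← hlen]
      rfl
    rw [this]

theorem derivation_sum_smul_apply {k A M ι : Type*} [CommRing k] [CommRing A] [Algebra k A]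
    [AddCommGroup M] [Module A M] [Module k M] [IsScalarTower k A M]
    (s : Finset ι) (c : ι → A) (D : ι → Derivation k A M) (a : A) :
    (∑ i ∈ s, c i • D i) a = ∑ i ∈ s, c i • D i a := by
  classical
  induction s using Finset.induction_on with
  | empty => simp
  | insert i s hi ih => rw [Finset.sum_insert hi, Finset.sum_insert hi, Derivation.add_apply, ih,
      Derivation.smul_apply]

/-- Combining the derivations with the adjugate of the Jacobian matrix makes that matrix scalar,
equal to its determinant, which reduces to the diagonal case. -/
theorem card_le_height_of_derivation {k A ι : Type*} [Field k] [CharZero k] [CommRing A]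
    [Algebra k A] [Fintype ι] [DecidableEq ι] (p : Ideal A) [p.IsPrime]
    (D : ι → Derivation k A A) (g : ι → A) (hg : ∀ i, g i ∈ p)
    (hD : (Matrix.of fun i j => D i (g j)).det ∉ p) : (Fintype.card ι : ℕ∞) ≤ p.height := by
  set G : Matrix ι ι A := Matrix.of fun i j => D i (g j) with hG
  let D' : ι → Derivation k A A := fun i => ∑ j, G.adjugate i j • D j
  have hD' : ∀ i j, D' i (g j) = if i = j then G.det else 0 := by
    intro i j
    have : D' i (g j) = (G.adjugate * G) i j := by
      rw [Matrix.mul_apply]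
      exact derivation_sum_smul_apply _ _ _ _
    rw [this, Matrix.adjugate_mul, Matrix.smul_apply, Matrix.one_apply]
    split_ifs <;> simp
  let e := Fintype.equivFin ι
  refine le_height_of_derivation_diagonal (Fintype.card ι) p (fun i => D' (e.symm i))
    (fun i => g (e.symm i)) (fun i => hg _) (fun i j hij => ?_) (fun i => ?_)
  · rw [hD', if_neg (by simpa using hij)]
  · rw [hD', if_pos rfl]
    exact hD

end DerivationHeight

/-! ### The Jacobian criterion for hypersurfaces -/

section Jacobian

open KaehlerDifferential TensorProduct

variable {k A : Type*} [CommRing k] [CommRing A] [Algebra k A]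

/-- The conormal sequence splits: `da ↦ (D f)⁻¹ (D a) [f]` is a retraction onto the conormal module,
because `D (g f) ≡ g (D f)` modulo `f`. -/
theorem formallySmooth_quotient_span_singleton [Algebra.FormallySmooth k A] (f : A)
    (D : Derivation k A A) (hD : IsUnit (Ideal.Quotient.mk (Ideal.span {f}) (D f))) :
    Algebra.FormallySmooth k (A ⧸ Ideal.span {f}) := by
  set I := Ideal.span {f} with hI
  have hsurj : Function.Surjective (algebraMap A (A ⧸ I)) := Ideal.Quotient.mk_surjective
  have hker : RingHom.ker (algebraMap A (A ⧸ I)) = I := Ideal.mk_ker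
  have hf : f ∈ RingHom.ker (algebraMap A (A ⧸ I)) := by
    rw [hker]; exact Ideal.mem_span_singleton_self f
  obtain ⟨u, hu⟩ := hD
  let c : (RingHom.ker (algebraMap A (A ⧸ I))).Cotangent :=
    (RingHom.ker (algebraMap A (A ⧸ I))).toCotangent ⟨f, hf⟩
  have hc : ∀ a ∈ I, a • c = 0 := by
    intro a ha
    rw [← map_smul, Ideal.toCotangent_eq_zero]
    rw [sq]
    exact Ideal.mul_mem_mul (by rw [hker]; exact ha) hf
  let q : (A ⧸ I) →ₗ[A] (RingHom.ker (algebraMap A (A ⧸ I))).Cotangent :=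
    Submodule.liftQ I (LinearMap.toSpanSingleton A _ c) (fun a ha => by
      rw [LinearMap.mem_ker, LinearMap.toSpanSingleton_apply]; exact hc a ha)
  have hq : ∀ a : A, q (Ideal.Quotient.mk I a) = a • c := fun a => rfl
  let l : (A ⧸ I) ⊗[A] Ω[A⁄k] →ₗ[A] (RingHom.ker (algebraMap A (A ⧸ I))).Cotangent :=
    q ∘ₗ (LinearMap.mulLeft A ((u⁻¹ : (A ⧸ I)ˣ) : A ⧸ I)) ∘ₗ
      (TensorProduct.rid A (A ⧸ I)).toLinearMap ∘ₗ
        (LinearMap.lTensor (A ⧸ I) D.liftKaehlerDifferential)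
  rw [Algebra.FormallySmooth.iff_split_injection hsurj]
  refine ⟨l, ?_⟩
  ext y
  obtain ⟨⟨y, hy⟩, rfl⟩ := Ideal.toCotangent_surjective _ y
  have hy' := hy
  rw [hker] at hy'
  obtain ⟨g, rfl⟩ := Ideal.mem_span_singleton'.mp hy'
  rw [LinearMap.comp_apply, kerCotangentToTensor_toCotangent]
  have h1 : l (1 ⊗ₜ[A] KaehlerDifferential.D k A (g * f)) =
      q (((u⁻¹ : (A ⧸ I)ˣ) : A ⧸ I) * (D (g * f) • (1 : A ⧸ I))) := by
    simp [l]
  have h2 : (D (g * f) • (1 : A ⧸ I)) = (u : A ⧸ I) * Ideal.Quotient.mk I g := by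
    rw [hu, ← Algebra.algebraMap_eq_smul_one, Ideal.Quotient.algebraMap_eq, Derivation.leibniz,
      smul_eq_mul, smul_eq_mul, map_add, map_mul, map_mul,
      Ideal.Quotient.eq_zero_iff_mem.mpr (Ideal.mem_span_singleton_self f)]
    ring
  change l (1 ⊗ₜ[A] KaehlerDifferential.D k A (g * f)) = _
  rw [h1, h2, Units.inv_mul_cancel_left, hq, LinearMap.id_apply]
  change _ = (RingHom.ker (algebraMap A (A ⧸ I))).toCotangent (g • ⟨f, hf⟩)
  rw [map_smul]

theorem smooth_quotient_span_singleton [Algebra.Smooth k A] (f : A)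
    (D : Derivation k A A) (hD : IsUnit (Ideal.Quotient.mk (Ideal.span {f}) (D f))) :
    Algebra.Smooth k (A ⧸ Ideal.span {f}) where
  formallySmooth := formallySmooth_quotient_span_singleton f D hD
  finitePresentation := Algebra.FinitePresentation.quotient ⟨{f}, by simp⟩

end Jacobian

/-! ### Coordinate systems -/

section Coordinates

open KaehlerDifferential

/-- The functions `x i` are coordinates on the `k`-algebra `A`: their differentials are a basis of
the module of Kähler differentials. -/
structure IsCoordinateSystem (k : Type*) {A σ : Type*} [CommRing k] [CommRing A] [Algebra k A]
    (x : σ → A) : Prop where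
  linearIndependent : LinearIndependent A fun i => D k A (x i)
  span_eq_top : ⊤ ≤ Submodule.span A (Set.range fun i => D k A (x i))

namespace IsCoordinateSystem

variable {k A σ : Type*} [CommRing k] [CommRing A] [Algebra k A] {x : σ → A}
  (h : IsCoordinateSystem k x)

theorem of_basis (b : Module.Basis σ A Ω[A⁄k]) (hb : ∀ i, b i = D k A (x i)) :
    IsCoordinateSystem k x where
  linearIndependent := by
    have := b.linearIndependent
    rwa [funext hb] at this
  span_eq_top := by
    rw [← b.span_eq, funext hb]

include h in
theorem sub_algebraMap (c : σ → k) : IsCoordinateSystem k fun i => x i - algebraMap k A (c i) where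
  linearIndependent := by simpa using h.linearIndependent
  span_eq_top := by simpa using h.span_eq_top

include h in
theorem reindex {τ : Type*} (e : τ ≃ σ) : IsCoordinateSystem k fun i => x (e i) where
  linearIndependent := h.linearIndependent.comp e e.injective
  span_eq_top := by
    have : (Set.range fun i => D k A (x (e i))) = Set.range fun i => D k A (x i) :=
      e.surjective.range_comp fun i => D k A (x i)
    rw [this]
    exact h.span_eq_top

/-- The basis of the Kähler differentials given by a coordinate system. -/
noncomputable def basis : Module.Basis σ A Ω[A⁄k] := .mk h.linearIndependent h.span_eq_top

/-- The partial derivatives with respect to a coordinate system. -/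
noncomputable def pderiv (i : σ) : Derivation k A A := (h.basis.coord i).compDer (D k A)

theorem pderiv_apply_coord [DecidableEq σ] (i j : σ) : h.pderiv i (x j) = if i = j then 1 else 0 := by
  have : D k A (x j) = h.basis j := by simp [basis]
  simp only [pderiv, Derivation.coe_comp, LinearMap.coe_comp, Derivation.coeFn_coe,
    Function.comp_apply, this]
  simp [Finsupp.single_apply, eq_comm]

/-- The chain rule. Values in a general module matter: values in `A / m²` give Taylor expansions at
a point, and values modulo the equation of the exceptional divisor control derivatives along it. -/
theorem derivation_apply [Fintype σ] {M : Type*} [AddCommGroup M] [Module k M] [Module A M]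
    [IsScalarTower k A M] (δ : Derivation k A M) (a : A) :
    δ a = ∑ i, h.pderiv i a • δ (x i) := by
  have h1 : δ a = δ.liftKaehlerDifferential (D k A a) := by simp
  conv_lhs => rw [h1, ← h.basis.sum_repr (D k A a), map_sum]
  refine Finset.sum_congr rfl fun i _ => ?_
  rw [map_smul]
  simp [basis, pderiv]

theorem eq_pderiv [Fintype σ] [DecidableEq σ] {i : σ} {δ : Derivation k A A}
    (hδ : ∀ j, δ (x j) = if i = j then 1 else 0) : δ = h.pderiv i := by
  ext a
  rw [h.derivation_apply δ a]
  simp [hδ]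

theorem pderiv_sub_algebraMap [Fintype σ] (c : σ → k) (i : σ) :
    (h.sub_algebraMap c).pderiv i = h.pderiv i := by
  classical
  refine h.eq_pderiv fun j => ?_
  rw [← (h.sub_algebraMap c).pderiv_apply_coord i j, map_sub, Derivation.map_algebraMap, sub_zero]

end IsCoordinateSystem

end Coordinates

/-! ### Second-order Taylor expansion at a rational point. -/

section Expansion

variable {k A σ : Type*} [Field k] [CommRing A] [Algebra k A] {x : σ → A}
  (h : IsCoordinateSystem k x) (ev : A →ₐ[k] k)

/-- The class of `a - a(p)` in `A / m²`, where `m` is the maximal ideal of a rational point `p`. -/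
noncomputable def pointDerivation : Derivation k A (A ⧸ (RingHom.ker ev) ^ 2) :=
  Derivation.mk'
    ((Ideal.Quotient.mkₐ k ((RingHom.ker ev) ^ 2)).toLinearMap ∘ₗ
      (LinearMap.id - (Algebra.linearMap k A) ∘ₗ ev.toLinearMap)) <| by
    intro a b
    have : ∀ c : A, c - algebraMap k A (ev c) ∈ RingHom.ker ev := fun c => by
      simp [RingHom.mem_ker]
    rw [Algebra.smul_def, Algebra.smul_def]
    simp only [LinearMap.comp_apply, LinearMap.sub_apply, LinearMap.id_apply,
      Algebra.linearMap_apply, AlgHom.toLinearMap_apply, Ideal.Quotient.algebraMap_eq,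
      Ideal.Quotient.mkₐ_eq_mk, ← map_mul, ← map_add]
    rw [eq_comm, Ideal.Quotient.eq]
    -- The defect in the Leibniz rule is exactly `(a - a(p)) (b - b(p))`.
    have h2 := Ideal.mul_mem_mul (this a) (this b)
    rw [← sq] at h2
    convert h2 using 1
    rw [map_mul, map_mul]
    ring

theorem pointDerivation_apply (a : A) :
    pointDerivation ev a = Ideal.Quotient.mk _ (a - algebraMap k A (ev a)) := rfl

include h in
-- The chain rule for `pointDerivation` gives this with coefficients `∂_i a` in `A`; replacing them
-- by their values at the point costs an element of `m · m`.
theorem sub_sum_mem_sq [Fintype σ] (hx : ∀ i, ev (x i) = 0) {a : A} (ha : ev a = 0) :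
    a - ∑ i, ev (h.pderiv i a) • x i ∈ RingHom.ker ev ^ 2 := by
  have h1 := h.derivation_apply (pointDerivation ev) a
  simp only [pointDerivation_apply, ha, hx, map_zero, sub_zero, Algebra.smul_def,
    Ideal.Quotient.algebraMap_eq, ← map_mul, ← map_sum] at h1
  rw [Ideal.Quotient.eq] at h1
  have h2 : ∑ i, (h.pderiv i a - algebraMap k A (ev (h.pderiv i a))) * x i ∈
      RingHom.ker ev ^ 2 := by
    refine sum_mem fun i _ => ?_
    rw [sq]
    exact Ideal.mul_mem_mul (by simp [RingHom.mem_ker]) (hx i)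
  have h3 := add_mem h1 h2
  convert h3 using 1
  simp only [sub_mul, Finset.sum_sub_distrib, Algebra.smul_def]
  ring

theorem eval_derivation_of_mem_sq (D : Derivation k A A) {a : A} (ha : a ∈ RingHom.ker ev ^ 2) :
    ev (D a) = 0 := by
  have := derivation_mem_pow D _ 1 ha
  rwa [pow_one] at this

theorem eval_derivation_derivation_of_mem_cube (D D' : Derivation k A A) {a : A}
    (ha : a ∈ RingHom.ker ev ^ 3) : ev (D (D' a)) = 0 :=
  eval_derivation_of_mem_sq ev D (derivation_mem_pow D' _ 2 ha)

theorem eval_derivation_derivation_mul (D D' : Derivation k A A) {a b : A}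
    (ha : ev a = 0) (hb : ev b = 0) :
    ev (D (D' (a * b))) = ev (D a) * ev (D' b) + ev (D' a) * ev (D b) := by
  simp only [Derivation.leibniz, smul_eq_mul, map_add, map_mul, ha, hb]
  ring

/-- The Hessian matrix at a rational point. -/
noncomputable def hessian (a : A) : Matrix σ σ k :=
  Matrix.of fun i j => ev (h.pderiv i (h.pderiv j a))

/-- Both claims are additive in `a`, so products of two elements of `m` suffice. For these the
Hessian is the symmetrised product of the two gradients, and the quadratic term is the product of
the two linear parts. -/
theorem hessian_spec [CharZero k] [Fintype σ] (hx : ∀ i, ev (x i) = 0) {a : A}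
    (ha : a ∈ RingHom.ker ev ^ 2) :
    (hessian h ev a).IsSymm ∧
      a - ∑ i, ∑ j, (((2 : k)⁻¹) • hessian h ev a) i j • (x i * x j) ∈ RingHom.ker ev ^ 3 := by
  rw [sq] at ha
  induction ha using Submodule.mul_induction_on' with
  | mem_mul_mem a ha b hb =>
    have ha' : ev a = 0 := ha
    have hb' : ev b = 0 := hb
    constructor
    · ext i j
      simp only [hessian, Matrix.transpose_apply, Matrix.of_apply,
        eval_derivation_derivation_mul ev _ _ ha' hb']
      ring
    · have h1 := sub_sum_mem_sq h ev hx ha'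
      have h2 := sub_sum_mem_sq h ev hx hb'
      set α := fun i => ev (h.pderiv i a)
      set β := fun i => ev (h.pderiv i b)
      have hα : ∑ i, β i • x i ∈ RingHom.ker ev :=
        sum_mem fun i _ => Submodule.smul_of_tower_mem _ _ (hx i)
      have h3 : ∑ i, ∑ j, (((2 : k)⁻¹) • hessian h ev (a * b)) i j • (x i * x j) =
          (∑ i, α i • x i) * (∑ i, β i • x i) := by
        have key : ∀ i j, (((2 : k)⁻¹) • hessian h ev (a * b)) i j =
            (2 : k)⁻¹ * (α i * β j) + (2 : k)⁻¹ * (α j * β i) := by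
          intro i j
          simp only [hessian, Matrix.smul_apply, Matrix.of_apply, smul_eq_mul,
            eval_derivation_derivation_mul ev _ _ ha' hb', α, β]
          ring
        have h4 : (∑ i, α i • x i) * (∑ i, β i • x i) =
            ∑ i, ∑ j, (α i * β j) • (x i * x j) := by
          rw [Finset.sum_mul_sum]
          refine Finset.sum_congr rfl fun i _ => Finset.sum_congr rfl fun j _ => ?_
          rw [smul_mul_smul_comm]
        have h5 : ∑ i, ∑ j, (α j * β i) • (x i * x j) =
            ∑ i, ∑ j, (α i * β j) • (x i * x j) := by
          rw [Finset.sum_comm]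
          refine Finset.sum_congr rfl fun i _ => Finset.sum_congr rfl fun j _ => ?_
          rw [mul_comm (x j)]
        simp only [key, add_smul, Finset.sum_add_distrib, mul_smul (2 : k)⁻¹]
        simp only [← Finset.smul_sum, h5, ← h4]
        rw [← add_smul, ← two_mul, mul_inv_cancel₀ two_ne_zero, one_smul]
      rw [h3]
      have h6 : a * b - (∑ i, α i • x i) * (∑ i, β i • x i) =
          a * (b - ∑ i, β i • x i) + (a - ∑ i, α i • x i) * (∑ i, β i • x i) := by ring
      rw [h6]
      refine add_mem ?_ ?_
      · rw [pow_succ']; exact Ideal.mul_mem_mul ha h2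
      · rw [pow_succ]; exact Ideal.mul_mem_mul h1 hα
  | add a _ b _ ha hb =>
    have : hessian h ev (a + b) = hessian h ev a + hessian h ev b := by
      ext i j; simp [hessian]
    rw [this]
    refine ⟨ha.1.add hb.1, ?_⟩
    have := add_mem ha.2 hb.2
    convert this using 1
    simp only [smul_add, Matrix.add_apply, add_smul, Finset.sum_add_distrib]
    ring

end Expansion

/-! ### Quadratic initial forms and Hessians. -/

section QuadraticInitialForm

variable {A σ : Type} [CommRing A] [Algebra ℂ A] {x : σ → A}
  (h : IsCoordinateSystem ℂ x) (ev : A →ₐ[ℂ] ℂ)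

theorem isLocalCoordinates_of_isCoordinateSystem {n : ℕ} {x : Fin n → A}
    (h : IsCoordinateSystem ℂ x) (hx : ∀ i, ev (x i) = 0) :
    IsLocalCoordinates (RingHom.ker ev) x where
  mem := hx
  existsUnique a ha := by
    classical
    refine ⟨fun i => ev (h.pderiv i a), sub_sum_mem_sq h ev hx ha, fun c hc => ?_⟩
    funext i
    have := eval_derivation_of_mem_sq ev (h.pderiv i) hc
    simp only [map_sub, map_sum, Derivation.map_smul, h.pderiv_apply_coord, map_smul,
      sub_eq_zero] at this
    simpa using this.symm

theorem hessian_sub_algebraMap [Fintype σ] (c : σ → ℂ) (f : A) :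
    hessian (h.sub_algebraMap c) ev f = hessian h ev f := by
  ext i j
  simp only [hessian, Matrix.of_apply, h.pderiv_sub_algebraMap]

theorem rank_two_inv_smul {m n : Type} [Fintype n] (M : Matrix m n ℂ) :
    ((2 : ℂ)⁻¹ • M).rank = M.rank :=
  Matrix.rank_smul_of_mem_nonZeroDivisors M
    (mem_nonZeroDivisors_of_ne_zero (inv_ne_zero two_ne_zero))

/-- Vanishing of `f` and of its first partials puts `f` in `m²`. After translating the coordinates
to the point, half the Hessian is the matrix of the quadratic form. -/
theorem hasQuadraticInitialForm_of_hessian [Fintype σ] {f : A} (hf : ev f = 0)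
    (hdf : ∀ i, ev (h.pderiv i f) = 0) (hne : hessian h ev f ≠ 0) :
    HasQuadraticInitialForm (RingHom.ker ev) f (hessian h ev f).rank := by
  set c : σ → ℂ := fun i => ev (x i)
  have h0 := h.sub_algebraMap c
  have hx : ∀ i, ev (x i - algebraMap ℂ A (c i)) = 0 := fun i => by simp [c]
  have hsq : f ∈ RingHom.ker ev ^ 2 := by
    have := sub_sum_mem_sq h0 ev hx hf
    simpa [h.pderiv_sub_algebraMap, hdf] using this
  obtain ⟨hsymm, hmem⟩ := hessian_spec h0 ev hx hsq
  rw [hessian_sub_algebraMap h] at hsymm hmem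
  let e := (Fintype.equivFin σ).symm
  refine ⟨Fintype.card σ, fun i => x (e i) - algebraMap ℂ A (c (e i)),
    ((2 : ℂ)⁻¹ • hessian h ev f).submatrix e e,
    isLocalCoordinates_of_isCoordinateSystem ev (h0.reindex e) fun i => hx (e i),
    (hsymm.smul _).submatrix e, ?_, ?_, ?_⟩
  · intro h1
    refine hne ?_
    have h2 : (2 : ℂ)⁻¹ • hessian h ev f = 0 := by
      ext i j
      have := congrFun (congrFun h1 (e.symm i)) (e.symm j)
      simpa using this
    exact (smul_eq_zero.mp h2).resolve_left (inv_ne_zero two_ne_zero)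
  · rw [Matrix.rank_submatrix, rank_two_inv_smul]
  · have h3 : ∑ i, ∑ j, (((2 : ℂ)⁻¹ • hessian h ev f).submatrix e e) i j •
        ((x (e i) - algebraMap ℂ A (c (e i))) * (x (e j) - algebraMap ℂ A (c (e j)))) =
        ∑ i, ∑ j, ((2 : ℂ)⁻¹ • hessian h ev f) i j •
        ((x i - algebraMap ℂ A (c i)) * (x j - algebraMap ℂ A (c j))) := by
      rw [← e.sum_comp]
      refine Finset.sum_congr rfl fun i _ => ?_
      rw [← e.sum_comp]
      rfl
    rw [h3]
    exact hmem

/-- The Hessian matrix in coordinates has at least the rank of the initial form. -/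
theorem le_rank_hessian [Fintype σ] {f : A} {ρ : ℕ}
    (hf : HasQuadraticInitialForm (RingHom.ker ev) f ρ) :
    f ∈ RingHom.ker ev ^ 2 ∧ 0 < ρ ∧ ρ ≤ (hessian h ev f).rank := by
  obtain ⟨n, z, M, hz, hMs, hM0, rfl, hfM⟩ := hf
  have hzev : ∀ i, ev (z i) = 0 := hz.mem
  have hsum : ∑ i, ∑ j, M i j • (z i * z j) ∈ RingHom.ker ev ^ 2 := by
    refine sum_mem fun i _ => sum_mem fun j _ => Submodule.smul_of_tower_mem _ _ ?_
    rw [sq]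
    exact Ideal.mul_mem_mul (hz.mem i) (hz.mem j)
  refine ⟨?_, ?_, ?_⟩
  · have := add_mem (Ideal.pow_le_pow_right (by norm_num : 2 ≤ 3) hfM) hsum
    simpa using this
  · rw [Nat.pos_iff_ne_zero]
    intro h0
    rw [Matrix.rank, Submodule.finrank_eq_zero, LinearMap.range_eq_bot] at h0
    refine hM0 (Matrix.ext_iff_mulVec.mpr fun v => ?_)
    rw [Matrix.zero_mulVec]
    exact LinearMap.congr_fun h0 v
  · classical
    set c : σ → ℂ := fun i => ev (x i)
    have h0 := h.sub_algebraMap c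
    have hx : ∀ i, ev (x i - algebraMap ℂ A (c i)) = 0 := fun i => by simp [c]
    -- `Y` expands the translated coordinates in the `z i` modulo `m²`; `Z` below expands the `z i`
    -- in the translated coordinates.
    choose Y hY _ using fun p => hz.existsUnique (x p - algebraMap ℂ A (c p)) (hx p)
    let Z : Matrix (Fin n) σ ℂ := Matrix.of fun i p => ev (h.pderiv p (z i))
    have hZ : ∀ i, z i - ∑ p, Z i p • (x p - algebraMap ℂ A (c p)) ∈ RingHom.ker ev ^ 2 := by
      intro i
      have := sub_sum_mem_sq h0 ev hx (hzev i)
      simp only [h.pderiv_sub_algebraMap] at this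
      exact this
    let Y' : Matrix σ (Fin n) ℂ := Matrix.of Y
    -- Both matrices express `z i` through the `z j` modulo `m²`, and such an expression is unique
    -- for local coordinates.
    have hZY : Z * Y' = 1 := by
      ext i j
      obtain ⟨w, -, hw⟩ := hz.existsUnique (z i) (hz.mem i)
      have h1 := hw (fun j => (Z * Y') i j) (by
        have h2 : ∑ p, Z i p • ((x p - algebraMap ℂ A (c p)) - ∑ j, Y p j • z j) ∈
            RingHom.ker ev ^ 2 :=
          sum_mem fun p _ => Submodule.smul_of_tower_mem _ _ (hY p)
        have h3 := add_mem (hZ i) h2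
        convert h3 using 1
        simp only [smul_sub, Finset.sum_sub_distrib, Finset.smul_sum, Matrix.mul_apply,
          Finset.sum_smul, smul_smul]
        rw [Finset.sum_comm]
        simp [Y'])
      have h2 := hw (fun j => (1 : Matrix (Fin n) (Fin n) ℂ) i j) (by
        simp [Matrix.one_apply])
      exact congrFun (h1.trans h2.symm) j
    -- Terms in `m³` do not contribute to second derivatives at the point, so the Hessian is twice
    -- the pullback of `M` along `Z`. The right inverse `Y'` of `Z` then recovers `M` from it, which
    -- bounds the rank of `M`.
    have hH : hessian h ev f = (2 : ℂ) • (Z.transpose * M * Z) := by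
      ext p q
      have h1 := eval_derivation_derivation_of_mem_cube ev (h.pderiv p) (h.pderiv q) hfM
      simp only [map_sub, map_sum, Derivation.map_smul, map_smul, sub_eq_zero,
        eval_derivation_derivation_mul ev _ _ (hzev _) (hzev _)] at h1
      rw [hessian, Matrix.of_apply, h1]
      have h2 : ∀ i j, M i j = M j i := fun i j => congrFun (congrFun hMs j) i
      have h3 : (Z.transpose * M * Z) p q = ∑ i, ∑ j, M i j * (Z i p * Z j q) := by
        simp only [Matrix.mul_apply, Matrix.transpose_apply, Finset.sum_mul]
        rw [Finset.sum_comm]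
        refine Finset.sum_congr rfl fun i _ => Finset.sum_congr rfl fun j _ => ?_
        ring
      have h4 : ∑ i, ∑ j, M i j * (Z i q * Z j p) = ∑ i, ∑ j, M i j * (Z i p * Z j q) := by
        rw [Finset.sum_comm]
        refine Finset.sum_congr rfl fun i _ => Finset.sum_congr rfl fun j _ => ?_
        rw [h2 j i]
        ring
      rw [Matrix.smul_apply, h3, smul_eq_mul, two_mul]
      nth_rewrite 2 [← h4]
      simp only [← Finset.sum_add_distrib, ← mul_add, smul_eq_mul]
      rfl
    have hM : M = Y'.transpose * ((2 : ℂ)⁻¹ • hessian h ev f) * Y' := by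
      have hYZ : Y'.transpose * Z.transpose = 1 := by
        rw [← Matrix.transpose_mul, hZY, Matrix.transpose_one]
      rw [hH, smul_smul, inv_mul_cancel₀ two_ne_zero, one_smul]
      calc M = (Y'.transpose * Z.transpose) * M * (Z * Y') := by rw [hYZ, hZY]; simp
        _ = _ := by simp only [Matrix.mul_assoc]
    calc M.rank = (Y'.transpose * ((2 : ℂ)⁻¹ • hessian h ev f) * Y').rank := by rw [← hM]
      _ ≤ (Y'.transpose * ((2 : ℂ)⁻¹ • hessian h ev f)).rank := Matrix.rank_mul_le_left _ _
      _ ≤ ((2 : ℂ)⁻¹ • hessian h ev f).rank := Matrix.rank_mul_le_right _ _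
      _ = _ := rank_two_inv_smul _

end QuadraticInitialForm

/-! ### Coordinate systems and étale maps to affine space -/

section Etale

open KaehlerDifferential TensorProduct

variable {k A σ : Type*} [CommRing k] [CommRing A] [Algebra k A]
  [Algebra (MvPolynomial σ k) A] [IsScalarTower k (MvPolynomial σ k) A]

theorem isCoordinateSystem_of_etale [Algebra.FormallyEtale (MvPolynomial σ k) A] :
    IsCoordinateSystem k fun i : σ => algebraMap (MvPolynomial σ k) A (.X i) :=
  .of_basis (((mvPolynomialBasis k σ).baseChange A).map
    (tensorKaehlerEquivOfFormallyEtale k (MvPolynomial σ k) A)) fun i => by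
      simp

/-- Coordinates identify the base-changed differentials of the polynomial ring with those of `A`. In
the Jacobi–Zariski sequence this kills the relative differentials and, since `H1` of the smooth
algebra `A` vanishes, the relative `H1` as well. -/
theorem IsCoordinateSystem.etale [Algebra.Smooth k A] [Finite σ]
    (h : IsCoordinateSystem k fun i : σ => algebraMap (MvPolynomial σ k) A (.X i)) :
    Algebra.Etale (MvPolynomial σ k) A := by
  have hbij : Function.Bijective (mapBaseChange k (MvPolynomial σ k) A) := by
    let e : A ⊗[MvPolynomial σ k] Ω[MvPolynomial σ k⁄k] ≃ₗ[A] Ω[A⁄k] :=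
      ((mvPolynomialBasis k σ).baseChange A).equiv h.basis (Equiv.refl _)
    have : (e : A ⊗[MvPolynomial σ k] Ω[MvPolynomial σ k⁄k] →ₗ[A] Ω[A⁄k]) =
        mapBaseChange k (MvPolynomial σ k) A := by
      refine ((mvPolynomialBasis k σ).baseChange A).ext fun i => ?_
      rw [LinearEquiv.coe_coe, Module.Basis.equiv_apply]
      simp [IsCoordinateSystem.basis]
    rw [← this]
    exact e.bijective
  have h1 : Subsingleton Ω[A⁄MvPolynomial σ k] := by
    refine subsingleton_of_forall_eq 0 fun y => ?_
    obtain ⟨y, rfl⟩ := KaehlerDifferential.map_surjective k (MvPolynomial σ k) A y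
    exact (exact_mapBaseChange_map k (MvPolynomial σ k) A y).mpr (hbij.surjective y)
  have h2 : Subsingleton (Algebra.H1Cotangent (MvPolynomial σ k) A) := by
    refine subsingleton_of_forall_eq 0 fun y => ?_
    have hy : Algebra.H1Cotangent.δ k (MvPolynomial σ k) A y = 0 := by
      refine hbij.injective ?_
      rw [map_zero]
      exact (Algebra.H1Cotangent.exact_δ_mapBaseChange k (MvPolynomial σ k) A _).mpr ⟨y, rfl⟩
    obtain ⟨w, rfl⟩ := (Algebra.H1Cotangent.exact_map_δ k (MvPolynomial σ k) A y).mp hy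
    rw [Subsingleton.elim w 0, map_zero]
  exact
    { formallyEtale := ⟨h1, h2⟩
      finitePresentation :=
        .of_restrict_scalars_finitePresentation k (MvPolynomial σ k) A }

end Etale

/-! ### The charts of the blow-up of a coordinate subspace -/

section Chart

open TensorProduct

/-- A chart of the blow-up of `Spec A` along the vanishing locus of the first coordinates
`x (Sum.inl i)`, in the direction `l`: an `A`-algebra `S`, smooth over `k`, with coordinates `y`
such that `x l = y l` and `x i = y l * y i` for `i ≠ l`. -/
structure IsBlowupChart (k : Type u) {A S ι τ : Type u} [DecidableEq ι] [CommRing k] [CommRing A]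
    [CommRing S] [Algebra k A] [Algebra k S] [Algebra A S] (x : ι ⊕ τ → A) (l : ι)
    (y : ι ⊕ τ → S) : Prop where
  smooth : Algebra.Smooth k S
  isCoordinateSystem : IsCoordinateSystem k y
  algebraMap_inl : ∀ i, algebraMap A S (x (.inl i)) =
    y (.inl l) * if i = l then 1 else y (.inl i)
  algebraMap_inr : ∀ j, algebraMap A S (x (.inr j)) = y (.inr j)
  mem_nonZeroDivisors : y (.inl l) ∈ nonZeroDivisors S
  adjoin_eq_top : Algebra.adjoin A (Set.range fun i => y (.inl i)) = ⊤
  exists_lift : ∀ {T : Type u} [CommRing T] [Algebra A T] (w : ι ⊕ τ → T),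
    (∀ i, algebraMap A T (x (.inl i)) = w (.inl l) * if i = l then 1 else w (.inl i)) →
    (∀ j, algebraMap A T (x (.inr j)) = w (.inr j)) → ∃ φ : S →ₐ[A] T, ∀ s, φ (y s) = w s

theorem algebraMap_mem_nonZeroDivisors_of_smooth {R S : Type*} [CommRing R] [CommRing S]
    [Algebra R S] [Algebra.Smooth R S] {r : R} (hr : r ∈ nonZeroDivisors R) :
    algebraMap R S r ∈ nonZeroDivisors S := by
  have hreg := Module.Flat.isSMulRegular_of_nonZeroDivisors (M := S) hr
  rw [mem_nonZeroDivisors_iff_right]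
  intro s hs
  refine hreg ?_
  change r • s = r • 0
  rw [smul_zero, Algebra.smul_def, mul_comm]
  exact hs

theorem algebraMap_tensorProduct_mem_nonZeroDivisors {R R' A : Type*} [CommRing R] [CommRing R']
    [CommRing A] [Algebra R R'] [Algebra R A] [Algebra.Smooth R A] {r : R'}
    (hr : r ∈ nonZeroDivisors R') :
    algebraMap R' (R' ⊗[R] A) r ∈ nonZeroDivisors (R' ⊗[R] A) :=
  algebraMap_mem_nonZeroDivisors_of_smooth hr

variable (k : Type u) {A ι τ : Type u} [DecidableEq ι] [Field k] [CommRing A]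
  [Algebra k A] [Algebra.Smooth k A] [Finite ι] [Finite τ] {x : ι ⊕ τ → A}

/-- The coordinates make `A` étale over a polynomial ring `P`, and `S` is the base change of `A`
along the standard blow-up chart `P → P'` of affine space. Smoothness and coordinates come from `S`
being étale over `P'`, regularity of `y l` from flatness, generation and the lifting property from
the tensor product. -/
theorem exists_isBlowupChart (h : IsCoordinateSystem k x) (l : ι) :
    ∃ (S : Type u) (_ : CommRing S) (_ : Algebra k S) (_ : Algebra A S) (_ : IsScalarTower k A S)
      (y : ι ⊕ τ → S), IsBlowupChart k x l y := by
  let P := MvPolynomial (ι ⊕ τ) k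
  -- The `ULift` makes `P'` a type different from `P`, so its algebra structure over `P` is the
  -- chart map `β` and cannot be confused with the identity.
  let P' := MvPolynomial (ULift.{u} (ι ⊕ τ)) k
  let y' : ι ⊕ τ → P' := fun s => MvPolynomial.X ⟨s⟩
  let β : P →ₐ[k] P' := MvPolynomial.aeval
    (Sum.elim (fun i => y' (.inl l) * if i = l then 1 else y' (.inl i)) (fun j => y' (.inr j)))
  let _ : Algebra P A := (MvPolynomial.aeval x : P →ₐ[k] A).toRingHom.toAlgebra
  have hPA : ∀ s, algebraMap P A (.X s) = x s := fun s => MvPolynomial.aeval_X x s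
  have _ : IsScalarTower k P A := IsScalarTower.of_algebraMap_eq fun c =>
    ((MvPolynomial.aeval x : P →ₐ[k] A).commutes c).symm
  let _ : Algebra P P' := β.toRingHom.toAlgebra
  have hβl : ∀ i, algebraMap P P' (.X (.inl i)) =
      y' (.inl l) * if i = l then 1 else y' (.inl i) := fun i => MvPolynomial.aeval_X _ _
  have hβr : ∀ j, algebraMap P P' (.X (.inr j)) = y' (.inr j) := fun j => MvPolynomial.aeval_X _ _
  have _ : IsScalarTower k P P' := IsScalarTower.of_algebraMap_eq fun c => (β.commutes c).symm
  have : Algebra.Etale P A := by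
    exact IsCoordinateSystem.etale ((congrArg (IsCoordinateSystem k) (funext hPA)).mpr h)
  let S := P' ⊗[P] A
  let _ : Algebra A S := Algebra.TensorProduct.includeRight.toRingHom.toAlgebra
  have hAS : ∀ a : A, algebraMap A S a = 1 ⊗ₜ a := fun a => rfl
  have _ : IsScalarTower P A S := IsScalarTower.of_algebraMap_eq fun p => by
    rw [hAS]
    exact Algebra.TensorProduct.algebraMap_apply' p
  have hPS : ∀ p : P, algebraMap A S (algebraMap P A p) = algebraMap P' S (algebraMap P P' p) := by
    intro p
    rw [← IsScalarTower.algebraMap_apply, ← IsScalarTower.algebraMap_apply]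
  have _ : IsScalarTower k A S := IsScalarTower.of_algebraMap_eq fun c => by
    rw [IsScalarTower.algebraMap_apply k P A, hPS, ← IsScalarTower.algebraMap_apply k P P',
      ← IsScalarTower.algebraMap_apply k P' S]
  let y : ι ⊕ τ → S := fun s => algebraMap P' S (y' s)
  refine ⟨S, inferInstance, inferInstance, inferInstance, inferInstance, y, ?_⟩
  have hetale : Algebra.Etale P' S := inferInstance
  have hsmooth : Algebra.Smooth k P' :=
    
    { formallySmooth := inferInstanceAs (Algebra.FormallySmooth k (MvPolynomial _ k))
      finitePresentation := .mvPolynomial k k (ULift.{u} (ι ⊕ τ)) }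
  have hX : y' (.inl l) ∈ nonZeroDivisors P' :=
    mem_nonZeroDivisors_of_ne_zero (MvPolynomial.X_ne_zero (R := k) _)
  have hnzd : y (.inl l) ∈ nonZeroDivisors S := by
    exact algebraMap_tensorProduct_mem_nonZeroDivisors (A := A) (R := P) hX
  refine ⟨Algebra.Smooth.comp k P' S, ?_, ?_, ?_, ?_, ?_, ?_⟩
  · exact (isCoordinateSystem_of_etale (k := k) (A := S)).reindex Equiv.ulift.symm
  · intro i
    rw [← hPA, hPS, hβl, map_mul]
    split_ifs <;> simp [y]
  · intro j
    rw [← hPA, hPS, hβr]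
  · exact hnzd
  · have hP : ∀ p : P', algebraMap P' S p ∈ Algebra.adjoin A (Set.range fun i => y (.inl i)) := by
      intro p
      induction p using MvPolynomial.induction_on with
      | C c =>
        change algebraMap P' S (algebraMap k P' c) ∈ _
        rw [← IsScalarTower.algebraMap_apply k P' S, IsScalarTower.algebraMap_apply k A S]
        exact Subalgebra.algebraMap_mem _ _
      | add p q hp hq =>
        rw [map_add]
        exact add_mem hp hq
      | mul_X p s hp =>
        rw [map_mul]
        refine mul_mem hp ?_
        obtain ⟨i | j⟩ := s
        · exact Algebra.subset_adjoin ⟨i, rfl⟩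
        · change algebraMap P' S (y' (.inr j)) ∈ _
          rw [← hβr, ← hPS]
          exact Subalgebra.algebraMap_mem _ _
    refine eq_top_iff.mpr fun s _ => ?_
    clear * - hP hAS
    induction s using TensorProduct.induction_on with
    | zero => exact zero_mem _
    | add a b ha hb => exact add_mem ha hb
    | tmul p a =>
      have : p ⊗ₜ[P] a = algebraMap P' S p * algebraMap A S a := by
        rw [hAS, Algebra.TensorProduct.algebraMap_apply, Algebra.TensorProduct.tmul_mul_tmul,
          mul_one, one_mul]
        rfl
      rw [this]
      exact mul_mem (hP p) (Subalgebra.algebraMap_mem _ a)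
  · intro T _ _ w hwl hwr
    let _ : Algebra P T := ((algebraMap A T).comp (algebraMap P A)).toAlgebra
    let _ : Algebra k T := ((algebraMap A T).comp (algebraMap k A)).toAlgebra
    have _ : IsScalarTower P A T := IsScalarTower.of_algebraMap_eq fun _ => rfl
    have _ : IsScalarTower k A T := IsScalarTower.of_algebraMap_eq fun _ => rfl
    have _ : IsScalarTower k P T := IsScalarTower.of_algebraMap_eq fun c => by
      rw [IsScalarTower.algebraMap_apply P A T, ← IsScalarTower.algebraMap_apply k P A,
        ← IsScalarTower.algebraMap_apply k A T]
    let f₀ : P' →ₐ[k] T := MvPolynomial.aeval fun s => w s.down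
    have hf₀ : ∀ s, f₀ (y' s) = w s := fun s => MvPolynomial.aeval_X _ _
    have hf₀' : (f₀.comp (IsScalarTower.toAlgHom k P P')) = IsScalarTower.toAlgHom k P T := by
      refine MvPolynomial.algHom_ext fun s => ?_
      rw [AlgHom.comp_apply, IsScalarTower.toAlgHom_apply, IsScalarTower.toAlgHom_apply,
        IsScalarTower.algebraMap_apply P A T, hPA]
      rcases s with i | j
      · rw [hβl, hwl, map_mul, hf₀]
        split_ifs <;> simp [hf₀]
      · rw [hβr, hwr, hf₀]
    let f : P' →ₐ[P] T := { f₀ with commutes' := fun p => DFunLike.congr_fun hf₀' p }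
    let g : A →ₐ[P] T := IsScalarTower.toAlgHom P A T
    let φ := Algebra.TensorProduct.productMap f g
    refine ⟨{ φ with commutes' := fun a => ?_ }, fun s => ?_⟩
    · change φ (1 ⊗ₜ a) = _
      simp [φ, g]
    · change φ (y' s ⊗ₜ 1) = _
      rw [Algebra.TensorProduct.productMap_apply_tmul, map_one, mul_one]
      exact hf₀ s

end Chart

/-! ### Minors -/

section Minors

theorem exists_linearIndependent_fun_of_finrank_span {K V : Type*} [Field K] [AddCommGroup V]
    [Module K V] [Module.Finite K V] (s : Set V) {r : ℕ}
    (h : Module.finrank K (Submodule.span K s) = r) :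
    ∃ f : Fin r → V, (∀ i, f i ∈ s) ∧ LinearIndependent K f := by
  subst h
  obtain ⟨f, hf, -, hli⟩ := Submodule.exists_fun_fin_finrank_span_eq K s
  exact ⟨f, hf, hli⟩

theorem exists_det_submatrix_ne_zero_of_linearIndependent {K n : Type*} [Field K] [Fintype n]
    {r : ℕ} (M : Matrix (Fin r) n K) (hM : LinearIndependent K M.row) :
    ∃ c : Fin r → n, (M.submatrix id c).det ≠ 0 := by
  have hrank : M.transpose.rank = r := by
    rw [Matrix.rank_transpose, hM.rank_matrix, Fintype.card_fin]
  rw [Matrix.rank_eq_finrank_span_row] at hrank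
  obtain ⟨f, hf, hli⟩ := exists_linearIndependent_fun_of_finrank_span _ hrank
  choose c hc using hf
  refine ⟨c, ?_⟩
  have h1 : (M.submatrix id c).transpose.row = f := funext hc
  rw [← Matrix.det_transpose, ← isUnit_iff_ne_zero, ← Matrix.isUnit_iff_isUnit_det,
    ← Matrix.linearIndependent_rows_iff_isUnit, h1]
  exact hli

theorem exists_det_submatrix_ne_zero {K m n : Type*} [Field K] [Fintype m] [Fintype n]
    (M : Matrix m n K) {r : ℕ} (hr : r = M.rank) :
    ∃ (a : Fin r → m) (c : Fin r → n), (M.submatrix a c).det ≠ 0 := by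
  rw [Matrix.rank_eq_finrank_span_row] at hr
  obtain ⟨f, hf, hli⟩ := exists_linearIndependent_fun_of_finrank_span _ hr.symm
  choose a ha using hf
  obtain ⟨c, hc⟩ := exists_det_submatrix_ne_zero_of_linearIndependent (M.submatrix a id) (by
    have h1 : (M.submatrix a id).row = f := funext ha
    rw [h1]
    exact hli)
  exact ⟨a, c, hc⟩

theorem linearIndependent_row_of_det_submatrix_ne_zero {K n : Type*} [Field K] {r : ℕ}
    (M : Matrix (Fin r) n K) (c : Fin r → n) (h : (M.submatrix id c).det ≠ 0) :
    LinearIndependent K M.row := by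
  have h1 : LinearIndependent K (M.submatrix id c).row := by
    rw [Matrix.linearIndependent_rows_iff_isUnit, Matrix.isUnit_iff_isUnit_det, isUnit_iff_ne_zero]
    exact h
  exact LinearIndependent.of_comp (LinearMap.funLeft K K c) h1

theorem le_rank_of_det_submatrix_ne_zero {K m n : Type*} [Field K] [Fintype m] [Fintype n] {r : ℕ}
    (M : Matrix m n K) (a : Fin r → m) (c : Fin r → n) (h : (M.submatrix a c).det ≠ 0) :
    r ≤ M.rank := by
  have h1 := (linearIndependent_row_of_det_submatrix_ne_zero (M.submatrix a id) c h).rank_matrix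
  rw [Fintype.card_fin] at h1
  rw [← h1]
  classical
  have h2 : M.submatrix a id = (1 : Matrix m m K).submatrix a id * M := by
    ext i j
    simp [Matrix.mul_apply, Matrix.one_apply]
  rw [h2]
  exact Matrix.rank_mul_le_right _ _

/-- Deleting a column which is a combination of the others does not affect the independence
of the rows. -/
theorem linearIndependent_row_submatrix_ne {K n : Type*} [Field K] [Fintype n] [DecidableEq n]
    {r : ℕ} (M : Matrix (Fin r) n K) (hM : LinearIndependent K M.row) {l : n} {v : n → K}
    (hv : v l = 1) (hMv : M.mulVec v = 0) :
    LinearIndependent K (M.submatrix id (Subtype.val : {j // j ≠ l} → n)).row := by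
  rw [Fintype.linearIndependent_iff] at hM ⊢
  intro g hg
  refine hM g ?_
  have h1 : ∀ j, j ≠ l → (∑ i, g i • M.row i) j = 0 := by
    intro j hj
    have := congrFun hg ⟨j, hj⟩
    simpa [Finset.sum_apply] using this
  -- The combination of rows is supported on column `l`; pairing it with `v`, which is `1` there,
  -- shows that this last entry vanishes too.
  have h2 : ∑ j, (∑ i, g i • M.row i) j * v j = 0 := by
    have h3 : ∀ i, ∑ j, M i j * v j = 0 := fun i => congrFun hMv i
    simp only [Finset.sum_apply, Finset.sum_mul, Pi.smul_apply, smul_eq_mul, mul_assoc,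
      Matrix.row_apply]
    rw [Finset.sum_comm]
    simp only [← Finset.mul_sum, h3, mul_zero, Finset.sum_const_zero]
  rw [Finset.sum_eq_single l (fun j _ hj => by rw [h1 j hj, zero_mul]) (by simp), hv,
    mul_one] at h2
  funext j
  by_cases hj : j = l
  · rw [hj]; exact h2
  · exact h1 j hj

end Minors

/-! ### Functions on a chart of the blow-up -/

namespace IsBlowupChart

variable {k A S ι τ : Type u} [DecidableEq ι] [Field k] [CommRing A]
    [CommRing S] [Algebra k A] [Algebra k S] [Algebra A S] {x : ι ⊕ τ → A} {l : ι}
    {y : ι ⊕ τ → S} (c : IsBlowupChart k x l y)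

variable (l y) in
/-- The functions `w i` on a chart of the blow-up such that `x i = y l * w i`. -/
def homogeneousCoord (i : ι) : S := if i = l then 1 else y (.inl i)

variable (l y) in
theorem homogeneousCoord_self : homogeneousCoord l y l = 1 := if_pos rfl

theorem homogeneousCoord_of_ne {i : ι} (hi : i ≠ l) : homogeneousCoord l y i = y (.inl i) :=
  if_neg hi

include c

theorem algebraMap_eq_mul (i : ι) :
    algebraMap A S (x (.inl i)) = y (.inl l) * homogeneousCoord l y i := c.algebraMap_inl i

theorem algebraMap_self : algebraMap A S (x (.inl l)) = y (.inl l) := by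
  rw [c.algebraMap_eq_mul, homogeneousCoord_self, mul_one]

theorem adjoin_homogeneousCoord : Algebra.adjoin A (Set.range (homogeneousCoord l y)) = ⊤ := by
  rw [eq_top_iff, ← c.adjoin_eq_top, Algebra.adjoin_le_iff]
  rintro _ ⟨i, rfl⟩
  by_cases hi : i = l
  · subst hi
    change y (.inl i) ∈ _
    rw [← c.algebraMap_self]
    exact Subalgebra.algebraMap_mem _ _
  · exact Algebra.subset_adjoin ⟨i, homogeneousCoord_of_ne hi⟩

theorem exists_pow_mul_eq_algebraMap (s : S) :
    ∃ (n : ℕ) (a : A), y (.inl l) ^ n * s = algebraMap A S a := by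
  have hs : s ∈ Algebra.adjoin A (Set.range (homogeneousCoord l y)) := by
    rw [c.adjoin_homogeneousCoord]; trivial
  induction hs using Algebra.adjoin_induction with
  | mem s hs =>
    obtain ⟨i, rfl⟩ := hs
    exact ⟨1, x (.inl i), by rw [pow_one, c.algebraMap_eq_mul]⟩
  | algebraMap a => exact ⟨0, a, by simp⟩
  | add s s' _ _ h h' =>
    obtain ⟨n, a, h⟩ := h
    obtain ⟨n', a', h'⟩ := h'
    refine ⟨n + n', x (.inl l) ^ n' * a + x (.inl l) ^ n * a', ?_⟩
    rw [map_add, map_mul, map_mul, map_pow, map_pow, c.algebraMap_self, ← h, ← h']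
    ring
  | mul s s' _ _ h h' =>
    obtain ⟨n, a, h⟩ := h
    obtain ⟨n', a', h'⟩ := h'
    refine ⟨n + n', a * a', ?_⟩
    rw [map_mul, ← h, ← h']
    ring

/-- The lifting property maps `S` to `A[1/x_l]` by sending `y i` to `x i / x l`, so an element that
dies in `S` already dies in that localization. With `exists_pow_mul_eq_algebraMap` this says that
the chart is an isomorphism off the exceptional divisor. -/
theorem exists_pow_mul_eq_zero {a : A} (ha : algebraMap A S a = 0) :
    ∃ n : ℕ, x (.inl l) ^ n * a = 0 := by
  let T := Localization.Away (x (.inl l))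
  have hinv : algebraMap A T (x (.inl l)) * IsLocalization.Away.invSelf (x (.inl l)) = 1 :=
    IsLocalization.Away.mul_invSelf _
  let w : ι ⊕ τ → T := Sum.elim
    (fun i => if i = l then algebraMap A T (x (.inl l)) else
      algebraMap A T (x (.inl i)) * IsLocalization.Away.invSelf (x (.inl l)))
    (fun j => algebraMap A T (x (.inr j)))
  obtain ⟨φ, -⟩ := c.exists_lift w (fun i => by
    simp only [w, Sum.elim_inl, if_true]
    split_ifs with hi
    · rw [hi, mul_one]
    · rw [mul_left_comm, hinv, mul_one]) (fun j => rfl)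
  have h1 : algebraMap A T a = 0 := by rw [← φ.commutes, ha, map_zero]
  obtain ⟨⟨_, n, rfl⟩, hn⟩ :=
    (IsLocalization.map_eq_zero_iff (Submonoid.powers (x (.inl l))) T a).mp h1
  exact ⟨n, hn⟩

/-! #### Differentiating along the exceptional divisor -/

/-- Moving along a fibre of the exceptional divisor does not move the image point. By the chain rule
modulo `y l` it is enough to differentiate the coordinates `x`: each `y l * w j` keeps its factor `y
l`, and the remaining coordinates do not involve `y i`. -/
theorem pderiv_algebraMap_mem [IsScalarTower k A S] [Fintype ι] [Fintype τ] [DecidableEq τ]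
    (h : IsCoordinateSystem k x) {i : ι} (hi : i ≠ l) (a : A) :
    c.isCoordinateSystem.pderiv (.inl i) (algebraMap A S a) ∈ Ideal.span {y (.inl l)} := by
  set I := Ideal.span {y (.inl l)}
  let δ : Derivation k A (S ⧸ I) :=
    Derivation.compAlgebraMap A
      ((Algebra.linearMap S (S ⧸ I)).compDer (c.isCoordinateSystem.pderiv (.inl i)))
  have hδ : ∀ a, δ a = Ideal.Quotient.mk I (c.isCoordinateSystem.pderiv (.inl i)
    (algebraMap A S a)) := fun a => rfl
  rw [← Ideal.Quotient.eq_zero_iff_mem, ← hδ, h.derivation_apply δ a]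
  refine Finset.sum_eq_zero fun s _ => ?_
  have hl : c.isCoordinateSystem.pderiv (.inl i) (y (.inl l)) = 0 := by
    rw [c.isCoordinateSystem.pderiv_apply_coord, if_neg (by simpa using hi)]
  have : δ (x s) = 0 := by
    rw [hδ, Ideal.Quotient.eq_zero_iff_mem]
    rcases s with j | j
    · rw [c.algebraMap_eq_mul, Derivation.leibniz, hl, smul_zero, add_zero]
      exact Ideal.mul_mem_right _ _ (Ideal.mem_span_singleton_self _)
    · rw [c.algebraMap_inr, c.isCoordinateSystem.pderiv_apply_coord, if_neg (by simp)]
      exact zero_mem _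
  rw [this, smul_zero]

end IsBlowupChart

namespace IsBlowupChart

variable {k A S ι τ : Type u} [DecidableEq ι] [Field k] [CommRing A]
    [CommRing S] [Algebra k A] [Algebra k S] [Algebra A S] {x : ι ⊕ τ → A} {l : ι}
    {y : ι ⊕ τ → S} (c : IsBlowupChart k x l y)

/-! #### The exceptional divisor -/

include c in
-- The exceptional divisor is an affine space over the centre: `θ` sends `y l` to `0` and every
-- other `y i` to a variable, and a map back to `S / (y l)` shows that nothing more is killed. The
-- variable indexed by `l` is a dummy that goes back to `0`.
theorem mem_span_iff_of_exists_hom [Fintype ι] :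
    ∃ θ : S →ₐ[A] MvPolynomial ι (A ⧸ Ideal.span (Set.range fun i => x (.inl i))),
      ∀ s, θ s = 0 ↔ s ∈ Ideal.span {y (.inl l)} := by
  set J := Ideal.span (Set.range fun i => x (.inl i)) with hJ
  have hxJ : ∀ i, Ideal.Quotient.mk J (x (.inl i)) = 0 := fun i =>
    Ideal.Quotient.eq_zero_iff_mem.mpr (Ideal.subset_span ⟨i, rfl⟩)
  have hA : ∀ a, algebraMap A (MvPolynomial ι (A ⧸ J)) a = .C (Ideal.Quotient.mk J a) :=
    fun a => rfl
  obtain ⟨θ, hθ⟩ := c.exists_lift (T := MvPolynomial ι (A ⧸ J))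
    (Sum.elim (fun i => if i = l then 0 else .X i) (fun j => .C (Ideal.Quotient.mk J (x (.inr j)))))
    (fun i => by rw [hA, hxJ, map_zero, Sum.elim_inl, if_pos rfl, zero_mul])
    (fun j => hA _)
  set I := Ideal.span {y (.inl l)} with hI
  have hJI : ∀ a ∈ J, algebraMap A (S ⧸ I) a = 0 := by
    intro a ha
    have : J ≤ RingHom.ker (algebraMap A (S ⧸ I)) := by
      rw [hJ, Ideal.span_le]
      rintro _ ⟨i, rfl⟩
      rw [SetLike.mem_coe, RingHom.mem_ker, IsScalarTower.algebraMap_apply A S (S ⧸ I),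
        c.algebraMap_eq_mul, Ideal.Quotient.algebraMap_eq, Ideal.Quotient.eq_zero_iff_mem]
      exact Ideal.mul_mem_right _ _ (Ideal.mem_span_singleton_self _)
    exact this ha
  let ψ : MvPolynomial ι (A ⧸ J) →+* S ⧸ I :=
    MvPolynomial.eval₂Hom (Ideal.Quotient.lift J (algebraMap A (S ⧸ I)) hJI)
      (fun i => Ideal.Quotient.mk I (y (.inl i)))
  let ψ' : MvPolynomial ι (A ⧸ J) →ₐ[A] S ⧸ I :=
    { ψ with
      commutes' := fun a => by
        change ψ (.C (Ideal.Quotient.mk J a)) = _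
        simp [ψ] }
  have hψ : ∀ p, ψ' p = ψ p := fun p => rfl
  have hl : Ideal.Quotient.mk I (y (.inl l)) = 0 :=
    Ideal.Quotient.eq_zero_iff_mem.mpr (Ideal.mem_span_singleton_self _)
  have hcomp : ψ'.comp θ = IsScalarTower.toAlgHom A S (S ⧸ I) := by
    refine AlgHom.ext_of_adjoin_eq_top c.adjoin_eq_top ?_
    rintro _ ⟨i, rfl⟩
    rw [AlgHom.comp_apply, hθ, Sum.elim_inl, IsScalarTower.toAlgHom_apply,
      Ideal.Quotient.algebraMap_eq]
    split_ifs with hi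
    · rw [hi, hl, map_zero]
    · simp [hψ, ψ]
  refine ⟨θ, fun s => ⟨fun hs => ?_, fun hs => ?_⟩⟩
  · have := DFunLike.congr_fun hcomp s
    rw [AlgHom.comp_apply, hs, map_zero, IsScalarTower.toAlgHom_apply,
      Ideal.Quotient.algebraMap_eq] at this
    exact Ideal.Quotient.eq_zero_iff_mem.mp this.symm
  · obtain ⟨s, rfl⟩ := Ideal.mem_span_singleton'.mp hs
    rw [map_mul, hθ, Sum.elim_inl, if_pos rfl, mul_zero]

include c in
theorem isPrime_span [Fintype ι] (hJ : (Ideal.span (Set.range fun i => x (.inl i))).IsPrime) :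
    (Ideal.span {y (.inl l)}).IsPrime := by
  obtain ⟨θ, hθ⟩ := c.mem_span_iff_of_exists_hom
  have : Ideal.span {y (.inl l)} = RingHom.ker θ := by
    ext s
    rw [RingHom.mem_ker, hθ]
  rw [this]
  exact RingHom.ker_isPrime _

include c in
theorem mem_of_algebraMap_mem_span [Fintype ι] {a : A}
    (ha : algebraMap A S a ∈ Ideal.span {y (.inl l)}) :
    a ∈ Ideal.span (Set.range fun i => x (.inl i)) := by
  obtain ⟨θ, hθ⟩ := c.mem_span_iff_of_exists_hom
  rw [← hθ, AlgHom.commutes] at ha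
  change MvPolynomial.C (Ideal.Quotient.mk _ a) = 0 at ha
  rwa [map_eq_zero_iff _ (MvPolynomial.C_injective _ _), Ideal.Quotient.eq_zero_iff_mem] at ha

/-! #### The strict transform of a hypersurface -/

section StrictTransform

variable [Fintype ι] (a : Matrix ι ι A)

variable (l y) in
/-- The gradient, up to a factor of two, of `strictTransform` along the exceptional divisor. -/
def halfGradient (i : ι) : S := ∑ j, algebraMap A S (a i j) * homogeneousCoord l y j

variable (l y) in
/-- The strict transform of the function `∑ i, ∑ j, a i j * (x i * x j)`. -/
def strictTransform : S := ∑ i, homogeneousCoord l y i * halfGradient l y a i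

include c in
theorem algebraMap_eq_sq_mul_strictTransform :
    algebraMap A S (∑ i, ∑ j, a i j * (x (.inl i) * x (.inl j))) =
      y (.inl l) ^ 2 * strictTransform l y a := by
  simp only [map_sum, map_mul, c.algebraMap_eq_mul, strictTransform, halfGradient,
    Finset.mul_sum]
  refine Finset.sum_congr rfl fun i _ => Finset.sum_congr rfl fun j _ => ?_
  ring

variable [IsScalarTower k A S] [Fintype τ] [DecidableEq τ] (h : IsCoordinateSystem k x)

omit [Fintype ι] [IsScalarTower k A S] [Fintype τ] in
theorem pderiv_homogeneousCoord {i : ι} (hi : i ≠ l) (j : ι) :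
    c.isCoordinateSystem.pderiv (.inl i) (homogeneousCoord l y j) = if j = i then 1 else 0 := by
  by_cases hj : j = l
  · subst hj
    rw [homogeneousCoord_self, Derivation.map_one_eq_zero, if_neg hi.symm]
  · rw [homogeneousCoord_of_ne hj, c.isCoordinateSystem.pderiv_apply_coord]
    simp only [Sum.inl.injEq, eq_comm]

omit [Fintype ι] [IsScalarTower k A S] [Fintype τ] in
theorem pderiv_mem_span {i : ι} (hi : i ≠ l) {s : S} (hs : s ∈ Ideal.span {y (.inl l)}) :
    c.isCoordinateSystem.pderiv (.inl i) s ∈ Ideal.span {y (.inl l)} := by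
  obtain ⟨s, rfl⟩ := Ideal.mem_span_singleton'.mp hs
  rw [Derivation.leibniz, c.isCoordinateSystem.pderiv_apply_coord, if_neg (by simpa using hi),
    smul_zero, zero_add, smul_eq_mul]
  exact Ideal.mul_mem_right _ _ (Ideal.mem_span_singleton_self _)

include h in
-- Modulo `y l` the coefficients are constant in the direction `i`, so only the factor `w i`
-- contributes to the derivative.
theorem pderiv_halfGradient_sub_mem {i : ι} (hi : i ≠ l) (j : ι) :
    c.isCoordinateSystem.pderiv (.inl i) (halfGradient l y a j) - algebraMap A S (a j i) ∈
      Ideal.span {y (.inl l)} := by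
  have h1 : c.isCoordinateSystem.pderiv (.inl i) (halfGradient l y a j) - algebraMap A S (a j i) =
      ∑ m, homogeneousCoord l y m *
        c.isCoordinateSystem.pderiv (.inl i) (algebraMap A S (a j m)) := by
    simp only [halfGradient, map_sum, Derivation.leibniz, c.pderiv_homogeneousCoord hi,
      Finset.sum_add_distrib, smul_eq_mul, mul_ite, mul_one, mul_zero, Finset.sum_ite_eq',
      Finset.mem_univ, if_true]
    ring
  rw [h1]
  exact sum_mem fun m _ => Ideal.mul_mem_left _ _ (c.pderiv_algebraMap_mem h hi _)

include h in
theorem pderiv_strictTransform_sub_mem (ha : a.IsSymm) {i : ι} (hi : i ≠ l) :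
    c.isCoordinateSystem.pderiv (.inl i) (strictTransform l y a) - 2 * halfGradient l y a i ∈
      Ideal.span {y (.inl l)} := by
  have h1 : c.isCoordinateSystem.pderiv (.inl i) (strictTransform l y a) -
      2 * halfGradient l y a i =
      ∑ j, homogeneousCoord l y j *
        (c.isCoordinateSystem.pderiv (.inl i) (halfGradient l y a j) -
          algebraMap A S (a j i)) := by
    have h2 : ∑ j, homogeneousCoord l y j * algebraMap A S (a j i) = halfGradient l y a i :=
      Finset.sum_congr rfl fun j _ => by rw [ha.apply i j, mul_comm]
    simp only [strictTransform, map_sum, Derivation.leibniz, c.pderiv_homogeneousCoord hi,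
      Finset.sum_add_distrib, smul_eq_mul, mul_ite, mul_one, mul_zero, Finset.sum_ite_eq',
      Finset.mem_univ, if_true, mul_sub, Finset.sum_sub_distrib, h2]
    ring
  rw [h1]
  exact sum_mem fun m _ => Ideal.mul_mem_left _ _ (c.pderiv_halfGradient_sub_mem a h hi _)

theorem two_mul_mem_iff [CharZero k] (Q : Ideal S) (s : S) : 2 * s ∈ Q ↔ s ∈ Q := by
  refine ⟨fun hs => ?_, fun hs => Ideal.mul_mem_left _ _ hs⟩
  have h1 : (2 : k)⁻¹ • (2 * s) ∈ Q := Submodule.smul_of_tower_mem _ _ hs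
  have h2 : (2 : k)⁻¹ • (2 * s) = s := by
    have : (2 : S) * s = (2 : k) • s := by
      rw [Algebra.smul_def, map_ofNat]
    rw [this, smul_smul, inv_mul_cancel₀ two_ne_zero, one_smul]
  rwa [h2] at h1

include h in
-- For `i ≠ l` these are half the partial derivatives of the strict transform, modulo `y l`. The
-- missing index is recovered from `F = g_l + ∑_{j ≠ l} w_j g_j`, using `w_l = 1`.
theorem halfGradient_mem [CharZero k] (ha : a.IsSymm) {Q : Ideal S} (hQ : y (.inl l) ∈ Q)
    (hf : strictTransform l y a ∈ Q)
    (hD : ∀ i, i ≠ l → c.isCoordinateSystem.pderiv (.inl i) (strictTransform l y a) ∈ Q) (i : ι) :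
    halfGradient l y a i ∈ Q := by
  have hle : Ideal.span {y (.inl l)} ≤ Q := by simpa [Ideal.span_le] using hQ
  have key : ∀ i, i ≠ l → halfGradient l y a i ∈ Q := by
    intro i hi
    rw [← two_mul_mem_iff (k := k)]
    have := sub_mem (hD i hi) (hle (c.pderiv_strictTransform_sub_mem a h ha hi))
    rwa [sub_sub_cancel] at this
  by_cases hi : i = l
  · subst hi
    rw [strictTransform, ← Finset.add_sum_erase _ _ (Finset.mem_univ i), homogeneousCoord_self,
      one_mul] at hf
    refine (Ideal.add_mem_iff_left _ ?_).mp hf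
    exact sum_mem fun j hj => Ideal.mul_mem_left _ _ (key j (Finset.ne_of_mem_erase hj))
  · exact key i hi

include c h in
-- If `y l` divided `F`, differentiating twice along the exceptional divisor would make `y l` divide
-- every `a i j` with `j ≠ l`, then the column `l` too through the half gradient. All entries of `a`
-- would then vanish on the centre.
theorem strictTransform_notMem [CharZero k] (ha : a.IsSymm) {p q : ι}
    (hpq : a p q ∉ Ideal.span (Set.range fun i => x (.inl i))) :
    strictTransform l y a ∉ Ideal.span {y (.inl l)} := by
  intro hf
  have h1 := c.halfGradient_mem a h ha (Ideal.mem_span_singleton_self _) hf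
    (fun i hi => c.pderiv_mem_span hi hf)
  have h2 : ∀ j, j ≠ l → ∀ i, algebraMap A S (a i j) ∈ Ideal.span {y (.inl l)} := by
    intro j hj i
    have := sub_mem (c.pderiv_mem_span hj (h1 i)) (c.pderiv_halfGradient_sub_mem a h hj i)
    rwa [sub_sub_cancel] at this
  refine hpq (c.mem_of_algebraMap_mem_span ?_)
  by_cases hq : q = l
  · subst hq
    have h3 := h1 p
    rw [halfGradient, ← Finset.add_sum_erase _ _ (Finset.mem_univ q), homogeneousCoord_self,
      mul_one] at h3
    refine (Ideal.add_mem_iff_left _ ?_).mp h3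
    exact sum_mem fun j hj => Ideal.mul_mem_right _ _ (h2 j (Finset.ne_of_mem_erase hj) p)
  · exact h2 q hq p

include c h in
-- The exceptional divisor is integral and `F` does not vanish on it, so `y l` stays regular modulo
-- `F`. This makes `F = 0` a chart of the blow-up of the hypersurface, with no spurious part
-- supported on the exceptional divisor.
theorem mem_nonZeroDivisors_quotient [CharZero k] (ha : a.IsSymm)
    (hJ : (Ideal.span (Set.range fun i => x (.inl i))).IsPrime) {p q : ι}
    (hpq : a p q ∉ Ideal.span (Set.range fun i => x (.inl i))) :
    Ideal.Quotient.mk (Ideal.span {strictTransform l y a}) (y (.inl l)) ∈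
      nonZeroDivisors (S ⧸ Ideal.span {strictTransform l y a}) := by
  rw [mem_nonZeroDivisors_iff_right]
  intro s hs
  obtain ⟨s, rfl⟩ := Ideal.Quotient.mk_surjective s
  rw [← map_mul, Ideal.Quotient.eq_zero_iff_mem] at hs
  obtain ⟨v, hv⟩ := Ideal.mem_span_singleton'.mp hs
  have h1 : v * strictTransform l y a ∈ Ideal.span {y (.inl l)} := by
    rw [hv]
    exact Ideal.mul_mem_left _ _ (Ideal.mem_span_singleton_self _)
  obtain ⟨v, rfl⟩ := Ideal.mem_span_singleton'.mp
    (((c.isPrime_span hJ).mem_or_mem h1).resolve_right (c.strictTransform_notMem a h ha hpq))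
  rw [Ideal.Quotient.eq_zero_iff_mem, Ideal.mem_span_singleton']
  refine ⟨v, ?_⟩
  have h2 : (s - v * strictTransform l y a) * y (.inl l) = 0 := by
    linear_combination -hv
  have h3 := mem_nonZeroDivisors_iff_right.mp c.mem_nonZeroDivisors _ h2
  linear_combination -h3

/-- The height estimate for singular points of the strict transform on the exceptional divisor. -/
theorem succ_le_height {k A S ι τ : Type u} [DecidableEq ι] [Field k] [CharZero k] [CommRing A]
    [CommRing S] [Algebra k A] [Algebra k S] [Algebra A S] {x : ι ⊕ τ → A} {l : ι}
    {y : ι ⊕ τ → S} (c : IsBlowupChart k x l y) [Fintype ι] (a : Matrix ι ι A)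
    [IsScalarTower k A S] [Fintype τ] [DecidableEq τ] (h : IsCoordinateSystem k x)
    (ha : a.IsSymm) {r : ℕ} (b d : Fin r → ι) (hdet : IsUnit (a.submatrix b d).det)
    {Q : Ideal S} [Q.IsPrime] (hQ : y (.inl l) ∈ Q) (hf : strictTransform l y a ∈ Q)
    (hD : ∀ i, i ≠ l → c.isCoordinateSystem.pderiv (.inl i) (strictTransform l y a) ∈ Q) :
    ((r + 1 : ℕ) : ℕ∞) ≤ Q.height := by
  have hgrad := c.halfGradient_mem a h ha hQ hf hD
  have hle : Ideal.span {y (.inl l)} ≤ Q := by simpa [Ideal.span_le] using hQ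
  -- All ranks are computed over the residue field of `Q`, since `Q` need not be a closed point.
  let K := FractionRing (S ⧸ Q)
  let π : S →+* K := (algebraMap (S ⧸ Q) K).comp (Ideal.Quotient.mk Q)
  have hπ : ∀ s, π s = 0 ↔ s ∈ Q := by
    intro s
    rw [RingHom.comp_apply, map_eq_zero_iff _ (IsFractionRing.injective (S ⧸ Q) K),
      Ideal.Quotient.eq_zero_iff_mem]
  let ρ : A →+* K := π.comp (algebraMap A S)
  let M : Matrix (Fin r) ι K := (a.map ρ).submatrix b id
  have hMv : M.mulVec (fun i => π (homogeneousCoord l y i)) = 0 := by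
    funext i
    have := (hπ _).mpr (hgrad (b i))
    simpa [halfGradient, M, ρ, Matrix.mulVec, dotProduct] using this
  have hMli : LinearIndependent K M.row := by
    refine linearIndependent_row_of_det_submatrix_ne_zero M d ?_
    have : M.submatrix id d = (a.submatrix b d).map ρ := rfl
    rw [this, ← RingHom.mapMatrix_apply, ← RingHom.map_det]
    exact (hdet.map ρ).ne_zero
  -- The vector `w` is killed by the chosen rows of `a` and has entry `1` at `l`, so column `l` can
  -- be dropped without losing independence.
  obtain ⟨e, he⟩ := exists_det_submatrix_ne_zero_of_linearIndependent _
    (linearIndependent_row_submatrix_ne M hMli (l := l)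
      (by rw [homogeneousCoord_self, map_one]) hMv)
  -- The extra direction `y l` supplies the `+ 1`. The Jacobian is block triangular because `y l`
  -- has zero derivative in the directions `e i ≠ l`.
  let D : Fin r ⊕ Unit → Derivation k S S := Sum.elim
    (fun i => c.isCoordinateSystem.pderiv (.inl (e i)))
    (fun _ => c.isCoordinateSystem.pderiv (.inl l))
  let g : Fin r ⊕ Unit → S := Sum.elim (fun i => halfGradient l y a (b i)) (fun _ => y (.inl l))
  have hcard := card_le_height_of_derivation Q D g
    (by rintro (i | i)
        · exact hgrad _
        · exact hQ) (by
      let G : Matrix (Fin r) (Fin r) S := Matrix.of fun i j =>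
        c.isCoordinateSystem.pderiv (.inl (e i)) (halfGradient l y a (b j))
      have hG : (Matrix.of fun i j => D i (g j)) = Matrix.fromBlocks G 0
          (Matrix.of fun _ j => c.isCoordinateSystem.pderiv (.inl l) (halfGradient l y a (b j)))
          1 := by
        ext i j
        rcases i with i | i <;> rcases j with j | j
        · rfl
        · simp only [Matrix.of_apply, D, g, Sum.elim_inl, Sum.elim_inr, Matrix.fromBlocks_apply₁₂,
            c.isCoordinateSystem.pderiv_apply_coord, Matrix.zero_apply]
          rw [if_neg (by simpa using (e i).2)]
        · rfl
        · simp [D, g, c.isCoordinateSystem.pderiv_apply_coord]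
      rw [hG, Matrix.det_fromBlocks_zero₁₂, Matrix.det_one, mul_one, ← hπ, RingHom.map_det]
      have : π.mapMatrix G = ((M.submatrix id Subtype.val).submatrix id e).transpose := by
        ext i j
        have h1 := (hπ _).mpr (hle (c.pderiv_halfGradient_sub_mem a h (e i).2 (b j)))
        rw [map_sub, sub_eq_zero] at h1
        exact h1
      rw [this, Matrix.det_transpose]
      exact he)
  simpa using hcard

end StrictTransform

end IsBlowupChart

/-! ### Étale base change and localization -/

section BaseChange

open KaehlerDifferential TensorProduct

theorem exists_derivation_extension {k A : Type*} [CommRing k] [CommRing A] [Algebra k A]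
    (B : Type*) [CommRing B] [Algebra k B] [Algebra A B] [IsScalarTower k A B]
    [Algebra.FormallyEtale A B] (D : Derivation k A A) :
    ∃ D' : Derivation k B B, ∀ a, D' (algebraMap A B a) = algebraMap A B (D a) := by
  let e := tensorKaehlerEquivOfFormallyEtale k A B
  let L : B ⊗[A] Ω[A⁄k] →ₗ[B] B :=
    (AlgebraTensorModule.rid A B B).toLinearMap ∘ₗ D.liftKaehlerDifferential.baseChange B
  refine ⟨(L ∘ₗ e.symm.toLinearMap).compDer (KaehlerDifferential.D k B), fun a => ?_⟩
  have h1 : e.symm (KaehlerDifferential.D k B (algebraMap A B a)) =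
      1 ⊗ₜ KaehlerDifferential.D k A a := by
    rw [LinearEquiv.symm_apply_eq]
    simp [e]
  change L (e.symm _) = _
  refine (congrArg L h1).trans ?_
  simp [L, Algebra.algebraMap_eq_smul_one]

theorem IsCoordinateSystem.algebraMap {k A σ : Type*} [CommRing k] [CommRing A] [Algebra k A]
    {x : σ → A} (h : IsCoordinateSystem k x) (B : Type*) [CommRing B] [Algebra k B] [Algebra A B]
    [IsScalarTower k A B] [Algebra.FormallyEtale A B] :
    IsCoordinateSystem k fun i => algebraMap A B (x i) :=
  .of_basis ((h.basis.baseChange B).map (tensorKaehlerEquivOfFormallyEtale k A B)) fun i => by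
    simp [IsCoordinateSystem.basis]

end BaseChange

/-! ### Closed points as evaluations. -/

section Points

theorem exists_ker_eq_of_isMaximal {S : Type*} [CommRing S] [Algebra ℂ S]
    [Algebra.FiniteType ℂ S] (m : Ideal S) [m.IsMaximal] :
    ∃ ev : S →ₐ[ℂ] ℂ, RingHom.ker ev = m := by
  let _ := Ideal.Quotient.field m
  have : Module.Finite ℂ (S ⧸ m) := finite_of_finite_type_of_isJacobsonRing ℂ (S ⧸ m)
  have hb := IsAlgClosed.algebraMap_bijective_of_isIntegral (k := ℂ) (K := S ⧸ m)
  let e : ℂ ≃ₐ[ℂ] S ⧸ m := AlgEquiv.ofBijective (Algebra.ofId ℂ (S ⧸ m)) hb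
  refine ⟨(e.symm : S ⧸ m →ₐ[ℂ] ℂ).comp (Ideal.Quotient.mkₐ ℂ m), ?_⟩
  ext s
  simp [RingHom.mem_ker, Ideal.Quotient.eq_zero_iff_mem]

end Points

/-! ### The Hessian of the strict transform. -/

namespace IsBlowupChart

theorem exists_hasQuadraticInitialForm {A S ι τ : Type} [DecidableEq ι] [CommRing A]
    [CommRing S] [Algebra ℂ A] [Algebra ℂ S] [Algebra A S] {x : ι ⊕ τ → A} {l : ι}
    {y : ι ⊕ τ → S} (c : IsBlowupChart ℂ x l y) [Fintype ι] (a : Matrix ι ι A)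
    [IsScalarTower ℂ A S] [Fintype τ] [DecidableEq τ] (h : IsCoordinateSystem ℂ x)
    (ha : a.IsSymm) {r : ℕ} (hr : 0 < r) (b d : Fin r → ι) (hdet : IsUnit (a.submatrix b d).det)
    (ev : S →ₐ[ℂ] ℂ) (hl : ev (y (.inl l)) = 0) (hf : ev (strictTransform l y a) = 0)
    (hD : ∀ s, ev (c.isCoordinateSystem.pderiv s (strictTransform l y a)) = 0) :
    ∃ ρ, r ≤ ρ ∧ HasQuadraticInitialForm (RingHom.ker ev) (strictTransform l y a) ρ := by
  have hle : Ideal.span {y (.inl l)} ≤ RingHom.ker ev := by simpa [Ideal.span_le] using hl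
  have hgrad := c.halfGradient_mem a h ha (Q := RingHom.ker ev) hl hf (fun i _ => hD _)
  let φ : A →+* ℂ := (ev : S →+* ℂ).comp (algebraMap A S)
  let N : Matrix ι ι ℂ := a.map φ
  let v : ι → ℂ := fun i => ev (homogeneousCoord l y i)
  have hvl : v l = 1 := by simp [v, homogeneousCoord_self]
  have hNv : N.mulVec v = 0 := by
    funext i
    have h1 : ev (halfGradient l y a i) = 0 := hgrad i
    simpa [halfGradient, N, φ, Matrix.mulVec, dotProduct, v] using h1
  have hNs : ∀ i j, N i j = N j i := fun i j => congrArg φ (ha.apply j i)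
  have key : ∀ b d : Fin r → ι, (N.submatrix b d).det ≠ 0 →
      ∃ e : Fin r → {i // i ≠ l}, (N.submatrix b (fun i => (e i : ι))).det ≠ 0 := by
    intro b d hdet
    exact exists_det_submatrix_ne_zero_of_linearIndependent _
      (linearIndependent_row_submatrix_ne (N.submatrix b id)
        (linearIndependent_row_of_det_submatrix_ne_zero (N.submatrix b id) d hdet) hvl
        (funext fun i => congrFun hNv (b i)))
  obtain ⟨e, he⟩ := key b d (by
    have : N.submatrix b d = (a.submatrix b d).map φ := rfl
    rw [this, ← RingHom.mapMatrix_apply, ← RingHom.map_det]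
    exact (hdet.map φ).ne_zero)
  -- The column `l` has been removed; symmetry of `N` turns the remaining rows into columns, so the
  -- same argument removes the row `l`.
  obtain ⟨e', he'⟩ := key (fun i => (e i : ι)) b (by
    have : N.submatrix (fun i => (e i : ι)) b = (N.submatrix b fun i => (e i : ι)).transpose := by
      ext i j
      exact hNs _ _
    rwa [this, Matrix.det_transpose])
  set H := hessian c.isCoordinateSystem ev (strictTransform l y a)
  -- Elements of `(y l)` remain in `(y l)` under derivatives in directions other than `l`, so the
  -- congruence for the first derivative may be differentiated once more.
  have hH : ∀ i j : {i // i ≠ l}, H (.inl i) (.inl j) = 2 * N i j := by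
    intro i j
    have h1 := c.pderiv_strictTransform_sub_mem a h ha j.2
    have h2 : ev _ = 0 := hle (c.pderiv_mem_span i.2 h1)
    have h3 : ev _ = 0 := hle (c.pderiv_halfGradient_sub_mem a h i.2 j)
    have h4 : c.isCoordinateSystem.pderiv (.inl (i : ι)) (2 * halfGradient l y a j) =
        2 * c.isCoordinateSystem.pderiv (.inl (i : ι)) (halfGradient l y a j) := by
      rw [two_mul, two_mul, map_add]
    rw [map_sub, map_sub, h4, map_mul, sub_eq_zero] at h2
    rw [map_sub, sub_eq_zero] at h3
    rw [h3] at h2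
    rw [hNs]
    change ev _ = _
    rw [h2, map_ofNat]
    rfl
  have hHdet : (H.submatrix (fun i => .inl (e i : ι)) fun i => .inl (e' i : ι)).det ≠ 0 := by
    have : (H.submatrix (fun i => .inl (e i : ι)) fun i => .inl (e' i : ι)) =
        (2 : ℂ) • (N.submatrix (fun i => (e i : ι)) fun i => (e' i : ι)) := by
      ext i j
      exact hH (e i) (e' j)
    rw [this, Matrix.det_smul]
    exact mul_ne_zero (pow_ne_zero _ two_ne_zero) he'
  have hrank := le_rank_of_det_submatrix_ne_zero H _ _ hHdet
  refine ⟨_, hrank, hasQuadraticInitialForm_of_hessian c.isCoordinateSystem ev hf hD ?_⟩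
  intro h0
  change H = 0 at h0
  rw [h0, Matrix.rank_zero] at hrank
  omega

end IsBlowupChart

/-! ### Non-singular points -/

section Nonsingular

theorem isNonsingularAt_of_isOpenImmersion {X Y : Scheme.{0}} (s : X ⟶ Spec (.of ℂ)) (j : Y ⟶ X)
    [IsOpenImmersion j] [hs : Smooth (j ≫ s)] (y : Y) : IsNonsingularAt s (j y) := by
  refine ⟨j.opensRange, ⟨y, rfl⟩, ?_⟩
  have : j.opensRange.ι ≫ s = j.isoOpensRange.inv ≫ j ≫ s := by
    rw [← Category.assoc, Scheme.Hom.isoOpensRange_inv_comp]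
  rw [this]
  infer_instance

theorem isNonsingularAt_comp_iff {X Y : Scheme.{0}} (s : X ⟶ Spec (.of ℂ)) (j : Y ⟶ X)
    [IsOpenImmersion j] (y : Y) : IsNonsingularAt (j ≫ s) y ↔ IsNonsingularAt s (j y) := by
  constructor
  · rintro ⟨V, hV, hs⟩
    have : Smooth ((V.ι ≫ j) ≫ s) := by rwa [Category.assoc]
    exact isNonsingularAt_of_isOpenImmersion s (V.ι ≫ j) ⟨y, hV⟩
  · rintro ⟨V, hV, hs⟩
    refine ⟨j ⁻¹ᵁ V, hV, ?_⟩
    have : (j ⁻¹ᵁ V).ι ≫ j ≫ s = (j ∣_ V) ≫ V.ι ≫ s := by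
      rw [← Category.assoc, ← Category.assoc, morphismRestrict_ι]
    rw [this]
    infer_instance

theorem smooth_Spec_map_algebraMap {B : Type} [CommRing B] [Algebra ℂ B] [h : Algebra.Smooth ℂ B] :
    Smooth (Spec.map (CommRingCat.ofHom (algebraMap ℂ B))) := by
  rw [HasRingHomProperty.Spec_iff (P := @Smooth)]
  exact RingHom.smooth_algebraMap.mpr h

theorem isLocalization_away_quotient {A T : Type*} [CommRing A] [CommRing T] [Algebra A T] (g : A)
    [IsLocalization.Away g T] {I : Ideal A} {J : Ideal T} (hJ : J = I.map (algebraMap A T))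
    (hle : I ≤ J.comap (algebraMap A T)) :
    letI := (Ideal.quotientMap J (algebraMap A T) hle).toAlgebra
    IsLocalization.Away (Ideal.Quotient.mk I g) (T ⧸ J) := by
  subst hJ
  let _ := (Ideal.quotientMap (I.map (algebraMap A T)) (algebraMap A T) hle).toAlgebra
  have h2 := IsLocalization.of_surjective (.powers g) T (Ideal.Quotient.mk I)
    Ideal.Quotient.mk_surjective (Ideal.Quotient.mk (I.map (algebraMap A T)))
    Ideal.Quotient.mk_surjective rfl (by simp)
  rwa [Submonoid.map_powers] at h2

theorem exists_isOpenImmersion_Spec_quotient_away {S : Type} [CommRing S] [Algebra ℂ S]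
    (T : Type) [CommRing T] [Algebra ℂ T] [Algebra S T] [IsScalarTower ℂ S T] (f g : S)
    [IsLocalization.Away g T] :
    ∃ φ : S ⧸ Ideal.span {f} →ₐ[ℂ] T ⧸ Ideal.span {algebraMap S T f},
      (∀ a, φ (Ideal.Quotient.mk _ a) = Ideal.Quotient.mk _ (algebraMap S T a)) ∧
      IsOpenImmersion (Spec.map (CommRingCat.ofHom φ.toRingHom)) ∧
      ∀ q : Spec (.of (S ⧸ Ideal.span {f})),
        (∃ q', Spec.map (CommRingCat.ofHom φ.toRingHom) q' = q) ↔
          Ideal.Quotient.mk _ g ∉ q.asIdeal := by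
  have hJ : Ideal.span {algebraMap S T f} = (Ideal.span {f}).map (algebraMap S T) := by
    rw [Ideal.map_span, Set.image_singleton]
  have hle : Ideal.span {f} ≤ (Ideal.span {algebraMap S T f}).comap (algebraMap S T) := by
    rw [hJ]
    exact Ideal.le_comap_map
  have hloc := isLocalization_away_quotient g hJ hle
  refine ⟨{ Ideal.quotientMap _ (algebraMap S T) hle with
    commutes' := fun c => ?_ }, fun a => rfl, ?_, ?_⟩
  · change Ideal.Quotient.mk _ (algebraMap S T (algebraMap ℂ S c)) = _
    rw [← IsScalarTower.algebraMap_apply]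
    rfl
  · let _ := (Ideal.quotientMap _ (algebraMap S T) hle).toAlgebra
    exact IsOpenImmersion.of_isLocalization (Ideal.Quotient.mk (Ideal.span {f}) g)
  · let _ := (Ideal.quotientMap _ (algebraMap S T) hle).toAlgebra
    have h1 := PrimeSpectrum.localization_away_comap_range (T ⧸ Ideal.span {algebraMap S T f})
      (Ideal.Quotient.mk (Ideal.span {f}) g)
    exact fun q => Set.ext_iff.mp h1 q

/-- On the principal open set where `D f` is invertible the extension of `D` meets the Jacobian
criterion. -/
theorem isNonsingularAt_Spec_quotient {S : Type} [CommRing S] [Algebra ℂ S] [Algebra.Smooth ℂ S]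
    (f : S) (q : Spec (.of (S ⧸ Ideal.span {f}))) (D : Derivation ℂ S S)
    (hD : D f ∉ q.asIdeal.comap (Ideal.Quotient.mk (Ideal.span {f}))) :
    IsNonsingularAt (Spec.map (CommRingCat.ofHom (algebraMap ℂ (S ⧸ Ideal.span {f})))) q := by
  let g := D f
  let T := Localization.Away g
  let B := S ⧸ Ideal.span {f}
  let C := T ⧸ Ideal.span {algebraMap S T f}
  have : Algebra.FormallyEtale S T := Algebra.FormallyEtale.of_isLocalization (.powers g)
  have : Algebra.Smooth S T := Algebra.Smooth.of_isLocalization_Away g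
  have : Algebra.Smooth ℂ T := Algebra.Smooth.comp ℂ S T
  obtain ⟨D', hD'⟩ := exists_derivation_extension T D
  have hC : Algebra.Smooth ℂ C := smooth_quotient_span_singleton _ D' (by
    rw [hD']
    exact (IsLocalization.Away.algebraMap_isUnit g).map _)
  obtain ⟨φ, -, hφ, hrange⟩ := exists_isOpenImmersion_Spec_quotient_away T f g
  obtain ⟨q, rfl⟩ := (hrange q).mpr hD
  have hsm : Smooth (Spec.map (CommRingCat.ofHom φ.toRingHom) ≫
      Spec.map (CommRingCat.ofHom (algebraMap ℂ (S ⧸ Ideal.span {f})))) := by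
    rw [← Spec.map_comp, ← CommRingCat.ofHom_comp]
    have : φ.toRingHom.comp (algebraMap ℂ (S ⧸ Ideal.span {f})) = algebraMap ℂ C :=
      φ.comp_algebraMap
    rw [this]
    exact smooth_Spec_map_algebraMap
  exact isNonsingularAt_of_isOpenImmersion _ _ q

/-! ### Localization of quadratic initial forms -/

/-- Powers of a maximal ideal are primary, so inverting an element outside `m` does not enlarge them
after contraction. -/
theorem algebraMap_mem_map_pow_iff {A T : Type*} [CommRing A] [CommRing T] [Algebra A T] {g : A}
    [IsLocalization.Away g T] {m : Ideal A} [m.IsMaximal] (hg : g ∉ m) (n : ℕ) (a : A) :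
    algebraMap A T a ∈ m.map (algebraMap A T) ^ n ↔ a ∈ m ^ n := by
  rw [← Ideal.map_pow]
  refine ⟨fun h => ?_, fun h => Ideal.mem_map_of_mem _ h⟩
  obtain ⟨_, ⟨e, rfl⟩, he⟩ :=
    (IsLocalization.algebraMap_mem_map_algebraMap_iff (.powers g) T _ _).mp h
  exact (Ideal.IsMaximal.mul_mem_pow m he).resolve_left
    fun h => hg (Ideal.IsPrime.mem_of_pow_mem inferInstance e h)

theorem exists_sub_algebraMap_mem_map_pow {A T : Type*} [CommRing A] [CommRing T] [Algebra A T]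
    {g : A} [IsLocalization.Away g T] {m : Ideal A} [m.IsMaximal] (hg : g ∉ m) (n : ℕ) (b : T) :
    ∃ a, b - algebraMap A T a ∈ m.map (algebraMap A T) ^ n := by
  obtain ⟨a, s, rfl⟩ := IsLocalization.exists_mk'_eq (.powers g) b
  obtain ⟨e, he⟩ := s.2
  obtain ⟨h, u, hu, huv⟩ := Ideal.IsMaximal.exists_inv_pow m
    (fun h => hg (Ideal.IsPrime.mem_of_pow_mem inferInstance e h) : g ^ e ∉ m) n
  refine ⟨a * h, ?_⟩
  rw [← Ideal.unit_mul_mem_iff_mem _ (IsLocalization.map_units T s), mul_sub,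
    IsLocalization.mk'_spec', ← he, ← map_mul,
    ← map_sub, algebraMap_mem_map_pow_iff hg]
  have h2 : a - g ^ e * (a * h) = a * u := by
    linear_combination -a * huv
  rw [h2]
  exact Ideal.mul_mem_left _ _ hu

theorem algebraMap_smul_tower {A T : Type*} [CommRing A] [CommRing T] [Algebra ℂ A]
    [Algebra ℂ T] [Algebra A T] [IsScalarTower ℂ A T] (c : ℂ) (a : A) :
    algebraMap A T (c • a) = c • algebraMap A T a :=
  map_smul (IsScalarTower.toAlgHom ℂ A T) c a

theorem IsLocalCoordinates.map_algebraMap {A T : Type} [CommRing A] [CommRing T] [Algebra ℂ A]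
    [Algebra ℂ T] [Algebra A T] [IsScalarTower ℂ A T] {g : A} [IsLocalization.Away g T]
    {m : Ideal A} [m.IsMaximal] (hg : g ∉ m) {n : ℕ} {z : Fin n → A}
    (hz : IsLocalCoordinates m z) :
    IsLocalCoordinates (m.map (algebraMap A T)) fun i => algebraMap A T (z i) where
  mem i := Ideal.mem_map_of_mem _ (hz.mem i)
  existsUnique b hb := by
    obtain ⟨a, ha⟩ := exists_sub_algebraMap_mem_map_pow hg 2 b
    have ham : a ∈ m := by
      have h1 := sub_mem hb (Ideal.pow_le_self two_ne_zero ha)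
      rw [sub_sub_cancel] at h1
      have := (algebraMap_mem_map_pow_iff (T := T) hg 1 a).mp (by rwa [pow_one])
      rwa [pow_one] at this
    have key : ∀ c : Fin n → ℂ, b - ∑ i, c i • algebraMap A T (z i) ∈
        m.map (algebraMap A T) ^ 2 ↔ a - ∑ i, c i • z i ∈ m ^ 2 := by
      intro c
      rw [← algebraMap_mem_map_pow_iff (T := T) hg, ← Ideal.add_mem_iff_right _ ha
        (b := algebraMap A T (a - ∑ i, c i • z i))]
      simp only [map_sub, map_sum, algebraMap_smul_tower]
      rw [sub_add_sub_cancel]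
    simp only [key]
    exact hz.existsUnique a ham

theorem HasQuadraticInitialForm.map_algebraMap {A T : Type} [CommRing A] [CommRing T] [Algebra ℂ A]
    [Algebra ℂ T] [Algebra A T] [IsScalarTower ℂ A T] {g : A} [IsLocalization.Away g T]
    {m : Ideal A} [m.IsMaximal] (hg : g ∉ m) {f : A} {ρ : ℕ}
    (hf : HasQuadraticInitialForm m f ρ) :
    HasQuadraticInitialForm (m.map (algebraMap A T)) (algebraMap A T f) ρ := by
  obtain ⟨n, z, M, hz, hMs, hM0, hρ, hfM⟩ := hf
  refine ⟨n, _, M, hz.map_algebraMap hg, hMs, hM0, hρ, ?_⟩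
  rw [← algebraMap_mem_map_pow_iff (T := T) hg] at hfM
  simpa only [map_sub, map_sum, map_mul, algebraMap_smul_tower] using hfM

end Nonsingular

/-! ### Local nature of the conditions on singularities -/

section Transfer

variable {X W : Scheme.{0}} (s : X ⟶ Spec (.of ℂ)) (k : W ⟶ X) [IsOpenImmersion k]

theorem IsQuadraticSingularity.of_comp {w : W} {ρ : ℕ} (h : IsQuadraticSingularity (k ≫ s) w ρ) :
    IsQuadraticSingularity s (k w) ρ := by
  obtain ⟨A, _, _, f, j, y, hA, hj, hjs, rfl, hm, hf⟩ := h
  exact ⟨A, _, _, f, j ≫ k, y, hA, inferInstance, by rw [Category.assoc, hjs],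
    by rw [Scheme.Hom.comp_apply], hm, hf⟩

/-- A principal open subset of a hypersurface is again a hypersurface, in a principal open subset of
the ambient space. One containing the point and mapping into `W` is chosen and factored through `k`.
-/
theorem IsQuadraticSingularity.comp {w : W} {ρ : ℕ} (h : IsQuadraticSingularity s (k w) ρ) :
    IsQuadraticSingularity (k ≫ s) w ρ := by
  obtain ⟨A, _, _, f, j, y, hA, hj, hjs, hyw, hm, hf⟩ := h
  set m := y.asIdeal.comap (Ideal.Quotient.mk (Ideal.span {f})) with hm'
  have hyO : y ∈ (j ⁻¹ᵁ k.opensRange) := ⟨w, hyw.symm⟩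
  obtain ⟨_, ⟨_, ⟨g', rfl⟩, rfl⟩, hyg, hgO⟩ :=
    PrimeSpectrum.isBasis_basic_opens.exists_subset_of_mem_open hyO (j ⁻¹ᵁ k.opensRange).isOpen
  obtain ⟨g, rfl⟩ := Ideal.Quotient.mk_surjective g'
  have hg : g ∉ m := hyg
  let T := Localization.Away g
  have : Algebra.Smooth A T := Algebra.Smooth.of_isLocalization_Away g
  have hT : Algebra.Smooth ℂ T := Algebra.Smooth.comp ℂ A T
  obtain ⟨φ, hφ, hφo, hrange⟩ := exists_isOpenImmersion_Spec_quotient_away T f g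
  let i := Spec.map (CommRingCat.ofHom φ.toRingHom)
  have hsub : Set.range (i ≫ j) ⊆ Set.range k := by
    rintro _ ⟨q, rfl⟩
    rw [Scheme.Hom.comp_apply]
    exact hgO ((hrange (i q)).mp ⟨q, rfl⟩)
  have hfac := IsOpenImmersion.lift_fac k (i ≫ j) hsub
  obtain ⟨y', hy'⟩ := (hrange y).mpr hyg
  have hcomap : (y'.asIdeal.comap (Ideal.Quotient.mk (Ideal.span {algebraMap A T f}))) =
      m.map (algebraMap A T) := by
    rw [← IsLocalization.map_under (.powers g) T (y'.asIdeal.comap (Ideal.Quotient.mk _)),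
      hm', ← hy']
    congr 1
    ext a
    change _ ↔ φ (Ideal.Quotient.mk _ a) ∈ y'.asIdeal
    rw [hφ]
    rfl
  have : IsOpenImmersion (IsOpenImmersion.lift k (i ≫ j) hsub) := by
    have : IsOpenImmersion (IsOpenImmersion.lift k (i ≫ j) hsub ≫ k) := by
      rw [hfac]
      infer_instance
    exact IsOpenImmersion.of_comp _ k
  refine ⟨T, inferInstance, inferInstance, algebraMap A T f, IsOpenImmersion.lift k (i ≫ j) hsub,
    y', hT, inferInstance, ?_, ?_, ?_, ?_⟩
  · rw [← Category.assoc, hfac, Category.assoc, hjs, ← Spec.map_comp, ← CommRingCat.ofHom_comp]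
    congr 2
    exact φ.comp_algebraMap
  · refine k.isOpenEmbedding.injective ?_
    rw [← Scheme.Hom.comp_apply, hfac, Scheme.Hom.comp_apply, ← hyw]
    exact congrArg j hy'
  · rw [hcomap]
    have : IsJacobsonRing A := isJacobsonRing_of_finiteType (A := ℂ)
    exact IsLocalization.isMaximal_of_isMaximal_disjoint g m hm hg
  · rw [hcomap]
    exact hf.map_algebraMap hg

/-- A scheme locally of finite type over a field is Jacobson, so closedness of a point can be tested
on an open subset. -/
theorem isClosed_singleton_iff [LocallyOfFiniteType s] (w : W) :
    IsClosed ({k w} : Set X) ↔ IsClosed ({w} : Set W) := by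
  have : JacobsonSpace X := LocallyOfFiniteType.jacobsonSpace s
  have := k.isOpenEmbedding.preimage_closedPoints
  exact Set.ext_iff.mp this w

/-- The condition on the point `x` that `X` has at most quadratic singularities of rank at least
`r`, and a singular locus of codimension at least `r`. -/
def IsAdmissibleAt (r : ℕ) (x : X) : Prop :=
  (IsClosed ({x} : Set X) → IsNonsingularAt s x ∨ ∃ ρ, r ≤ ρ ∧ IsQuadraticSingularity s x ρ) ∧
    (¬ IsNonsingularAt s x → (r : ℕ∞) ≤ Order.coheight x)

theorem forall_isAdmissibleAt_iff (r : ℕ) : (∀ x, IsAdmissibleAt s r x) ↔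
    HasAtMostQuadraticSingularities s r ∧ (r : ℕ∞) ≤ codim (singularLocus s) := by
  simp only [IsAdmissibleAt, forall_and, HasAtMostQuadraticSingularities, codim, le_iInf_iff,
    singularLocus, Set.mem_ofPred_eq]

theorem isAdmissibleAt_comp_iff [LocallyOfFiniteType s] (r : ℕ) (w : W) :
    IsAdmissibleAt (k ≫ s) r w ↔ IsAdmissibleAt s r (k w) := by
  have h1 : ∀ ρ, IsQuadraticSingularity (k ≫ s) w ρ ↔ IsQuadraticSingularity s (k w) ρ :=
    fun ρ => ⟨.of_comp s k, .comp s k⟩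
  rw [IsAdmissibleAt, IsAdmissibleAt, isNonsingularAt_comp_iff, isClosed_singleton_iff s k,
    coheight_eq_of_isOpenImmersion]
  simp only [h1]

theorem IsNonsingularAt.isAdmissibleAt {s : X ⟶ Spec (.of ℂ)} {x : X} (h : IsNonsingularAt s x)
    (r : ℕ) : IsAdmissibleAt s r x :=
  ⟨fun _ => .inl h, fun h' => (h' h).elim⟩

end Transfer

/-! ### Charts of the blow-up -/

section Charts

theorem isAdmissibleAt_Spec_of_smooth {C : Type} [CommRing C] [Algebra ℂ C] [Algebra.Smooth ℂ C]
    (r : ℕ) (q : Spec (.of C)) :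
    IsAdmissibleAt (Spec.map (CommRingCat.ofHom (algebraMap ℂ C))) r q := by
  have : Smooth (𝟙 (Spec (.of C)) ≫ Spec.map (CommRingCat.ofHom (algebraMap ℂ C))) := by
    rw [Category.id_comp]
    exact smooth_Spec_map_algebraMap
  exact (isNonsingularAt_of_isOpenImmersion _ (𝟙 (Spec (.of C))) q).isAdmissibleAt r

/-- Either some derivative of the strict transform is nonzero at the point, which is then
nonsingular, or all vanish and the Hessian and height estimates apply. -/
theorem IsBlowupChart.isAdmissibleAt {A S ι τ : Type} [DecidableEq ι] [CommRing A]
    [CommRing S] [Algebra ℂ A] [Algebra ℂ S] [Algebra A S] {x : ι ⊕ τ → A} {l : ι}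
    {y : ι ⊕ τ → S} (c : IsBlowupChart ℂ x l y) [Fintype ι] (a : Matrix ι ι A)
    [IsScalarTower ℂ A S] [Fintype τ] [DecidableEq τ] (h : IsCoordinateSystem ℂ x)
    (ha : a.IsSymm) {r n : ℕ} (hr : r ≤ n) (hn : 0 < n) (b d : Fin n → ι)
    (hdet : IsUnit (a.submatrix b d).det)
    (q : Spec (.of (S ⧸ Ideal.span {strictTransform l y a})))
    (hq : Ideal.Quotient.mk _ (y (.inl l)) ∈ q.asIdeal) :
    IsAdmissibleAt (Spec.map (CommRingCat.ofHom
      (algebraMap ℂ (S ⧸ Ideal.span {strictTransform l y a})))) r q := by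
  have := c.smooth
  set Q := q.asIdeal.comap (Ideal.Quotient.mk (Ideal.span {strictTransform l y a})) with hQ
  by_cases hD : ∃ D : Derivation ℂ S S, D (strictTransform l y a) ∉ Q
  · obtain ⟨D, hD⟩ := hD
    exact (isNonsingularAt_Spec_quotient _ q D hD).isAdmissibleAt r
  push Not at hD
  have hfQ : strictTransform l y a ∈ Q := by
    rw [hQ, Ideal.mem_comap, Ideal.Quotient.eq_zero_iff_mem.mpr (Ideal.mem_span_singleton_self _)]
    exact zero_mem _
  have : Q.IsPrime := Ideal.IsPrime.comap (hK := q.isPrime) _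
  constructor
  · intro hcl
    right
    have hmax : q.asIdeal.IsMaximal := (PrimeSpectrum.isClosed_singleton_iff_isMaximal _).mp hcl
    have hQmax : Q.IsMaximal := Ideal.comap_isMaximal_of_surjective _ Ideal.Quotient.mk_surjective
    obtain ⟨ev, hev⟩ := exists_ker_eq_of_isMaximal Q
    have hmem : ∀ s ∈ Q, ev s = 0 := fun s hs => by rwa [← hev] at hs
    obtain ⟨ρ, hρ, hini⟩ := c.exists_hasQuadraticInitialForm a h ha hn b d hdet ev
      (hmem _ hq) (hmem _ hfQ) fun s => hmem _ (hD _)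
    refine ⟨ρ, hr.trans hρ, S, inferInstance, inferInstance, _, 𝟙 _, q, inferInstance,
      inferInstance, Category.id_comp _, rfl, hQmax, ?_⟩
    rw [hev] at hini
    exact hini
  · intro _
    have : IsNoetherianRing S := Algebra.FiniteType.isNoetherianRing ℂ S
    have h1 := c.succ_le_height a h ha b d hdet (Q := Q) hq hfQ fun i _ => hD _
    -- By Krull, dividing by the single equation `F` lowers the height by at most one, which uses up
    -- the extra `+ 1` from `succ_le_height`.
    have h2 := Ideal.height_le_height_add_one_of_mem hfQ
    have h3 : Q.map (Ideal.Quotient.mk (Ideal.span {strictTransform l y a})) = q.asIdeal :=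
      Ideal.map_comap_of_surjective _ Ideal.Quotient.mk_surjective _
    rw [h3] at h2
    have h4 := h1.trans h2
    have h5 : q.asIdeal.height = Order.coheight q :=
      idealHeight_eq_coheight (.of (S ⧸ Ideal.span {strictTransform l y a})) q
    rw [h5, Nat.cast_add, Nat.cast_one] at h4
    exact (Nat.cast_le.mpr hr).trans ((ENat.add_le_add_iff_right ENat.one_ne_top).mp h4)

theorem isLocalization_away_of_exists_pow {R C : Type*} [CommRing R] [CommRing C] [Algebra R C]
    (z : R) (hker : ∀ a, algebraMap R C a = 0 → ∃ n : ℕ, z ^ n * a = 0)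
    (hsurj : ∀ c, ∃ (n : ℕ) (a : R), algebraMap R C z ^ n * c = algebraMap R C a)
    (C' : Type*) [CommRing C'] [Algebra C C'] [Algebra R C'] [IsScalarTower R C C']
    [IsLocalization.Away (algebraMap R C z) C'] : IsLocalization.Away z C' := by
  have hu : IsUnit (algebraMap R C' z) := by
    rw [IsScalarTower.algebraMap_apply R C C']
    exact IsLocalization.Away.algebraMap_isUnit _
  refine IsLocalization.Away.mk _ hu ?_ ?_
  · intro c'
    obtain ⟨m, c, hc⟩ := IsLocalization.Away.surj (algebraMap R C z) c'
    obtain ⟨n, a, ha⟩ := hsurj c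
    refine ⟨m + n, a, ?_⟩
    rw [IsScalarTower.algebraMap_apply R C C', IsScalarTower.algebraMap_apply R C C', ← ha,
      map_mul, ← hc, map_pow]
    ring
  · intro a b hab
    rw [IsScalarTower.algebraMap_apply R C C', IsScalarTower.algebraMap_apply R C C'] at hab
    obtain ⟨n, hn⟩ := IsLocalization.Away.exists_of_eq (algebraMap R C z) hab
    rw [← sub_eq_zero, ← mul_sub, ← map_pow, ← map_sub, ← map_mul] at hn
    obtain ⟨m, hm⟩ := hker _ hn
    refine ⟨m + n, ?_⟩
    linear_combination hm

/-- The two conditions on `z` say that `R → C` becomes an isomorphism once `z` is inverted, so `q`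
lies in an open set shared with `X`. -/
theorem isAdmissibleAt_Spec_of_notMem {X : Scheme.{0}} (s : X ⟶ Spec (.of ℂ))
    [LocallyOfFiniteType s] {r : ℕ} (hX : ∀ x, IsAdmissibleAt s r x)
    {R C : Type} [CommRing R] [CommRing C] [Algebra ℂ R] [Algebra ℂ C] [Algebra R C]
    [IsScalarTower ℂ R C] [Algebra.FiniteType ℂ C]
    (k : Spec (.of R) ⟶ X) [IsOpenImmersion k]
    (hk : k ≫ s = Spec.map (CommRingCat.ofHom (algebraMap ℂ R)))
    (z : R) (hker : ∀ a, algebraMap R C a = 0 → ∃ n : ℕ, z ^ n * a = 0)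
    (hsurj : ∀ c, ∃ (n : ℕ) (a : R), algebraMap R C z ^ n * c = algebraMap R C a)
    (q : Spec (.of C)) (hq : algebraMap R C z ∉ q.asIdeal) :
    IsAdmissibleAt (Spec.map (CommRingCat.ofHom (algebraMap ℂ C))) r q := by
  let C' := Localization.Away (algebraMap R C z)
  have : IsLocalization.Away z C' := isLocalization_away_of_exists_pow z hker hsurj C'
  have : IsOpenImmersion (Spec.map (CommRingCat.ofHom (algebraMap C C'))) :=
    IsOpenImmersion.of_isLocalization (algebraMap R C z)
  have : IsOpenImmersion (Spec.map (CommRingCat.ofHom (algebraMap R C'))) :=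
    IsOpenImmersion.of_isLocalization z
  have : LocallyOfFiniteType (Spec.map (CommRingCat.ofHom (algebraMap ℂ C))) := by
    rw [HasRingHomProperty.Spec_iff (P := @LocallyOfFiniteType)]
    exact RingHom.finiteType_algebraMap.mpr inferInstance
  obtain ⟨q', rfl⟩ : ∃ q', Spec.map (CommRingCat.ofHom (algebraMap C C')) q' = q :=
    (Set.ext_iff.mp (PrimeSpectrum.localization_away_comap_range C' (algebraMap R C z)) q).mpr hq
  rw [← isAdmissibleAt_comp_iff]
  have : Spec.map (CommRingCat.ofHom (algebraMap C C')) ≫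
      Spec.map (CommRingCat.ofHom (algebraMap ℂ C)) =
      (Spec.map (CommRingCat.ofHom (algebraMap R C')) ≫ k) ≫ s := by
    rw [Category.assoc, hk, ← Spec.map_comp, ← Spec.map_comp, ← CommRingCat.ofHom_comp,
      ← CommRingCat.ofHom_comp, ← IsScalarTower.algebraMap_eq, ← IsScalarTower.algebraMap_eq]
  rw [this, isAdmissibleAt_comp_iff]
  exact hX _

end Charts

theorem exists_ringEquiv_of_range_eq {A S L : Type*} [CommRing A] [CommRing S] [CommRing L]
    (f : A →+* L) (g : S →+* L) (hf : Function.Injective f) (hg : Function.Injective g)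
    (h1 : ∀ x, ∃ s, g s = f x) (h2 : ∀ s, ∃ x, f x = g s) :
    ∃ e : A ≃+* S, ∀ x, g (e x) = f x := by
  choose φ hφ using h1
  let ψ : A →+* S :=
    { toFun := φ
      map_one' := hg (by rw [hφ, map_one, map_one])
      map_mul' := fun x y => hg (by rw [hφ, map_mul, map_mul, hφ, hφ])
      map_zero' := hg (by rw [hφ, map_zero, map_zero])
      map_add' := fun x y => hg (by rw [hφ, map_add, map_add, hφ, hφ]) }
  refine ⟨RingEquiv.ofBijective ψ ⟨fun x y h => hf ?_, fun s => ?_⟩, hφ⟩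
  · rw [← hφ, ← hφ]
    exact congrArg g h
  · obtain ⟨x, hx⟩ := h2 s
    exact ⟨x, hg ((hφ x).trans hx)⟩

/-! ### The standard charts of the blow-up -/

section ReesCharts

open Polynomial HomogeneousLocalization

variable {R : Type u} [CommRing R] (I : Ideal R)

/-- The element `a t ^ n` of the Rees algebra. -/
noncomputable def reesMonomial (n : ℕ) (a : R) (ha : a ∈ I ^ n) : reesAlgebra I :=
  ⟨monomial n a, reesAlgebra.monomial_mem.mpr ha⟩

variable {I}

theorem reesMonomial_mem {n : ℕ} {a : R} (ha : a ∈ I ^ n) :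
    reesMonomial I n a ha ∈ reesPiece I n := fun _ hm => coeff_monomial_of_ne _ hm

theorem exists_eq_reesMonomial {n : ℕ} {p : reesAlgebra I} (hp : p ∈ reesPiece I n) :
    ∃ (a : R) (ha : a ∈ I ^ n), p = reesMonomial I n a ha :=
  ⟨_, p.2 n, Subtype.ext (coe_eq_monomial I ⟨p, hp⟩)⟩

theorem reesMonomial_mul {m n : ℕ} {a b : R} (ha : a ∈ I ^ m) (hb : b ∈ I ^ n) :
    reesMonomial I m a ha * reesMonomial I n b hb =
      reesMonomial I (m + n) (a * b) (by rw [pow_add]; exact Ideal.mul_mem_mul ha hb) :=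
  Subtype.ext (monomial_mul_monomial _ _ _ _)

theorem reesMonomial_add {n : ℕ} {a b : R} (ha : a ∈ I ^ n) (hb : b ∈ I ^ n) :
    reesMonomial I n a ha + reesMonomial I n b hb = reesMonomial I n (a + b) (add_mem ha hb) :=
  Subtype.ext (map_add _ a b).symm

/-- The Rees algebra is generated in degree one, so the charts attached to generators of `I` cover
the blow-up. -/
theorem irrelevant_le_span {κ : Type*} (z : κ → R) (hz : ∀ i, z i ∈ I ^ 1)
    (hI : I = Ideal.span (Set.range z)) :
    (HomogeneousIdeal.irrelevant (reesPiece I)).toIdeal ≤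
      Ideal.span (Set.range fun i => reesMonomial I 1 (z i) (hz i)) := by
  set K := Ideal.span (Set.range fun i => reesMonomial I 1 (z i) (hz i)) with hK
  have h1 : ∀ a (ha : a ∈ I ^ 1), reesMonomial I 1 a ha ∈ K := by
    intro a ha
    have ha' : a ∈ Ideal.span (Set.range z) := by rwa [pow_one, hI] at ha
    induction ha' using Submodule.span_induction with
    | mem x hx =>
      obtain ⟨i, rfl⟩ := hx
      exact Ideal.subset_span ⟨i, rfl⟩
    | zero =>
      have : reesMonomial I 1 0 ha = 0 := Subtype.ext (map_zero (monomial 1))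
      rw [this]
      exact zero_mem _
    | add x y hx hy hx' hy' =>
      have hx1 : x ∈ I ^ 1 := by rwa [pow_one, hI]
      have hy1 : y ∈ I ^ 1 := by rwa [pow_one, hI]
      rw [← reesMonomial_add hx1 hy1]
      exact add_mem (hx' _) (hy' _)
    | smul c x hx hx' =>
      have hx1 : x ∈ I ^ 1 := by rwa [pow_one, hI]
      have : reesMonomial I 1 (c • x) ha = c • reesMonomial I 1 x hx1 :=
        Subtype.ext (smul_monomial c 1 x).symm
      rw [this]
      exact Submodule.smul_of_tower_mem _ _ (hx' hx1)
  rw [HomogeneousIdeal.irrelevant_eq_span, Ideal.span_le]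
  intro p hp
  simp only [Set.mem_iUnion] at hp
  obtain ⟨n, hn, hp⟩ := hp
  obtain ⟨a, ha, rfl⟩ := exists_eq_reesMonomial hp
  obtain ⟨n, rfl⟩ := Nat.exists_eq_succ_of_ne_zero (ne_of_gt hn)
  have ha' := ha
  rw [pow_succ] at ha'
  change reesMonomial I (n + 1) a ha ∈ K
  clear hp
  induction ha' using Submodule.mul_induction_on' with
  | mem_mul_mem x hx y hy =>
    have := reesMonomial_mul hx (by rwa [pow_one] : y ∈ I ^ 1)
    rw [← this]
    exact Ideal.mul_mem_left _ _ (h1 _ _)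
  | add x hx y hy hx' hy' =>
    rw [← pow_succ] at hx hy
    rw [← reesMonomial_add hx hy]
    exact add_mem (hx' _) (hy' _)

variable {S : Type u} [CommRing S] [Algebra R S]

/-- Both rings are subrings of `S[1/z]`: the degree zero part of the localized Rees algebra embeds
by `a t^n / (z t)^n ↦ a / z^n`, with injectivity from `hker`. By `hdvd` its image lies in `S`, and
by `hadj` it is all of `S`. -/
theorem exists_awayEquiv {z : R} (hz : z ∈ I ^ 1)
    (hnzd : algebraMap R S z ∈ nonZeroDivisors S)
    (hdvd : ∀ a ∈ I, algebraMap R S z ∣ algebraMap R S a)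
    (hadj : Algebra.adjoin R {w : S | ∃ a ∈ I, algebraMap R S a = algebraMap R S z * w} = ⊤)
    (hker : ∀ a, algebraMap R S a = 0 → ∃ n : ℕ, z ^ n * a = 0) :
    ∃ e : Away (reesPiece I) (reesMonomial I 1 z hz) ≃+* S,
      ∀ a : R, e (fromZeroRingHom (reesPiece I) _ (algebraMap R (reesPiece I 0) a)) =
        algebraMap R S a := by
  obtain ⟨L, _, _, _, _, _⟩ : ∃ (L : Type u) (_ : CommRing L) (_ : Algebra R L) (_ : Algebra S L)
      (_ : IsScalarTower R S L), IsLocalization.Away (algebraMap R S z) L :=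
    ⟨Localization.Away (algebraMap R S z), inferInstance, inferInstance, inferInstance,
      inferInstance, inferInstance⟩
  have hinj : Function.Injective (algebraMap S L) :=
    IsLocalization.injective L (Submonoid.powers_le.mpr hnzd)
  let t : L := IsLocalization.Away.invSelf (algebraMap R S z)
  have ht : algebraMap R L z * t = 1 := by
    rw [IsScalarTower.algebraMap_apply R S L]
    exact IsLocalization.Away.mul_invSelf _
  -- The variable `t` goes to `1 / z`, hence `z t` to `1`.
  let χ : reesAlgebra I →ₐ[R] L := (Polynomial.aeval t).comp (reesAlgebra I).val
  have hχ : ∀ n a ha, χ (reesMonomial I n a ha) = algebraMap R L a * t ^ n := fun n a ha =>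
    Polynomial.aeval_monomial t
  set zt := reesMonomial I 1 z hz
  have hχz : χ zt = 1 := by rw [hχ, pow_one, ht]
  let Ψ : Away (reesPiece I) zt →+* L :=
    (IsLocalization.Away.lift zt (g := χ.toRingHom) (S := Localization.Away zt)
      (hχz ▸ isUnit_one : IsUnit (χ zt))).comp (algebraMap _ (Localization.Away zt))
  have hΨ : ∀ n a ha (ha' : reesMonomial I n a ha ∈ reesPiece I (n • 1)),
      Ψ (Away.mk (reesPiece I) (reesMonomial_mem hz) n (reesMonomial I n a ha) ha') =
        algebraMap R L a * t ^ n := by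
    intro n a ha ha'
    have h1 : Ψ (Away.mk (reesPiece I) (reesMonomial_mem hz) n (reesMonomial I n a ha) ha') *
        χ zt ^ n = χ (reesMonomial I n a ha) := by
      have h2 := Away.val_mk (𝒜 := reesPiece I) n (reesMonomial_mem hz) (reesMonomial I n a ha) ha'
      have h3 : Localization.mk (reesMonomial I n a ha) (⟨zt ^ n, by use n⟩ : Submonoid.powers zt) *
          algebraMap _ (Localization.Away zt) (zt ^ n) =
          algebraMap _ (Localization.Away zt) (reesMonomial I n a ha) := by
        rw [Localization.mk_eq_mk']
        exact IsLocalization.mk'_spec _ _ _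
      have h4 := congrArg (IsLocalization.Away.lift zt (g := χ.toRingHom)
        (S := Localization.Away zt) (hχz ▸ isUnit_one : IsUnit (χ zt))) h3
      rw [map_mul, IsLocalization.Away.lift_eq, IsLocalization.Away.lift_eq] at h4
      rw [← map_pow]
      exact h4
    rw [← hχ n a ha, ← h1, hχz, one_pow, mul_one]
  have hΨ0 : ∀ a : R, Ψ (fromZeroRingHom (reesPiece I) _ (algebraMap R (reesPiece I 0) a)) =
      algebraMap R L a := by
    intro a
    have h1 := hΨ 0 a (by simp) (reesMonomial_mem _)
    rw [pow_zero t, mul_one] at h1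
    rw [← h1]
    congr 1
  have hmk : ∀ x, ∃ (n : ℕ) (a : R) (ha : a ∈ I ^ n) (ha' : _),
      x = Away.mk (reesPiece I) (reesMonomial_mem hz) n (reesMonomial I n a ha) ha' := by
    intro x
    obtain ⟨n, p, hp, rfl⟩ := Away.mk_surjective (reesPiece I) (reesMonomial_mem hz) x
    have hp' := hp
    rw [smul_eq_mul, mul_one] at hp'
    obtain ⟨a, ha, rfl⟩ := exists_eq_reesMonomial hp'
    exact ⟨n, a, ha, hp, rfl⟩
  have htu : IsUnit t := IsUnit.of_mul_eq_one _ ((mul_comm _ _).trans ht)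
  have hΨinj : Function.Injective Ψ := by
    rw [injective_iff_map_eq_zero]
    intro x hx
    obtain ⟨n, a, ha, ha', rfl⟩ := hmk x
    rw [hΨ, (htu.pow n).mul_left_eq_zero, IsScalarTower.algebraMap_apply R S L,
      map_eq_zero_iff _ hinj] at hx
    obtain ⟨m, hm⟩ := hker a hx
    apply HomogeneousLocalization.val_injective
    rw [Away.val_mk, HomogeneousLocalization.val_zero, Localization.mk_eq_mk',
      IsLocalization.mk'_eq_zero_iff]
    refine ⟨⟨zt ^ m, m, rfl⟩, ?_⟩
    apply Subtype.ext
    change (monomial 1 z) ^ m * monomial n a = 0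
    rw [monomial_pow, monomial_mul_monomial, hm, map_zero]
  have hsub : ∀ x, ∃ s, algebraMap S L s = Ψ x := by
    intro x
    obtain ⟨n, a, ha, ha', rfl⟩ := hmk x
    rw [hΨ]
    have h1 : ∀ n, ∀ a ∈ I ^ n, algebraMap R S z ^ n ∣ algebraMap R S a := by
      intro n
      induction n with
      | zero => intro a _; simp
      | succ n ih =>
        intro a ha
        rw [pow_succ] at ha
        induction ha using Submodule.mul_induction_on' with
        | mem_mul_mem x hx y hy =>
          rw [map_mul, pow_succ]
          exact mul_dvd_mul (ih x hx) (hdvd y hy)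
        | add x _ y _ hx hy =>
          rw [map_add]
          exact dvd_add hx hy
    obtain ⟨w, hw⟩ := h1 n a ha
    refine ⟨w, ?_⟩
    rw [IsScalarTower.algebraMap_apply R S L, hw, map_mul, map_pow,
      ← IsScalarTower.algebraMap_apply]
    have : (algebraMap R L z) ^ n * t ^ n = 1 := by rw [← mul_pow, ht, one_pow]
    linear_combination -(algebraMap S L w) * this
  have hsup : ∀ w, ∃ x, Ψ x = algebraMap S L w := by
    intro w
    have hw : w ∈ Algebra.adjoin R
        {w : S | ∃ a ∈ I, algebraMap R S a = algebraMap R S z * w} := by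
      rw [hadj]
      trivial
    induction hw using Algebra.adjoin_induction with
    | mem w hw =>
      obtain ⟨a, ha, haw⟩ := hw
      have ha1 : a ∈ I ^ 1 := by rwa [pow_one]
      refine ⟨Away.mk (reesPiece I) (reesMonomial_mem hz) 1 (reesMonomial I 1 a ha1)
        (reesMonomial_mem ha1), ?_⟩
      rw [hΨ, IsScalarTower.algebraMap_apply R S L, haw, map_mul, pow_one,
        ← IsScalarTower.algebraMap_apply]
      linear_combination (algebraMap S L w) * ht
    | algebraMap a =>
      exact ⟨_, (hΨ0 a).trans (IsScalarTower.algebraMap_apply R S L a)⟩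
    | add x y _ _ hx hy =>
      obtain ⟨x', hx⟩ := hx
      obtain ⟨y', hy⟩ := hy
      exact ⟨x' + y', by rw [map_add, map_add, hx, hy]⟩
    | mul x y _ _ hx hy =>
      obtain ⟨x', hx⟩ := hx
      obtain ⟨y', hy⟩ := hy
      exact ⟨x' * y', by rw [map_mul, map_mul, hx, hy]⟩
  obtain ⟨e, he⟩ := exists_ringEquiv_of_range_eq Ψ (algebraMap S L) hΨinj hinj hsub hsup
  refine ⟨e, fun a => hinj ?_⟩
  rw [he, hΨ0, ← IsScalarTower.algebraMap_apply]

theorem exists_pow_mul_eq_of_adjoin_eq_top {z : R}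
    (hadj : Algebra.adjoin R {w : S | ∃ a ∈ I, algebraMap R S a = algebraMap R S z * w} = ⊤)
    (c : S) : ∃ (n : ℕ) (a : R), algebraMap R S z ^ n * c = algebraMap R S a := by
  have hc : c ∈ Algebra.adjoin R {w : S | ∃ a ∈ I, algebraMap R S a = algebraMap R S z * w} := by
    rw [hadj]
    trivial
  induction hc using Algebra.adjoin_induction with
  | mem w hw =>
    obtain ⟨a, -, ha⟩ := hw
    exact ⟨1, a, by rw [pow_one, ha]⟩
  | algebraMap a => exact ⟨0, a, by rw [pow_zero, one_mul]⟩
  | add x y _ _ hx hy =>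
    obtain ⟨m, a, ha⟩ := hx
    obtain ⟨n, b, hb⟩ := hy
    refine ⟨m + n, z ^ n * a + z ^ m * b, ?_⟩
    rw [map_add, map_mul, map_mul, ← ha, ← hb, map_pow, map_pow]
    ring
  | mul x y _ _ hx hy =>
    obtain ⟨m, a, ha⟩ := hx
    obtain ⟨n, b, hb⟩ := hy
    refine ⟨m + n, a * b, ?_⟩
    rw [map_mul, ← ha, ← hb]
    ring

theorem exists_awayι_eq {κ : Type*} (z : κ → R) (hz : ∀ i, z i ∈ I ^ 1)
    (hI : I = Ideal.span (Set.range z)) (y : affineBlowup I) :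
    ∃ i q, Proj.awayι (reesPiece I) _ (reesMonomial_mem (hz i)) one_pos q = y := by
  have h1 := (Proj.iSup_basicOpen_eq_top (reesPiece I) _ (irrelevant_le_span z hz hI)).ge
    (Set.mem_univ y)
  obtain ⟨i, hi⟩ := Opens.mem_iSup.mp h1
  rw [← Proj.opensRange_awayι (reesPiece I) _ (reesMonomial_mem (hz i)) one_pos] at hi
  exact ⟨i, hi⟩

/-- Finite type is needed for the blow-up to be Jacobson, so that closed points can be tested on its
charts. -/
instance [IsNoetherianRing R] : LocallyOfFiniteType (affineBlowupToSpec I) := by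
  have h1 : Algebra.FiniteType R (reesAlgebra I) :=
    ((reesAlgebra I).fg_iff_finiteType).mp (reesAlgebra.fg ((isNoetherianRing_iff_ideal_fg R).mp
      inferInstance I))
  have : IsScalarTower R (reesPiece I 0) (reesAlgebra I) :=
    ⟨fun a b c => smul_mul_assoc a (b : reesAlgebra I) c⟩
  have h2 : Algebra.FiniteType (reesPiece I 0) (reesAlgebra I) :=
    Algebra.FiniteType.of_restrictScalars_finiteType R _ _
  have h3 : Function.Surjective (algebraMap R (reesPiece I 0)) := fun p =>
    ⟨_, Subtype.ext (Subtype.ext (coe_eq_monomial I p).symm)⟩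
  have h4 : LocallyOfFiniteType
      (Spec.map (CommRingCat.ofHom (algebraMap R (reesPiece I 0))) :
        Spec (.of (reesPiece I 0)) ⟶ Spec (.of R)) := by
    rw [HasRingHomProperty.Spec_iff (P := @LocallyOfFiniteType)]
    exact RingHom.FiniteType.of_surjective _ h3
  have h5 : LocallyOfFiniteType (Proj.toSpecZero (reesPiece I)) :=
    Proj.instLocallyOfFiniteTypeToSpecZeroOfFiniteTypeSubtypeMemOfNatNat (reesPiece I)
  exact MorphismProperty.comp_mem @LocallyOfFiniteType _ _ h5 h4

end ReesCharts

/-! ### Admissibility of a blow-up from its charts. -/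

section BlowupAdmissible

open HomogeneousLocalization

theorem isAdmissibleAt_affineBlowup {X : Scheme.{0}} (s : X ⟶ Spec (.of ℂ))
    [LocallyOfFiniteType s] {r : ℕ} (hX : ∀ x, IsAdmissibleAt s r x)
    {R : Type} [CommRing R] [Algebra ℂ R] [IsNoetherianRing R]
    (k : Spec (.of R) ⟶ X) [IsOpenImmersion k]
    (hk : k ≫ s = Spec.map (CommRingCat.ofHom (algebraMap ℂ R)))
    {I : Ideal R} {κ : Type*} (z : κ → R) (hI : I = Ideal.span (Set.range z))
    (hchart : ∀ i, ∃ (S : Type) (_ : CommRing S) (_ : Algebra ℂ S) (_ : Algebra R S)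
      (_ : IsScalarTower ℂ R S), Algebra.FiniteType ℂ S ∧
      algebraMap R S (z i) ∈ nonZeroDivisors S ∧
      (∀ a ∈ I, algebraMap R S (z i) ∣ algebraMap R S a) ∧
      Algebra.adjoin R {w : S | ∃ a ∈ I, algebraMap R S a = algebraMap R S (z i) * w} = ⊤ ∧
      (∀ a, algebraMap R S a = 0 → ∃ n : ℕ, z i ^ n * a = 0) ∧
      ∀ q : Spec (.of S), algebraMap R S (z i) ∈ q.asIdeal →
        IsAdmissibleAt (Spec.map (CommRingCat.ofHom (algebraMap ℂ S))) r q)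
    (y : affineBlowup I) : IsAdmissibleAt ((affineBlowupToSpec I ≫ k) ≫ s) r y := by
  have hz : ∀ i, z i ∈ I ^ 1 := fun i => by
    rw [pow_one, hI]
    exact Ideal.subset_span ⟨i, rfl⟩
  obtain ⟨i, q, rfl⟩ := exists_awayι_eq z hz hI y
  obtain ⟨S, _, _, _, _, hft, hnzd, hdvd, hadj, hker, hq⟩ := hchart i
  obtain ⟨e, he⟩ := exists_awayEquiv (hz i) hnzd hdvd hadj hker
  have hS : ∀ q : Spec (.of S),
      IsAdmissibleAt (Spec.map (CommRingCat.ofHom (algebraMap ℂ S))) r q := by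
    intro q
    by_cases hzq : algebraMap R S (z i) ∈ q.asIdeal
    · exact hq q hzq
    · exact isAdmissibleAt_Spec_of_notMem s hX k hk (z i) hker
        (exists_pow_mul_eq_of_adjoin_eq_top hadj) q hzq
  let ε : Spec (.of S) ⟶ Spec (.of (Away (reesPiece I) (reesMonomial I 1 (z i) (hz i)))) :=
    Spec.map (RingEquiv.toCommRingCatIso e).hom
  have hε : IsIso ε := inferInstance
  let j : Spec (.of (Away (reesPiece I) (reesMonomial I 1 (z i) (hz i)))) ⟶ affineBlowup I :=
    Proj.awayι (reesPiece I) _ (reesMonomial_mem (hz i)) one_pos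
  have hj : IsOpenImmersion j :=
    inferInstanceAs (IsOpenImmersion (Proj.awayι (reesPiece I) _ (reesMonomial_mem (hz i)) one_pos))
  have hj1 : j ≫ affineBlowupToSpec I =
      Spec.map (CommRingCat.ofHom (fromZeroRingHom (reesPiece I) _)) ≫
        (Spec.map (CommRingCat.ofHom (algebraMap R (reesPiece I 0))) :
          Spec (.of (reesPiece I 0)) ⟶ Spec (.of R)) :=
    Proj.awayι_toSpecZero_assoc (reesPiece I) _ (reesMonomial_mem (hz i)) one_pos _
  have hcomp : (ε ≫ j) ≫ (affineBlowupToSpec I ≫ k) ≫ s =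
      Spec.map (CommRingCat.ofHom (algebraMap ℂ S)) := by
    rw [Category.assoc, Category.assoc, hk, ← Category.assoc j, hj1, ← Spec.map_comp,
      ← Spec.map_comp, ← Spec.map_comp, IsScalarTower.algebraMap_eq ℂ R S]
    congr 1
    ext c
    exact he (algebraMap ℂ R c)
  obtain ⟨q, rfl⟩ := ε.homeomorph.surjective q
  have h1 := hS q
  rw [← hcomp, isAdmissibleAt_comp_iff] at h1
  exact h1

end BlowupAdmissible

/-! ### Coordinates adapted to a smooth closed subscheme -/

section Adapted

open KaehlerDifferential TensorProduct

theorem linearIndependent_D_of_isUnit_det {k A σ : Type*} [CommRing k] [CommRing A] [Algebra k A]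
    [Fintype σ] [DecidableEq σ] (x : σ → A) (δ : σ → Derivation k A A)
    (h : IsUnit (Matrix.of fun s t => δ s (x t)).det) :
    LinearIndependent A fun s => KaehlerDifferential.D k A (x s) := by
  rw [Fintype.linearIndependent_iff]
  intro c hc
  have h1 : (Matrix.of fun s t => δ s (x t)).mulVec c = 0 := by
    funext s
    have := congrArg (δ s).liftKaehlerDifferential hc
    simpa [Matrix.mulVec, dotProduct, mul_comm] using this
  have h2 : c = 0 := by
    rw [← Matrix.one_mulVec c, ← Matrix.nonsing_inv_mul _ h, ← Matrix.mulVec_mulVec, h1,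
      Matrix.mulVec_zero]
  exact fun i => congrFun h2 i

theorem span_range_D_algebraMap {k A : Type*} [CommRing k] [CommRing A] [Algebra k A]
    (T : Type*) [CommRing T] [Algebra k T] [Algebra A T] [IsScalarTower k A T]
    [Algebra.FormallyEtale A T] :
    Submodule.span T (Set.range fun a : A => KaehlerDifferential.D k T (algebraMap A T a)) = ⊤ := by
  rw [eq_top_iff]
  intro v _
  obtain ⟨v, rfl⟩ := (tensorKaehlerEquivOfFormallyEtale k A T).surjective v
  induction v using TensorProduct.induction_on with
  | zero => simp
  | add v w hv hw =>
    rw [map_add]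
    exact add_mem (hv trivial) (hw trivial)
  | tmul t v =>
    have hv : v ∈ Submodule.span A (Set.range (KaehlerDifferential.D k A)) := by
      rw [KaehlerDifferential.span_range_derivation]
      trivial
    induction hv using Submodule.span_induction with
    | mem v hv =>
      obtain ⟨a, rfl⟩ := hv
      have : tensorKaehlerEquivOfFormallyEtale k A T (t ⊗ₜ KaehlerDifferential.D k A a) =
          t • KaehlerDifferential.D k T (algebraMap A T a) := by
        simp
      rw [this]
      exact Submodule.smul_mem _ _ (Submodule.subset_span ⟨a, rfl⟩)
    | zero => simp
    | add v w _ _ hv hw =>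
      rw [TensorProduct.tmul_add, map_add]
      exact add_mem (hv trivial) (hw trivial)
    | smul a v _ hv =>
      rw [TensorProduct.tmul_smul, ← algebraMap_smul T a (t ⊗ₜ[A] v), map_smul]
      exact Submodule.smul_mem _ _ (hv trivial)

variable {k A : Type*} [Field k] [CommRing A] [Algebra k A] (ev : A →ₐ[k] k)

/-- The fibre of the Kähler differentials at a rational point. -/
abbrev KaehlerFiber := Ω[A⁄k] ⧸ (RingHom.ker ev • ⊤ : Submodule A Ω[A⁄k])

/-- The restriction of a differential to the fibre at a rational point. -/
noncomputable abbrev toKaehlerFiber : Ω[A⁄k] →ₗ[A] KaehlerFiber ev := Submodule.mkQ _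

theorem toKaehlerFiber_smul (a : A) (v : Ω[A⁄k]) :
    toKaehlerFiber ev (a • v) = ev a • toKaehlerFiber ev v := by
  rw [← algebraMap_smul A (ev a) (toKaehlerFiber ev v), ← map_smul, ← sub_eq_zero, ← map_sub,
    ← sub_smul]
  refine (Submodule.Quotient.mk_eq_zero _).mpr (Submodule.smul_mem_smul ?_ trivial)
  simp [RingHom.mem_ker]

theorem span_range_toKaehlerFiber :
    Submodule.span k (Set.range fun a : A => toKaehlerFiber ev (KaehlerDifferential.D k A a)) =
      ⊤ := by
  rw [eq_top_iff]
  intro v _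
  obtain ⟨v, rfl⟩ := Submodule.mkQ_surjective _ v
  have hv : v ∈ Submodule.span A (Set.range (KaehlerDifferential.D k A)) := by
    rw [KaehlerDifferential.span_range_derivation]
    trivial
  induction hv using Submodule.span_induction with
  | mem v hv =>
    obtain ⟨a, rfl⟩ := hv
    exact Submodule.subset_span ⟨a, rfl⟩
  | zero => simp
  | add v w _ _ hv hw =>
    rw [map_add]
    exact add_mem (hv trivial) (hw trivial)
  | smul a v _ hv =>
    have := toKaehlerFiber_smul ev a v
    rw [this]
    exact Submodule.smul_mem _ _ (hv trivial)

instance [Module.Finite A Ω[A⁄k]] : Module.Finite k (KaehlerFiber ev) := by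
  obtain ⟨S, hS⟩ := (inferInstance : Module.Finite A Ω[A⁄k]).fg_top
  classical
  refine ⟨⟨S.image (toKaehlerFiber ev), ?_⟩⟩
  rw [eq_top_iff]
  intro v _
  obtain ⟨v, rfl⟩ := Submodule.mkQ_surjective _ v
  have hv : v ∈ Submodule.span A (S : Set Ω[A⁄k]) := by
    rw [hS]
    trivial
  induction hv using Submodule.span_induction with
  | mem v hv => exact Submodule.subset_span (by simpa using ⟨v, hv, rfl⟩)
  | zero => simp
  | add v w _ _ hv hw =>
    rw [map_add]
    exact add_mem (hv trivial) (hw trivial)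
  | smul a v _ hv =>
    have := toKaehlerFiber_smul ev a v
    rw [this]
    exact Submodule.smul_mem _ _ (hv trivial)

/-- Functions whose differentials form a basis of the fibre of the Kähler differentials at a
rational point are coordinates in a neighbourhood of this point. -/
theorem exists_isCoordinateSystem_of_basis [Algebra.Smooth k A] {σ : Type*} [Fintype σ]
    (x : σ → A) (b : Module.Basis σ k (KaehlerFiber ev))
    (hb : ∀ s, b s = toKaehlerFiber ev (KaehlerDifferential.D k A (x s))) :
    ∃ g : A, ev g ≠ 0 ∧ ∀ (T : Type _) [CommRing T] [Algebra k T] [Algebra A T]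
      [IsScalarTower k A T] [Algebra.FormallyEtale A T], IsUnit (algebraMap A T g) →
      IsCoordinateSystem k fun s => algebraMap A T (x s) := by
  classical
  set m := RingHom.ker ev with hm
  have hsup : (⊤ : Submodule A Ω[A⁄k]) ≤
      Submodule.span A (Set.range fun s => KaehlerDifferential.D k A (x s)) ⊔ m • ⊤ := by
    intro v _
    rw [← Submodule.ker_mkQ (m • ⊤ : Submodule A Ω[A⁄k])]
    set w := ∑ s, b.repr (toKaehlerFiber ev v) s • KaehlerDifferential.D k A (x s) with hw
    have h1 : toKaehlerFiber ev w = toKaehlerFiber ev v := by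
      rw [← b.sum_repr (toKaehlerFiber ev v), hw, map_sum]
      refine Finset.sum_congr rfl fun s _ => ?_
      rw [hb, ← algebraMap_smul A (b.repr (toKaehlerFiber ev v) s), toKaehlerFiber_smul,
        AlgHom.commutes]
      rfl
    refine Submodule.mem_sup.mpr ⟨w, sum_mem fun s _ =>
      Submodule.smul_of_tower_mem _ _ (Submodule.subset_span ⟨s, rfl⟩), v - w, ?_, by abel⟩
    rw [LinearMap.mem_ker, map_sub, sub_eq_zero]
    exact h1.symm
  -- Nakayama: the `D (x s)` generate the differentials after multiplication by some `g₁` that is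
  -- `1` at the point.
  obtain ⟨g₁, hg₁, hspan⟩ := Submodule.exists_sub_one_mem_and_smul_le_of_fg_of_le_sup
    (Module.Finite.fg_top (R := A) (M := Ω[A⁄k])) le_rfl hsup
  -- The differentials are projective, so the coordinate functionals of the fibre lift to
  -- derivations. Their Jacobian matrix on `x` is the identity at the point, and its determinant
  -- controls linear independence nearby.
  have hlift : ∀ s, ∃ ψ : Ω[A⁄k] →ₗ[A] A, ∀ v, ev (ψ v) = b.repr (toKaehlerFiber ev v) s := by
    intro s
    let G : Ω[A⁄k] →ₗ[A] A ⧸ m :=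
      { toFun := fun v => Ideal.Quotient.mk m
          (algebraMap k A (b.repr (toKaehlerFiber ev v) s))
        map_add' := fun v w => by simp only [map_add, Finsupp.add_apply]
        map_smul' := fun a v => by
          rw [toKaehlerFiber_smul, map_smul, Finsupp.smul_apply, RingHom.id_apply, smul_eq_mul,
            map_mul, map_mul, Algebra.smul_def, Ideal.Quotient.algebraMap_eq]
          congr 1
          rw [Ideal.Quotient.eq]
          simp [m, RingHom.mem_ker] }
    obtain ⟨ψ, hψ⟩ := Module.projective_lifting_property (Submodule.mkQ m : A →ₗ[A] A ⧸ m) G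
      (Submodule.mkQ_surjective _)
    refine ⟨ψ, fun v => ?_⟩
    have h1 : Ideal.Quotient.mk m (ψ v) = Ideal.Quotient.mk m
      (algebraMap k A (b.repr (toKaehlerFiber ev v) s)) := LinearMap.congr_fun hψ v
    rw [Ideal.Quotient.eq, hm, RingHom.mem_ker, map_sub, sub_eq_zero] at h1
    rw [h1, AlgHom.commutes]
    rfl
  choose ψ hψ using hlift
  let δ : σ → Derivation k A A := fun s => (ψ s).compDer (KaehlerDifferential.D k A)
  let M : Matrix σ σ A := Matrix.of fun s t => δ s (x t)
  have hM : ev M.det = 1 := by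
    have h1 : ev.toRingHom.mapMatrix M = 1 := by
      ext s t
      have := hψ s (KaehlerDifferential.D k A (x t))
      rw [← hb, b.repr_self] at this
      rw [Matrix.one_apply]
      refine this.trans ?_
      rw [Finsupp.single_apply]
      simp only [eq_comm]
    have h2 := RingHom.map_det ev.toRingHom M
    rw [h1, Matrix.det_one] at h2
    exact h2
  refine ⟨g₁ * M.det, ?_, ?_⟩
  · rw [map_mul, hM, mul_one]
    rw [hm, RingHom.mem_ker, map_sub, map_one, sub_eq_zero] at hg₁
    rw [hg₁]
    exact one_ne_zero
  · intro T _ _ _ _ _ hg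
    rw [map_mul] at hg
    refine ⟨?_, ?_⟩
    · choose δ' hδ' using fun s => exists_derivation_extension T (δ s)
      refine linearIndependent_D_of_isUnit_det _ δ' ?_
      have h1 : (Matrix.of fun s t => δ' s (algebraMap A T (x t))) =
          (algebraMap A T).mapMatrix M := by
        ext s t
        exact hδ' s (x t)
      rw [h1, ← RingHom.map_det]
      exact isUnit_of_mul_isUnit_right hg
    · rw [← span_range_D_algebraMap (k := k) (A := A) T, Submodule.span_le]
      rintro _ ⟨a, rfl⟩
      have h1 : g₁ • KaehlerDifferential.D k A a ∈
          Submodule.span A (Set.range fun s => KaehlerDifferential.D k A (x s)) :=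
        hspan (Submodule.smul_mem_pointwise_smul _ _ _ trivial)
      have h2 : ∀ v ∈ Submodule.span A (Set.range fun s => KaehlerDifferential.D k A (x s)),
          KaehlerDifferential.map k k A T v ∈ Submodule.span T
            (Set.range fun s => KaehlerDifferential.D k T (algebraMap A T (x s))) := by
        intro v hv
        induction hv using Submodule.span_induction with
        | mem v hv =>
          obtain ⟨s, rfl⟩ := hv
          rw [KaehlerDifferential.map_D]
          exact Submodule.subset_span ⟨s, rfl⟩
        | zero => simp
        | add v w _ _ hv hw =>
          rw [map_add]
          exact add_mem hv hw
        | smul c v _ hv =>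
          rw [map_smul]
          exact Submodule.smul_of_tower_mem _ _ hv
      have h3 := h2 _ h1
      rw [map_smul, KaehlerDifferential.map_D, ← algebraMap_smul T g₁] at h3
      exact (Submodule.smul_mem_iff_of_isUnit _ (isUnit_of_mul_isUnit_left hg)).mp h3

/-- Smoothness of `A / J` splits the conormal sequence, so the map from `J / J²` to differentials
stays injective on fibres at the point. -/
theorem mem_sup_of_toKaehlerFiber_eq_zero {J : Ideal A} [Algebra.FormallySmooth k A]
    [Algebra.FormallySmooth k (A ⧸ J)] {w : A} (hw : w ∈ J)
    (h0 : toKaehlerFiber ev (KaehlerDifferential.D k A w) = 0) :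
    w ∈ RingHom.ker ev * J ⊔ J ^ 2 := by
  have hsurj : Function.Surjective (algebraMap A (A ⧸ J)) := Ideal.Quotient.mk_surjective
  have hker : RingHom.ker (algebraMap A (A ⧸ J)) = J := Ideal.mk_ker
  obtain ⟨l, hl⟩ := (Algebra.FormallySmooth.iff_split_injection (R := k) hsurj).mp inferInstance
  have hw' : w ∈ RingHom.ker (algebraMap A (A ⧸ J)) := by rwa [hker]
  let L : Ω[A⁄k] →ₗ[A] (RingHom.ker (algebraMap A (A ⧸ J))).Cotangent :=
    l ∘ₗ TensorProduct.mk A (A ⧸ J) Ω[A⁄k] 1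
  have h1 : L (KaehlerDifferential.D k A w) =
      (RingHom.ker (algebraMap A (A ⧸ J))).toCotangent ⟨w, hw'⟩ := by
    have := LinearMap.congr_fun hl ((RingHom.ker (algebraMap A (A ⧸ J))).toCotangent ⟨w, hw'⟩)
    rwa [LinearMap.comp_apply, kerCotangentToTensor_toCotangent] at this
  have h2 : KaehlerDifferential.D k A w ∈ (RingHom.ker ev • ⊤ : Submodule A Ω[A⁄k]) :=
    (Submodule.Quotient.mk_eq_zero _).mp h0
  have h3 : L (KaehlerDifferential.D k A w) ∈ (RingHom.ker ev • ⊤ : Submodule A _) := by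
    have := Submodule.mem_map_of_mem (f := L) h2
    rw [Submodule.map_smul''] at this
    exact Submodule.smul_mono le_rfl le_top this
  rw [h1, ← (LinearMap.range_eq_top.mpr (Ideal.toCotangent_surjective _)), ← Submodule.map_top,
    ← Submodule.map_smul''] at h3
  obtain ⟨⟨w', hw''⟩, hmem, heq⟩ := h3
  rw [Ideal.toCotangent_eq] at heq
  simp only [hker] at heq hw''
  have h4 : w' ∈ RingHom.ker ev * J := by
    have h5 := Submodule.mem_map_of_mem
      (f := (RingHom.ker (algebraMap A (A ⧸ J))).subtype) hmem
    rw [Submodule.map_smul'', Submodule.map_top, Submodule.range_subtype] at h5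
    have h6 : w' ∈ RingHom.ker ev • RingHom.ker (algebraMap A (A ⧸ J)) := h5
    rwa [hker] at h6
  refine Submodule.mem_sup.mpr ⟨w', h4, w - w', ?_, by ring⟩
  rw [← neg_mem_iff, neg_sub]
  exact heq

/-- Take functions in `J` whose differentials form a basis of the span of `d J` in the fibre, and
complete them to a basis of the whole fibre. The first group generates `J` near the point by
Nakayama. The case `J = ⊥` gives coordinates at an arbitrary point. -/
theorem exists_isCoordinateSystem_adapted {A : Type} [CommRing A] [Algebra k A] (ev : A →ₐ[k] k)
    [Algebra.Smooth k A] [IsNoetherianRing A] {J : Ideal A} (hJ : J ≤ RingHom.ker ev)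
    [Algebra.FormallySmooth k (A ⧸ J)] :
    ∃ (ι τ : Type) (_ : Fintype ι) (_ : Fintype τ) (x : ι ⊕ τ → A) (g : A), ev g ≠ 0 ∧
      (∀ i, x (.inl i) ∈ J) ∧
      (∀ a ∈ J, g * a ∈ Ideal.span (Set.range fun i => x (.inl i))) ∧
      ∀ (T : Type) [CommRing T] [Algebra k T] [Algebra A T]
      [IsScalarTower k A T] [Algebra.FormallyEtale A T], IsUnit (algebraMap A T g) →
      IsCoordinateSystem k fun s => algebraMap A T (x s) := by
  classical
  let d : A → KaehlerFiber ev := fun a => toKaehlerFiber ev (KaehlerDifferential.D k A a)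
  have hd : ∀ a b, d (a + b) = d a + d b := fun a b => by simp only [d, map_add]
  obtain ⟨b₁, hb₁, hspan₁, hli₁⟩ := exists_linearIndependent k (d '' J)
  obtain ⟨b₂, hb₂, hb₁₂, hspan₂, hli₂⟩ := exists_linearIndepOn_id_extension hli₁
    (hb₁.trans (Set.image_subset_range d J))
  have hfin₂ : b₂.Finite := hli₂.setFinite
  let _ : Fintype b₁ := (hfin₂.subset hb₁₂).fintype
  let _ : Fintype ↑(b₂ \ b₁) := (hfin₂.subset Set.sdiff_subset).fintype
  choose z hzJ hz using fun v : b₁ => hb₁ v.2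
  choose t ht using fun v : ↑(b₂ \ b₁) => hb₂ v.2.1
  let x : b₁ ⊕ ↑(b₂ \ b₁) → A := Sum.elim z t
  let B₂ : Module.Basis b₂ k (KaehlerFiber ev) := .mk hli₂ (by
    rw [← span_range_toKaehlerFiber ev, Submodule.span_le]
    have h1 : (Set.range fun v : b₂ => id (v : KaehlerFiber ev)) = b₂ := Subtype.range_coe
    rw [h1]
    exact hspan₂)
  let B := B₂.reindex (Equiv.Set.sumDiffSubset hb₁₂).symm
  have hB : ∀ s, B s = d (x s) := by
    intro s
    have h1 : B s = ((Equiv.Set.sumDiffSubset hb₁₂ s : b₂) : KaehlerFiber ev) := by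
      simp [B, B₂]
    rw [h1]
    rcases s with s | s
    · exact (hz s).symm
    · exact (ht s).symm
  obtain ⟨g₁, hg₁, hcoord⟩ := exists_isCoordinateSystem_of_basis ev x B hB
  have hsup : J ≤ Ideal.span (Set.range fun i => x (.inl i)) ⊔ RingHom.ker ev • J := by
    intro a ha
    have h1 : d a ∈ Submodule.span k b₁ := by
      rw [hspan₁]
      exact Submodule.subset_span ⟨a, ha, rfl⟩
    have h2 : ∀ v ∈ Submodule.span k b₁, ∃ w ∈ Ideal.span (Set.range fun i => x (.inl i)),
        w ∈ J ∧ d w = v := by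
      intro v hv
      induction hv using Submodule.span_induction with
      | mem v hv => exact ⟨z ⟨v, hv⟩, Ideal.subset_span ⟨⟨v, hv⟩, rfl⟩, hzJ _, hz ⟨v, hv⟩⟩
      | zero => exact ⟨0, zero_mem _, zero_mem _, by simp [d]⟩
      | add v v' _ _ hv hv' =>
        obtain ⟨w, hw, hwJ, rfl⟩ := hv
        obtain ⟨w', hw', hwJ', rfl⟩ := hv'
        exact ⟨w + w', add_mem hw hw', add_mem hwJ hwJ', hd w w'⟩
      | smul c v _ hv =>
        obtain ⟨w, hw, hwJ, rfl⟩ := hv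
        refine ⟨c • w, Submodule.smul_of_tower_mem _ _ hw, Submodule.smul_of_tower_mem _ _ hwJ, ?_⟩
        change toKaehlerFiber ev (KaehlerDifferential.D k A (c • w)) =
          c • toKaehlerFiber ev (KaehlerDifferential.D k A w)
        rw [Derivation.map_smul, ← algebraMap_smul A c, toKaehlerFiber_smul, AlgHom.commutes]
        rfl
    obtain ⟨w, hw, hwJ, hwa⟩ := h2 _ h1
    -- By choice `w` and `a` have the same differential at the point, so their difference lies in `m
    -- J + J²`, and `J²` is absorbed since `J ≤ m`.
    have h3 : a - w ∈ RingHom.ker ev * J ⊔ J ^ 2 := by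
      refine mem_sup_of_toKaehlerFiber_eq_zero ev (sub_mem ha hwJ) ?_
      rw [map_sub, map_sub, sub_eq_zero]
      exact hwa.symm
    have h4 : RingHom.ker ev * J ⊔ J ^ 2 = RingHom.ker ev • J := by
      rw [sq]
      exact sup_eq_left.mpr (Ideal.mul_mono_left hJ)
    rw [h4] at h3
    exact Submodule.mem_sup.mpr ⟨w, hw, a - w, h3, by ring⟩
  obtain ⟨g₂, hg₂, hspan⟩ := Submodule.exists_sub_one_mem_and_smul_le_of_fg_of_le_sup
    ((isNoetherianRing_iff_ideal_fg A).mp inferInstance J) le_rfl hsup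
  refine ⟨b₁, ↑(b₂ \ b₁), inferInstance, inferInstance, x, g₁ * g₂, ?_, hzJ, ?_, ?_⟩
  · rw [RingHom.mem_ker, map_sub, map_one, sub_eq_zero] at hg₂
    rw [map_mul, hg₂, mul_one]
    exact hg₁
  · intro a ha
    rw [mul_assoc]
    exact Ideal.mul_mem_left _ _ (hspan (Submodule.smul_mem_pointwise_smul _ _ _ ha))
  · intro T _ _ _ _ _ hg
    rw [map_mul] at hg
    exact hcoord T (isUnit_of_mul_isUnit_left hg)

end Adapted

/-! ### The charts of the blow-up of a hypersurface -/

section HypersurfaceCharts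

theorem exists_algebra_of_surjective {A R S : Type*} [CommRing A] [CommRing R] [CommRing S]
    [Algebra A R] [Algebra A S] (hsurj : Function.Surjective (algebraMap A R))
    (hK : ∀ a, algebraMap A R a = 0 → algebraMap A S a = 0) :
    ∃ _ : Algebra R S, IsScalarTower A R S := by
  let φ : R →+* S := (algebraMap A R).liftOfSurjective hsurj ⟨algebraMap A S, hK⟩
  let _ : Algebra R S := φ.toAlgebra
  refine ⟨φ.toAlgebra, IsScalarTower.of_algebraMap_eq fun a => ?_⟩
  exact (RingHom.liftOfRightInverse_comp_apply _ _ _ ⟨algebraMap A S, hK⟩ a).symm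

/-- A chart of the blow-up of `Spec R` along the ideal `I` in the direction of the generator `z`,
all of whose points on the exceptional divisor are admissible. -/
def HasAdmissibleChart {R : Type} [CommRing R] [Algebra ℂ R] (I : Ideal R) (r : ℕ) (z : R) : Prop :=
  ∃ (S : Type) (_ : CommRing S) (_ : Algebra ℂ S) (_ : Algebra R S)
      (_ : IsScalarTower ℂ R S), Algebra.FiniteType ℂ S ∧
      algebraMap R S z ∈ nonZeroDivisors S ∧
      (∀ a ∈ I, algebraMap R S z ∣ algebraMap R S a) ∧
      Algebra.adjoin R {w : S | ∃ a ∈ I, algebraMap R S a = algebraMap R S z * w} = ⊤ ∧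
      (∀ a, algebraMap R S a = 0 → ∃ n : ℕ, z ^ n * a = 0) ∧
      ∀ q : Spec (.of S), algebraMap R S z ∈ q.asIdeal →
        IsAdmissibleAt (Spec.map (CommRingCat.ofHom (algebraMap ℂ S))) r q

/-- The chart is `S / (F)`, and most properties descend from `A → S`. The exponent `N` is `2` for a
quadratic singularity, while a smooth `X` is covered by `F = 0`. -/
theorem IsBlowupChart.hasAdmissibleChart {A S ι τ : Type} [DecidableEq ι] [CommRing A]
    [CommRing S] [Algebra ℂ A] [Algebra ℂ S] [Algebra A S] [IsScalarTower ℂ A S] {x : ι ⊕ τ → A}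
    {l : ι} {y : ι ⊕ τ → S} (c : IsBlowupChart ℂ x l y)
    {R : Type} [CommRing R] [Algebra ℂ R] [Algebra A R] [IsScalarTower ℂ A R]
    (hsurj : Function.Surjective (algebraMap A R)) {f : A} {F : S} {N : ℕ}
    (hf : algebraMap A S f = y (.inl l) ^ N * F)
    (hker : ∀ a, algebraMap A R a = 0 ↔ a ∈ Ideal.span {f}) {I : Ideal R}
    (hI : I.comap (algebraMap A R) = Ideal.span (Set.range fun i => x (.inl i)))
    (hnzd : Ideal.Quotient.mk (Ideal.span {F}) (y (.inl l)) ∈ nonZeroDivisors (S ⧸ Ideal.span {F}))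
    {r : ℕ} (hadm : ∀ q : Spec (.of (S ⧸ Ideal.span {F})),
      Ideal.Quotient.mk _ (y (.inl l)) ∈ q.asIdeal →
      IsAdmissibleAt (Spec.map (CommRingCat.ofHom (algebraMap ℂ (S ⧸ Ideal.span {F})))) r q) :
    HasAdmissibleChart I r (algebraMap A R (x (.inl l))) := by
  let C := S ⧸ Ideal.span {F}
  have := c.smooth
  have hF : Ideal.Quotient.mk (Ideal.span {F}) F = 0 :=
    Ideal.Quotient.eq_zero_iff_mem.mpr (Ideal.mem_span_singleton_self F)
  have hAC : ∀ a, algebraMap A C a = Ideal.Quotient.mk _ (algebraMap A S a) := fun a => rfl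
  have hK : ∀ a, algebraMap A R a = 0 → algebraMap A C a = 0 := by
    intro a ha
    obtain ⟨b, rfl⟩ := Ideal.mem_span_singleton'.mp ((hker a).mp ha)
    rw [hAC, map_mul, hf, map_mul, map_mul, hF, mul_zero, mul_zero]
  obtain ⟨_, _⟩ := exists_algebra_of_surjective hsurj hK
  have hRC : ∀ a, algebraMap R C (algebraMap A R a) = Ideal.Quotient.mk _ (algebraMap A S a) :=
    fun a => (IsScalarTower.algebraMap_apply A R C a).symm
  have hx : ∀ i, algebraMap A R (x (.inl i)) ∈ I := fun i => by
    rw [← Ideal.mem_comap, hI]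
    exact Ideal.subset_span ⟨i, rfl⟩
  have htower : IsScalarTower ℂ R C := IsScalarTower.of_algebraMap_eq fun t => by
    rw [IsScalarTower.algebraMap_apply ℂ A R, ← IsScalarTower.algebraMap_apply A R C,
      ← IsScalarTower.algebraMap_apply ℂ A C]
  refine ⟨C, inferInstance, inferInstance, _, htower, inferInstance, ?_, ?_, ?_, ?_, ?_⟩
  · rw [hRC, c.algebraMap_self]
    exact hnzd
  · intro a ha
    obtain ⟨a, rfl⟩ := hsurj a
    rw [hRC, hRC, c.algebraMap_self]
    refine map_dvd _ ?_
    have ha' : a ∈ Ideal.span (Set.range fun i => x (.inl i)) := by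
      rw [← hI]
      exact ha
    have hle : Ideal.span (Set.range fun i => x (.inl i)) ≤
        (Ideal.span {y (.inl l)}).comap (algebraMap A S) := by
      rw [Ideal.span_le]
      rintro _ ⟨i, rfl⟩
      rw [SetLike.mem_coe, Ideal.mem_comap, Ideal.mem_span_singleton]
      exact ⟨_, c.algebraMap_eq_mul i⟩
    exact Ideal.mem_span_singleton.mp (hle ha')
  · rw [eq_top_iff]
    rintro s -
    obtain ⟨s, rfl⟩ := Ideal.Quotient.mk_surjective s
    have hs : s ∈ Algebra.adjoin A (Set.range (homogeneousCoord l y)) := by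
      rw [c.adjoin_homogeneousCoord]
      trivial
    induction hs using Algebra.adjoin_induction with
    | mem s hs =>
      obtain ⟨i, rfl⟩ := hs
      refine Algebra.subset_adjoin ⟨_, hx i, ?_⟩
      rw [hRC, hRC, c.algebraMap_self, ← map_mul, c.algebraMap_eq_mul]
    | algebraMap a =>
      rw [← hRC]
      exact Subalgebra.algebraMap_mem _ _
    | add s t _ _ hs ht =>
      rw [map_add]
      exact add_mem hs ht
    | mul s t _ _ hs ht =>
      rw [map_mul]
      exact mul_mem hs ht
  · intro a ha
    obtain ⟨a, rfl⟩ := hsurj a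
    rw [hRC, Ideal.Quotient.eq_zero_iff_mem] at ha
    obtain ⟨s, hs⟩ := Ideal.mem_span_singleton'.mp ha
    -- If `a` becomes `s F` in `S`, clearing the denominators of `s` shows that a power of `x l`
    -- times `a` is a multiple of `f`.
    obtain ⟨n, b, hb⟩ := c.exists_pow_mul_eq_algebraMap s
    have h1 : algebraMap A S (x (.inl l) ^ (N + n) * a - f * b) = 0 := by
      rw [map_sub, map_mul, map_mul, map_pow, c.algebraMap_self, hf, ← hb, ← hs]
      ring
    obtain ⟨m, hm⟩ := c.exists_pow_mul_eq_zero h1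
    refine ⟨m + (N + n), ?_⟩
    rw [← map_pow, ← map_mul, hker, Ideal.mem_span_singleton']
    exact ⟨x (.inl l) ^ m * b, by linear_combination -hm⟩
  · intro q hq
    rw [hRC, c.algebraMap_self] at hq
    exact hadm q hq

theorem hasAdmissibleChart_of_isCoordinateSystem {A ι τ : Type} [CommRing A] [Algebra ℂ A]
    [Algebra.Smooth ℂ A] [Finite ι] [Finite τ] {x : ι ⊕ τ → A} (h : IsCoordinateSystem ℂ x)
    {R : Type} [CommRing R] [Algebra ℂ R] [Algebra A R] [IsScalarTower ℂ A R]
    (hsurj : Function.Surjective (algebraMap A R))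
    (hker : ∀ a, algebraMap A R a = 0 ↔ a ∈ Ideal.span {(0 : A)}) {I : Ideal R}
    (hI : I.comap (algebraMap A R) = Ideal.span (Set.range fun i => x (.inl i))) (r : ℕ) (l : ι) :
    HasAdmissibleChart I r (algebraMap A R (x (.inl l))) := by
  classical
  obtain ⟨S, _, _, _, _, y, c⟩ := exists_isBlowupChart ℂ h l
  have := c.smooth
  refine c.hasAdmissibleChart hsurj (F := 0) (N := 0) (by simp) hker hI ?_ ?_
  · rw [mem_nonZeroDivisors_iff_right]
    intro s hs
    obtain ⟨s, rfl⟩ := Ideal.Quotient.mk_surjective s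
    rw [← map_mul, Ideal.Quotient.eq_zero_iff_mem, Ideal.mem_span_singleton, zero_dvd_iff] at hs
    rw [mem_nonZeroDivisors_iff_right.mp c.mem_nonZeroDivisors _ hs, map_zero]
  · intro q _
    let e : S ≃ₐ[ℂ] S ⧸ Ideal.span {(0 : S)} :=
      (AlgEquiv.quotientBot ℂ S).symm.trans (Ideal.quotientEquivAlgOfEq ℂ (by simp))
    have := Algebra.Smooth.of_equiv e
    exact isAdmissibleAt_Spec_of_smooth r q

theorem hasAdmissibleChart_of_isSymm {A ι τ : Type} [CommRing A] [Algebra ℂ A]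
    [Algebra.Smooth ℂ A] [Fintype ι] [Fintype τ] {x : ι ⊕ τ → A} (h : IsCoordinateSystem ℂ x)
    {R : Type} [CommRing R] [Algebra ℂ R] [Algebra A R] [IsScalarTower ℂ A R]
    (hsurj : Function.Surjective (algebraMap A R)) {a : Matrix ι ι A} (ha : a.IsSymm)
    (hker : ∀ b, algebraMap A R b = 0 ↔
      b ∈ Ideal.span {∑ i, ∑ j, a i j * (x (.inl i) * x (.inl j))}) {I : Ideal R}
    (hI : I.comap (algebraMap A R) = Ideal.span (Set.range fun i => x (.inl i)))
    (hJ : (Ideal.span (Set.range fun i => x (.inl i))).IsPrime) {r n : ℕ} (hr : r ≤ n) (hn : 0 < n)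
    (b d : Fin n → ι) (hdet : IsUnit (a.submatrix b d).det) (l : ι) :
    HasAdmissibleChart I r (algebraMap A R (x (.inl l))) := by
  classical
  obtain ⟨S, _, _, _, _, y, c⟩ := exists_isBlowupChart ℂ h l
  -- A minor of positive size with all entries in the proper ideal could not be a unit; this is one
  -- use of `0 < n`.
  obtain ⟨p, q, hpq⟩ : ∃ p q, a p q ∉ Ideal.span (Set.range fun i => x (.inl i)) := by
    by_contra! hall
    refine hJ.ne_top ((Ideal.eq_top_iff_one _).mpr ?_)
    have h1 : (a.submatrix b d).det ∈ Ideal.span (Set.range fun i => x (.inl i)) := by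
      rw [Matrix.det_apply]
      refine sum_mem fun σ _ => Submodule.smul_of_tower_mem _ _ ?_
      rw [← Finset.mul_prod_erase _ _ (Finset.mem_univ (⟨0, hn⟩ : Fin n))]
      exact Ideal.mul_mem_right _ _ (hall _ _)
    obtain ⟨u, hu⟩ := hdet
    rw [← hu] at h1
    have := Ideal.mul_mem_left _ ((u⁻¹ : Aˣ) : A) h1
    rwa [Units.inv_mul] at this
  exact c.hasAdmissibleChart hsurj (c.algebraMap_eq_sq_mul_strictTransform a) hker hI
    (c.mem_nonZeroDivisors_quotient a h ha hJ hpq)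
    fun q hq => c.isAdmissibleAt a h ha hr hn b d hdet q hq

end HypersurfaceCharts

/-! ### Hypersurface charts -/

section HypersurfaceChart

variable {X : Scheme.{0}}

/-- The open immersion `j` identifies the hypersurface `f = 0` in the smooth affine scheme `Spec A`
with an open subscheme of `X`. -/
structure IsHypersurfaceChart (s : X ⟶ Spec (.of ℂ)) {A : Type} [CommRing A] [Algebra ℂ A] (f : A)
    (j : Spec (.of (A ⧸ Ideal.span {f})) ⟶ X) : Prop where
  smooth : Algebra.Smooth ℂ A
  isOpenImmersion : IsOpenImmersion j
  comp_eq : j ≫ s = Spec.map (CommRingCat.ofHom (algebraMap ℂ (A ⧸ Ideal.span {f})))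

/-- The ideal of the functions on `Spec A` vanishing on the trace of `B`. -/
noncomputable def chartIdeal {A : Type} [CommRing A] (f : A)
    (j : Spec (.of (A ⧸ Ideal.span {f})) ⟶ X) (B : Set X) : Ideal A :=
  (PrimeSpectrum.vanishingIdeal (j ⁻¹' B)).comap (Ideal.Quotient.mk (Ideal.span {f}))

theorem mem_chartIdeal {A : Type} [CommRing A] {f : A}
    {j : Spec (.of (A ⧸ Ideal.span {f})) ⟶ X} {B : Set X} {a : A} :
    a ∈ chartIdeal f j B ↔ ∀ q : Spec (.of (A ⧸ Ideal.span {f})), j q ∈ B →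
      Ideal.Quotient.mk (Ideal.span {f}) a ∈ q.asIdeal :=
  PrimeSpectrum.mem_vanishingIdeal _ _

theorem self_mem_chartIdeal {A : Type} [CommRing A] {f : A}
    {j : Spec (.of (A ⧸ Ideal.span {f})) ⟶ X} {B : Set X} : f ∈ chartIdeal f j B := by
  rw [mem_chartIdeal]
  intro q _
  rw [Ideal.Quotient.eq_zero_iff_mem.mpr (Ideal.mem_span_singleton_self f)]
  exact zero_mem _

theorem isPrime_chartIdeal {A : Type} [CommRing A] {f : A}
    {j : Spec (.of (A ⧸ Ideal.span {f})) ⟶ X} [IsOpenImmersion j] {B : Set X}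
    (hB : IsIrreducible B) {q : Spec (.of (A ⧸ Ideal.span {f}))} (hq : j q ∈ B) :
    (chartIdeal f j B).IsPrime := by
  have h1 : IsIrreducible (j ⁻¹' B) := ⟨⟨q, hq⟩, hB.2.preimage j.isOpenEmbedding⟩
  have h2 := PrimeSpectrum.isIrreducible_iff_vanishingIdeal_isPrime.mp h1
  exact h2.comap _

variable {s : X ⟶ Spec (.of ℂ)} {A : Type} [CommRing A] [Algebra ℂ A] {f : A}
  {j : Spec (.of (A ⧸ Ideal.span {f})) ⟶ X}

theorem IsHypersurfaceChart.exists_away (h : IsHypersurfaceChart s f j) (B : Set X) (g : A)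
    (T : Type) [CommRing T] [Algebra ℂ T] [Algebra A T] [IsScalarTower ℂ A T]
    [IsLocalization.Away g T] :
    ∃ j' : Spec (.of (T ⧸ Ideal.span {algebraMap A T f})) ⟶ X,
      IsHypersurfaceChart s (algebraMap A T f) j' ∧
      chartIdeal (algebraMap A T f) j' B = (chartIdeal f j B).map (algebraMap A T) := by
  have := h.smooth
  have := h.isOpenImmersion
  have : Algebra.Smooth A T := Algebra.Smooth.of_isLocalization_Away g
  obtain ⟨φ, hφ, hφo, hrange⟩ := exists_isOpenImmersion_Spec_quotient_away T f g
  refine ⟨Spec.map (CommRingCat.ofHom φ.toRingHom) ≫ j,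
    ⟨Algebra.Smooth.comp ℂ A T, inferInstance, ?_⟩, ?_⟩
  · rw [Category.assoc, h.comp_eq, ← Spec.map_comp, ← CommRingCat.ofHom_comp]
    congr 2
    exact φ.comp_algebraMap
  · have hmem : ∀ (q' : Spec (.of (T ⧸ Ideal.span {algebraMap A T f}))) (a : A),
        Ideal.Quotient.mk _ (algebraMap A T a) ∈ q'.asIdeal ↔ Ideal.Quotient.mk _ a ∈
          (Spec.map (CommRingCat.ofHom φ.toRingHom) q').asIdeal := by
      intro q' a
      rw [← hφ]
      rfl
    apply le_antisymm
    · intro t ht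
      obtain ⟨a, e, rfl⟩ := IsLocalization.exists_mk'_eq (.powers g) t
      have h1 : algebraMap A T a ∈ chartIdeal (algebraMap A T f)
          (Spec.map (CommRingCat.ofHom φ.toRingHom) ≫ j) B := by
        rw [← IsLocalization.mk'_spec T a e]
        exact Ideal.mul_mem_right _ _ ht
      rw [mem_chartIdeal] at h1
      -- Nothing is known about `a` at points of `B` outside the principal open set, but `g`
      -- vanishes there.
      have h2 : g * a ∈ chartIdeal f j B := by
        rw [mem_chartIdeal]
        intro q hq
        rw [map_mul]
        by_cases hg : Ideal.Quotient.mk (Ideal.span {f}) g ∈ q.asIdeal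
        · exact Ideal.mul_mem_right _ _ hg
        · obtain ⟨q', rfl⟩ := (hrange q).mpr hg
          refine Ideal.mul_mem_left _ _ ((hmem q' a).mp (h1 q' ?_))
          rwa [Scheme.Hom.comp_apply]
      rw [IsLocalization.mk'_mem_map_algebraMap_iff (.powers g)]
      exact ⟨g, Submonoid.mem_powers g, h2⟩
    · rw [Ideal.map_le_iff_le_comap]
      intro a ha
      rw [Ideal.mem_comap, mem_chartIdeal]
      rw [mem_chartIdeal] at ha
      intro q' hq'
      rw [hmem]
      refine ha _ ?_
      rwa [Scheme.Hom.comp_apply] at hq'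

/-- A point where `D f` is nonzero would be nonsingular by the Jacobian criterion. -/
theorem IsHypersurfaceChart.derivation_mem_chartIdeal (h : IsHypersurfaceChart s f j) {B : Set X}
    (hB : B ⊆ singularLocus s) (D : Derivation ℂ A A) : D f ∈ chartIdeal f j B := by
  have := h.smooth
  have := h.isOpenImmersion
  rw [mem_chartIdeal]
  intro q hq
  by_contra hD
  have h1 := isNonsingularAt_Spec_quotient f q D hD
  rw [← h.comp_eq, isNonsingularAt_comp_iff] at h1
  exact hB hq h1

/-- If a hypersurface chart has admissible blow-up charts, then `X` has an affine open subset whose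
blow-up is admissible. -/
theorem IsHypersurfaceChart.exists_affineOpens [LocallyOfFiniteType s]
    (h : IsHypersurfaceChart s f j) {r : ℕ} (hX : ∀ x, IsAdmissibleAt s r x) (B : Closeds X)
    (hJ : (chartIdeal f j (B : Set X)).IsPrime) {ι : Type} {x : ι → A}
    (hx : chartIdeal f j (B : Set X) = Ideal.span (Set.range x))
    (hchart : ∀ (R : Type) [CommRing R] [Algebra ℂ R] [Algebra A R] [IsScalarTower ℂ A R]
      (_ : Function.Surjective (algebraMap A R))
      (_ : ∀ a, algebraMap A R a = 0 ↔ a ∈ Ideal.span {f}) (I : Ideal R)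
      (_ : I.comap (algebraMap A R) = Ideal.span (Set.range x)) (l : ι),
      HasAdmissibleChart I r (algebraMap A R (x l))) :
    ∃ U : X.affineOpens, (((U : X.Opens) : Set X) ∩ (B : Set X)).Nonempty ∧
      ∀ y, IsAdmissibleAt (blowupMap B U ≫ s) r y := by
  have := h.smooth
  have := h.isOpenImmersion
  let U : X.affineOpens := ⟨j.opensRange, isAffineOpen_opensRange j⟩
  have : IsOpenImmersion U.2.fromSpec := IsAffineOpen.isOpenImmersion_fromSpec _
  have hrange : Set.range j = Set.range U.2.fromSpec := by
    rw [U.2.range_fromSpec]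
    rfl
  let e := IsOpenImmersion.isoOfRangeEq j U.2.fromSpec hrange
  have he : e.inv ≫ j = U.2.fromSpec := IsOpenImmersion.isoOfRangeEq_inv_fac j U.2.fromSpec hrange
  let θ : CommRingCat.of (A ⧸ Ideal.span {f}) ⟶ Γ(X, U) := Spec.preimage e.inv
  have hθ : Spec.map θ = e.inv := Spec.map_preimage e.inv
  have : IsIso (Spec.map θ) := hθ ▸ inferInstance
  have hθb : Function.Bijective θ := isIso_SpecMap_iff.mp this
  -- `Γ(X, U)` is only isomorphic to `A / (f)`; the chart hypothesis ranges over all quotients of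
  -- `A` with kernel `(f)` so that it applies here directly.
  let _ : Algebra A Γ(X, U) := (θ.hom.comp (Ideal.Quotient.mk (Ideal.span {f}))).toAlgebra
  let _ : Algebra ℂ Γ(X, U) := ((algebraMap A Γ(X, U)).comp (algebraMap ℂ A)).toAlgebra
  have : IsScalarTower ℂ A Γ(X, U) := IsScalarTower.of_algebraMap_eq fun _ => rfl
  have hA : ∀ a, algebraMap A Γ(X, U) a = θ (Ideal.Quotient.mk (Ideal.span {f}) a) := fun _ => rfl
  have hsurj : Function.Surjective (algebraMap A Γ(X, U)) :=
    hθb.surjective.comp Ideal.Quotient.mk_surjective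
  have hker : ∀ a, algebraMap A Γ(X, U) a = 0 ↔ a ∈ Ideal.span {f} := fun a => by
    rw [hA, map_eq_zero_iff _ hθb.injective, Ideal.Quotient.eq_zero_iff_mem]
  have hI : (subvarietyIdeal B U).comap (algebraMap A Γ(X, U)) = Ideal.span (Set.range x) := by
    rw [← hx]
    ext a
    have hsub : subvarietyIdeal B U =
        PrimeSpectrum.vanishingIdeal (U.2.fromSpec ⁻¹' (B : Set X)) := rfl
    rw [Ideal.mem_comap, hsub, PrimeSpectrum.mem_vanishingIdeal, mem_chartIdeal]
    have hpt : ∀ p, j (e.inv p) ∈ (B : Set X) ↔ U.2.fromSpec p ∈ (B : Set X) := fun p => by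
      rw [← he, Scheme.Hom.comp_apply]
    have hmem : ∀ p : Spec Γ(X, U), algebraMap A Γ(X, U) a ∈ p.asIdeal ↔
        Ideal.Quotient.mk (Ideal.span {f}) a ∈ (e.inv p).asIdeal := fun p => by
      rw [← hθ]
      rfl
    constructor
    · intro h1 q hq
      obtain ⟨p, rfl⟩ := e.inv.homeomorph.surjective q
      exact (hmem p).mp (h1 p ((hpt p).mp hq))
    · intro h1 p hp
      exact (hmem p).mpr (h1 _ ((hpt p).mpr hp))
  have hI' : subvarietyIdeal B U = Ideal.span (Set.range fun l => algebraMap A Γ(X, U) (x l)) := by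
    rw [← Ideal.map_comap_of_surjective _ hsurj (subvarietyIdeal B U), hI, Ideal.map_span,
      ← Set.range_comp]
    rfl
  have : IsNoetherianRing A := Algebra.FiniteType.isNoetherianRing ℂ A
  have : IsNoetherianRing Γ(X, U) := isNoetherianRing_of_surjective _ _ (algebraMap A _) hsurj
  have hk : U.2.fromSpec ≫ s = Spec.map (CommRingCat.ofHom (algebraMap ℂ Γ(X, U))) := by
    rw [← he, Category.assoc, h.comp_eq, ← hθ, ← Spec.map_comp]
    rfl
  refine ⟨U, ?_, fun y => ?_⟩
  · by_contra hempty
    refine hJ.ne_top ((Ideal.eq_top_iff_one _).mpr (mem_chartIdeal.mpr fun q hq => ?_))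
    exact (hempty ⟨j q, ⟨q, rfl⟩, hq⟩).elim
  · exact isAdmissibleAt_affineBlowup s hX (R := Γ(X, U)) U.2.fromSpec hk _ hI'
      (fun l => hchart Γ(X, U) hsurj hker _ hI l) y

end HypersurfaceChart

/-! ### Shrinking a chart -/

section Shrinking

/-- Evaluation at a point extends to the localization at a function not vanishing there. -/
theorem exists_evaluation_extension {A T : Type*} [CommRing A] [CommRing T] [Algebra ℂ A]
    [Algebra ℂ T] [Algebra A T] [IsScalarTower ℂ A T] (ev : A →ₐ[ℂ] ℂ) {g : A} (hg : ev g ≠ 0)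
    [IsLocalization.Away g T] :
    ∃ ev' : T →ₐ[ℂ] ℂ, (∀ a, ev' (algebraMap A T a) = ev a) ∧
      RingHom.ker ev' = (RingHom.ker ev).map (algebraMap A T) := by
  have hu : ∀ y : Submonoid.powers g, IsUnit (ev y) := by
    rintro ⟨_, n, rfl⟩
    rw [map_pow]
    exact (IsUnit.mk0 _ hg).pow n
  let ev' : T →ₐ[ℂ] ℂ := IsLocalization.liftAlgHom (M := .powers g) (f := ev) hu
  have hev : ∀ a, ev' (algebraMap A T a) = ev a := fun a => IsLocalization.lift_eq hu a
  refine ⟨ev', hev, ?_⟩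
  rw [← IsLocalization.map_under (.powers g) T (RingHom.ker ev')]
  congr 1
  ext a
  rw [Ideal.under_def, Ideal.mem_comap, RingHom.mem_ker, RingHom.mem_ker, hev]

/-- A variety over a field of characteristic zero is generically smooth. -/
theorem exists_ne_zero_smooth (C : Type) [CommRing C] [IsDomain C] [Algebra ℂ C]
    [Algebra.FiniteType ℂ C] : ∃ c : C, c ≠ 0 ∧ Algebra.Smooth ℂ (Localization.Away c) := by
  have : IsNoetherianRing C := Algebra.FiniteType.isNoetherianRing ℂ C
  have : Algebra.FinitePresentation ℂ C := Algebra.FinitePresentation.of_finiteType.mp inferInstance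
  let L := Localization.AtPrime (⊥ : Ideal C)
  have hle : (⊥ : Ideal C).primeCompl = nonZeroDivisors C := by
    ext c
    simp [Ideal.primeCompl, mem_nonZeroDivisors_iff_ne_zero]
  have hfrac : IsFractionRing C L :=
    IsLocalization.of_le_of_exists_dvd (⊥ : Ideal C).primeCompl _ hle.le
      fun c hc => ⟨c, hle.ge hc, dvd_rfl⟩
  let _ : Field L := IsFractionRing.toField C
  have : Algebra.EssFiniteType C L := .of_isLocalization _ (⊥ : Ideal C).primeCompl
  have : Algebra.EssFiniteType ℂ L := .comp ℂ C L
  -- At the generic point, smoothness is formal smoothness of the function field, which holds in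
  -- characteristic zero.
  have : Algebra.IsSmoothAt ℂ (⊥ : Ideal C) := by
    change Algebra.FormallySmooth ℂ L
    infer_instance
  obtain ⟨c, hc, hs⟩ := Algebra.IsSmoothAt.exists_notMem_smooth ℂ (⊥ : Ideal C)
  exact ⟨c, hc, hs⟩

theorem exists_isLocalization_away {A : Type} [CommRing A] [Algebra ℂ A] (g : A) :
    ∃ (T : Type) (_ : CommRing T) (_ : Algebra ℂ T) (_ : Algebra A T) (_ : IsScalarTower ℂ A T),
      IsLocalization.Away g T :=
  ⟨Localization.Away g, inferInstance, inferInstance, inferInstance, inferInstance, inferInstance⟩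

/-- The localization of a quotient is smooth if the quotient is smooth over the basic open set. -/
theorem smooth_quotient_of_smooth_away {A T : Type} [CommRing A] [CommRing T] [Algebra ℂ A]
    [Algebra ℂ T] [Algebra A T] [IsScalarTower ℂ A T] (g : A) [IsLocalization.Away g T]
    {I : Ideal A} {J : Ideal T} (hJ : J = I.map (algebraMap A T))
    [Algebra.Smooth ℂ (Localization.Away (Ideal.Quotient.mk I g))] : Algebra.Smooth ℂ (T ⧸ J) := by
  have hle : I ≤ J.comap (algebraMap A T) := hJ ▸ Ideal.le_comap_map
  let _ := (Ideal.quotientMap J (algebraMap A T) hle).toAlgebra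
  have : IsLocalization.Away (Ideal.Quotient.mk I g) (T ⧸ J) :=
    isLocalization_away_quotient g hJ hle
  have : IsScalarTower ℂ (A ⧸ I) (T ⧸ J) := IsScalarTower.of_algebraMap_eq fun t => by
    change Ideal.Quotient.mk J (algebraMap ℂ T t) =
      Ideal.quotientMap J (algebraMap A T) hle (Ideal.Quotient.mk I (algebraMap ℂ A t))
    rw [Ideal.quotientMap_mk, ← IsScalarTower.algebraMap_apply]
  exact .of_equiv ((IsLocalization.algEquiv (.powers (Ideal.Quotient.mk I g))
    (Localization.Away (Ideal.Quotient.mk I g)) (T ⧸ J)).restrictScalars ℂ)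

variable {X : Scheme.{0}} {s : X ⟶ Spec (.of ℂ)} {A : Type} [CommRing A] [Algebra ℂ A] {f : A}
  {j : Spec (.of (A ⧸ Ideal.span {f})) ⟶ X}

theorem IsHypersurfaceChart.exists_away_isPrime (h : IsHypersurfaceChart s f j) {B : Set X}
    (hJ : (chartIdeal f j B).IsPrime) {g : A} (hg : g ∉ chartIdeal f j B)
    (T : Type) [CommRing T] [Algebra ℂ T] [Algebra A T] [IsScalarTower ℂ A T]
    [IsLocalization.Away g T] :
    ∃ j' : Spec (.of (T ⧸ Ideal.span {algebraMap A T f})) ⟶ X,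
      IsHypersurfaceChart s (algebraMap A T f) j' ∧
      chartIdeal (algebraMap A T f) j' B = (chartIdeal f j B).map (algebraMap A T) ∧
      ((chartIdeal f j B).map (algebraMap A T)).IsPrime := by
  obtain ⟨j', hj', hJ'⟩ := h.exists_away B g T
  refine ⟨j', hj', hJ', ?_⟩
  exact IsLocalization.isPrime_of_isPrime_disjoint (.powers g) T _ hJ
    ((Ideal.disjoint_powers_iff_notMem_of_isPrime g).mpr hg)

/-- After shrinking a chart meeting `B`, the set `B` is cut out by some of the functions of a
coordinate system. -/
theorem IsHypersurfaceChart.exists_adapted (h : IsHypersurfaceChart s f j) {B : Set X}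
    (hJ : (chartIdeal f j B).IsPrime) :
    ∃ (T : Type) (_ : CommRing T) (_ : Algebra ℂ T) (_ : Algebra A T) (_ : IsScalarTower ℂ A T)
      (_ : Algebra.FormallyEtale A T)
      (j' : Spec (.of (T ⧸ Ideal.span {algebraMap A T f})) ⟶ X) (ev : T →ₐ[ℂ] ℂ) (ι τ : Type)
      (_ : Fintype ι) (_ : Fintype τ) (x : ι ⊕ τ → T),
      IsHypersurfaceChart s (algebraMap A T f) j' ∧
      (chartIdeal (algebraMap A T f) j' B).IsPrime ∧
      chartIdeal (algebraMap A T f) j' B ≤ RingHom.ker ev ∧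
      chartIdeal (algebraMap A T f) j' B = Ideal.span (Set.range fun i => x (.inl i)) ∧
      IsCoordinateSystem ℂ x := by
  have := h.smooth
  -- Generic smoothness of `B`; the new chart still meets `B` because `c` is nonzero on it.
  obtain ⟨c, hc, _⟩ := exists_ne_zero_smooth (A ⧸ chartIdeal f j B)
  obtain ⟨g, rfl⟩ := Ideal.Quotient.mk_surjective c
  have hg : g ∉ chartIdeal f j B := fun hg => hc (Ideal.Quotient.eq_zero_iff_mem.mpr hg)
  obtain ⟨A₁, _, _, _, _, _⟩ := exists_isLocalization_away g
  obtain ⟨j₁, h₁, hJ₁, hp₁⟩ := h.exists_away_isPrime hJ hg A₁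
  have := h₁.smooth
  have : IsNoetherianRing A₁ := Algebra.FiniteType.isNoetherianRing ℂ A₁
  have : Algebra.Smooth ℂ (A₁ ⧸ chartIdeal (algebraMap A A₁ f) j₁ B) :=
    smooth_quotient_of_smooth_away g hJ₁
  rw [← hJ₁] at hp₁
  -- Any closed point of the smooth part of `B` serves here; it need not be a point chosen earlier.
  obtain ⟨m, hm, hle⟩ := Ideal.exists_le_maximal _ hp₁.ne_top
  obtain ⟨ev₁, rfl⟩ := exists_ker_eq_of_isMaximal m
  obtain ⟨ι, τ, _, _, x, g₁, hg₁, hxJ, hJx, hcoord⟩ := exists_isCoordinateSystem_adapted ev₁ hle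
  have hg₁' : g₁ ∉ chartIdeal (algebraMap A A₁ f) j₁ B := fun h' => hg₁ (hle h')
  obtain ⟨T, _, _, _, _, _⟩ := exists_isLocalization_away g₁
  obtain ⟨j₂, h₂, hJ₂, hp₂⟩ := h₁.exists_away_isPrime hp₁ hg₁' T
  obtain ⟨ev, hev, hker⟩ := exists_evaluation_extension ev₁ hg₁ (T := T)
  have hu : IsUnit (algebraMap A₁ T g₁) := IsLocalization.Away.algebraMap_isUnit g₁
  have : Algebra.FormallyEtale A A₁ := .of_isLocalization (.powers g)
  have : Algebra.FormallyEtale A₁ T := .of_isLocalization (.powers g₁)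
  let _ : Algebra A T := ((algebraMap A₁ T).comp (algebraMap A A₁)).toAlgebra
  have : IsScalarTower A A₁ T := IsScalarTower.of_algebraMap_eq fun _ => rfl
  have : IsScalarTower ℂ A T := IsScalarTower.of_algebraMap_eq fun t => by
    rw [IsScalarTower.algebraMap_apply A A₁ T, ← IsScalarTower.algebraMap_apply ℂ A A₁,
      ← IsScalarTower.algebraMap_apply]
  have hJ₂' : chartIdeal (algebraMap A T f) j₂ B =
    (chartIdeal (algebraMap A A₁ f) j₁ B).map (algebraMap A₁ T) := hJ₂
  refine ⟨T, inferInstance, inferInstance, inferInstance, inferInstance, .comp A A₁ T, j₂, ev, ι, τ,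
    inferInstance, inferInstance, _, h₂, hJ₂ ▸ hp₂, ?_, ?_, hcoord T hu⟩
  · rw [hJ₂', hker]
    exact Ideal.map_mono hle
  · rw [hJ₂']
    apply le_antisymm
    · rw [Ideal.map_le_iff_le_comap]
      intro a ha
      rw [Ideal.mem_comap, ← Ideal.unit_mul_mem_iff_mem _ hu, ← map_mul]
      have := Ideal.mem_map_of_mem (algebraMap A₁ T) (hJx a ha)
      rwa [Ideal.map_span, ← Set.range_comp] at this
    · rw [Ideal.span_le]
      rintro _ ⟨i, rfl⟩
      exact Ideal.mem_map_of_mem _ (hxJ i)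

end Shrinking

/-! ### Functions vanishing to order two along a coordinate subspace -/

section OrderTwo

variable {A ι τ : Type} [CommRing A] [Algebra ℂ A] [Fintype ι]

theorem pderiv_algebraMap_apply {σ T : Type} [Fintype σ] [CommRing T] [Algebra ℂ T]
    [Algebra A T] [IsScalarTower ℂ A T] [Algebra.FormallyEtale A T] {w : σ → A}
    (h : IsCoordinateSystem ℂ w) (h' : IsCoordinateSystem ℂ fun i => algebraMap A T (w i)) (i : σ)
    (a : A) : h'.pderiv i (algebraMap A T a) = algebraMap A T (h.pderiv i a) := by
  classical
  obtain ⟨D, hD⟩ := exists_derivation_extension T (h.pderiv i)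
  have h1 : D = h'.pderiv i := h'.eq_pderiv fun j => by
    rw [hD, h.pderiv_apply_coord]
    split_ifs <;> simp
  rw [← h1, hD]

/-- A function vanishing to order two along a coordinate subspace is a quadratic form in the
equations of the subspace, with functions as coefficients. -/
theorem exists_isSymm_eq_sum {x : ι ⊕ τ → A} (h : IsCoordinateSystem ℂ x) {f : A}
    (hf : f ∈ Ideal.span (Set.range fun i => x (.inl i)))
    (hdf : ∀ D : Derivation ℂ A A, D f ∈ Ideal.span (Set.range fun i => x (.inl i))) :
    ∃ a : Matrix ι ι A, a.IsSymm ∧ f = ∑ i, ∑ j, a i j * (x (.inl i) * x (.inl j)) := by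
  classical
  set J := Ideal.span (Set.range fun i => x (.inl i)) with hJ
  have hx : ∀ i, x (.inl i) ∈ J := fun i => Ideal.subset_span ⟨i, rfl⟩
  obtain ⟨c, hc⟩ := (Ideal.mem_span_range_iff_exists_fun).mp hf
  -- Differentiating `f = ∑ c_k x_k` along the `i`-th coordinate gives `c i` modulo `J`; each `c i`
  -- can then be expanded in turn.
  have hcJ : ∀ i, c i ∈ J := by
    intro i
    have h1 := hdf (h.pderiv (.inl i))
    rw [← hc, map_sum] at h1
    have h2 : ∑ k, h.pderiv (.inl i) (c k * x (.inl k)) =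
        c i + ∑ k, x (.inl k) * h.pderiv (.inl i) (c k) := by
      simp only [Derivation.leibniz, smul_eq_mul, h.pderiv_apply_coord, Finset.sum_add_distrib,
        Sum.inl.injEq, mul_ite, mul_one, mul_zero, Finset.sum_ite_eq, Finset.mem_univ, if_true]
    rw [h2] at h1
    exact (Ideal.add_mem_iff_left _ (sum_mem fun k _ => Ideal.mul_mem_right _ _ (hx k))).mp h1
  have hm : ∀ i, ∃ m : ι → A, ∑ k, m k * x (.inl k) = c i := fun i =>
    (Ideal.mem_span_range_iff_exists_fun).mp (hcJ i)
  choose m hm using hm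
  let u : A := algebraMap ℂ A 2⁻¹
  have hu : u + u = 1 := by
    rw [← map_add, ← map_one (algebraMap ℂ A)]
    norm_num
  have h1 : f = ∑ i, ∑ j, m i j * (x (.inl i) * x (.inl j)) := by
    rw [← hc]
    refine Finset.sum_congr rfl fun i _ => ?_
    rw [← hm i, Finset.sum_mul]
    exact Finset.sum_congr rfl fun j _ => by ring
  have h2 : f = ∑ i, ∑ j, m j i * (x (.inl i) * x (.inl j)) := by
    rw [Finset.sum_comm, h1]
    exact Finset.sum_congr rfl fun i _ => Finset.sum_congr rfl fun j _ => by ring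
  refine ⟨.of fun i j => u * (m i j + m j i), ?_, ?_⟩
  · ext i j
    simp [add_comm]
  · calc f = u * f + u * f := by rw [← add_mul, hu, one_mul]
      _ = u * (∑ i, ∑ j, m i j * (x (.inl i) * x (.inl j))) +
          u * (∑ i, ∑ j, m j i * (x (.inl i) * x (.inl j))) := by rw [← h1, ← h2]
      _ = _ := by
        simp only [Finset.mul_sum, ← Finset.sum_add_distrib, Matrix.of_apply]
        exact Finset.sum_congr rfl fun i _ => Finset.sum_congr rfl fun j _ => by ring

/-- The rank of the Hessian of a quadratic form in functions vanishing at a point is bounded by the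
rank of the matrix of coefficients. -/
theorem rank_hessian_le {σ : Type} [Fintype σ] {w : σ → A} (h : IsCoordinateSystem ℂ w)
    (ev : A →ₐ[ℂ] ℂ) {z : ι → A} (hz : ∀ i, ev (z i) = 0) {a : Matrix ι ι A} (ha : a.IsSymm) :
    (hessian h ev (∑ i, ∑ j, a i j * (z i * z j))).rank ≤ (a.map ev).rank := by
  classical
  let P : Matrix σ ι ℂ := .of fun s i => ev (h.pderiv s (z i))
  have h1 : hessian h ev (∑ i, ∑ j, a i j * (z i * z j)) =
      P * ((a.map ev) * ((2 : ℂ) • P.transpose)) := by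
    ext s t
    -- Only terms in which both factors `z` are differentiated survive at the point, so `a` itself
    -- is never differentiated.
    have h2 : ∀ i j, ev (h.pderiv s (h.pderiv t (a i j * (z i * z j)))) =
        P s i * ev (a i j) * P t j + P s j * ev (a i j) * P t i := by
      intro i j
      have := eval_derivation_derivation_mul ev (h.pderiv s) (h.pderiv t) (a := z i)
        (b := a i j * z j) (hz i) (by rw [map_mul, hz, mul_zero])
      rw [mul_left_comm, this]
      simp only [Derivation.leibniz, smul_eq_mul, map_add, map_mul, hz, P, Matrix.of_apply]
      ring
    have h3 : ∑ i, ∑ j, P s j * ev (a i j) * P t i = ∑ i, ∑ j, P s i * ev (a i j) * P t j := by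
      rw [Finset.sum_comm]
      exact Finset.sum_congr rfl fun i _ => Finset.sum_congr rfl fun j _ => by
        rw [ha.apply i j]
    simp only [hessian, Matrix.of_apply, map_sum, h2, Finset.sum_add_distrib, h3]
    simp only [Matrix.mul_apply, Matrix.smul_apply, Matrix.transpose_apply, Matrix.map_apply,
      Finset.mul_sum, ← Finset.sum_add_distrib, smul_eq_mul]
    exact Finset.sum_congr rfl fun i _ => Finset.sum_congr rfl fun j _ => by ring
  rw [h1]
  exact (Matrix.rank_mul_le_right _ _).trans (Matrix.rank_mul_le_left _ _)

end OrderTwo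

/-! ### The main theorem -/

section Main

variable {X : Scheme.{0}} {s : X ⟶ Spec (.of ℂ)} {A : Type} [CommRing A] [Algebra ℂ A] {f : A}
  {j : Spec (.of (A ⧸ Ideal.span {f})) ⟶ X}

/-- Blowing up a subvariety of the singular locus in a chart in which some minor of the Hessian of
the equation is invertible. -/
theorem IsHypersurfaceChart.exists_affineOpens_of_hessian [LocallyOfFiniteType s]
    (h : IsHypersurfaceChart s f j) {r : ℕ} (hX : ∀ x, IsAdmissibleAt s r x) (B : Closeds X)
    (hB : (B : Set X) ⊆ singularLocus s) (hJ : (chartIdeal f j (B : Set X)).IsPrime)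
    {σ : Type} [Fintype σ] {w : σ → A} (hw : IsCoordinateSystem ℂ w) {n : ℕ} (hr : r ≤ n)
    (hn : 0 < n) (b d : Fin n → σ)
    (hdet : IsUnit (Matrix.of fun i k => hw.pderiv (b i) (hw.pderiv (d k) f)).det) :
    ∃ U : X.affineOpens, (((U : X.Opens) : Set X) ∩ (B : Set X)).Nonempty ∧
      ∀ y, IsAdmissibleAt (blowupMap B U ≫ s) r y := by
  obtain ⟨T, _, _, _, _, _, j₁, ev, ι, τ, _, _, x, h₁, hJ₁, hle, hx, hxc⟩ := h.exists_adapted hJ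
  have hxev : ∀ i, ev (x (.inl i)) = 0 := fun i => hle (hx ▸ Ideal.subset_span ⟨i, rfl⟩)
  obtain ⟨a, ha, hfa⟩ := exists_isSymm_eq_sum hxc (hx ▸ self_mem_chartIdeal)
    (fun D => hx ▸ h₁.derivation_mem_chartIdeal hB D)
  have hwT := hw.algebraMap T
  -- The Hessian minor is a unit on the whole chart, hence nonzero at `ev` even though `ev` need not
  -- be the original quadratic singularity.
  have hrank : n ≤ (a.map ev).rank := by
    refine le_trans ?_ (rank_hessian_le hwT ev hxev ha)
    rw [← hfa]
    refine le_rank_of_det_submatrix_ne_zero _ b d ?_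
    have h1 : (hessian hwT ev (algebraMap A T f)).submatrix b d =
        ((Matrix.of fun i k => hw.pderiv (b i) (hw.pderiv (d k) f)).map (algebraMap A T)).map ev := by
      ext i k
      simp [hessian, pderiv_algebraMap_apply hw hwT]
    have h2 := (hdet.map (algebraMap A T)).map ev
    rw [RingHom.map_det, AlgHom.map_det] at h2
    rw [h1]
    exact h2.ne_zero
  obtain ⟨b', d', hdet'⟩ := exists_det_submatrix_ne_zero (a.map ev) rfl
  have hg : ev (a.submatrix b' d').det ≠ 0 := by
    rw [AlgHom.map_det]
    exact hdet'
  obtain ⟨T₂, _, _, _, _, _⟩ := exists_isLocalization_away (a.submatrix b' d').det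
  obtain ⟨j₂, h₂, hJ₂, hp₂⟩ := h₁.exists_away_isPrime hJ₁ (fun h' => hg (hle h')) T₂
  have : Algebra.FormallyEtale T T₂ := .of_isLocalization (.powers (a.submatrix b' d').det)
  have hxc₂ := hxc.algebraMap T₂
  have := h₂.smooth
  have hspan : (chartIdeal (algebraMap A T f) j₁ (B : Set X)).map (algebraMap T T₂) =
      Ideal.span (Set.range fun i => algebraMap T T₂ (x (.inl i))) := by
    rw [hx, Ideal.map_span, ← Set.range_comp]
    rfl
  refine h₂.exists_affineOpens hX B (hJ₂ ▸ hp₂) (hJ₂.trans hspan) ?_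
  intro R _ _ _ _ hsurj hker I hI l
  have hu : IsUnit ((a.map (algebraMap T T₂)).submatrix b' d').det := by
    have := IsLocalization.Away.algebraMap_isUnit (S := T₂) (a.submatrix b' d').det
    rwa [RingHom.map_det] at this
  refine hasAdmissibleChart_of_isSymm hxc₂ hsurj (a := a.map (algebraMap T T₂)) ?_ ?_ hI
    (hspan ▸ hp₂) (hr.trans hrank) (hn.trans_le hrank) b' d' hu l
  · exact ha.map _
  · intro c
    rw [hker, hfa]
    simp only [map_sum, map_mul, Matrix.map_apply]

/-- Blowing up a subvariety of the singular locus near a quadratic singularity. -/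
theorem IsHypersurfaceChart.exists_affineOpens_of_hasQuadraticInitialForm [LocallyOfFiniteType s]
    (h : IsHypersurfaceChart s f j) {r : ℕ} (hX : ∀ x, IsAdmissibleAt s r x) (B : Closeds X)
    (hB : (B : Set X) ⊆ singularLocus s) (hJ : (chartIdeal f j (B : Set X)).IsPrime)
    (ev : A →ₐ[ℂ] ℂ) (hle : chartIdeal f j (B : Set X) ≤ RingHom.ker ev) {ρ : ℕ} (hr : r ≤ ρ)
    (hf : HasQuadraticInitialForm (RingHom.ker ev) f ρ) :
    ∃ U : X.affineOpens, (((U : X.Opens) : Set X) ∩ (B : Set X)).Nonempty ∧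
      ∀ y, IsAdmissibleAt (blowupMap B U ≫ s) r y := by
  have := h.smooth
  have : IsNoetherianRing A := Algebra.FiniteType.isNoetherianRing ℂ A
  have : Algebra.FormallySmooth ℂ (A ⧸ (⊥ : Ideal A)) := .of_equiv (AlgEquiv.quotientBot ℂ A).symm
  have hmax : (RingHom.ker ev).IsMaximal :=
    RingHom.ker_isMaximal_of_surjective ev fun c => ⟨algebraMap ℂ A c, ev.commutes c⟩
  -- With `J = ⊥` this only provides coordinates near the point, unrelated to `B`.
  obtain ⟨ι, τ, _, _, w, g, hg, -, -, hw⟩ :=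
    exists_isCoordinateSystem_adapted ev (bot_le (a := RingHom.ker ev))
  obtain ⟨A₁, _, _, _, _, _⟩ := exists_isLocalization_away g
  obtain ⟨j₁, h₁, hJ₁, hp₁⟩ := h.exists_away_isPrime hJ (fun h' => hg (hle h')) A₁
  obtain ⟨ev₁, hev₁, hker₁⟩ := exists_evaluation_extension ev hg (T := A₁)
  have : Algebra.FormallyEtale A A₁ := .of_isLocalization (.powers g)
  have hw₁ := hw A₁ (IsLocalization.Away.algebraMap_isUnit g)
  have hf₁ : HasQuadraticInitialForm (RingHom.ker ev₁) (algebraMap A A₁ f) ρ := by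
    rw [hker₁]
    exact hf.map_algebraMap (g := g) hg
  obtain ⟨-, hρ, hρr⟩ := le_rank_hessian hw₁ ev₁ hf₁
  obtain ⟨b, d, hdet⟩ := exists_det_submatrix_ne_zero (hessian hw₁ ev₁ (algebraMap A A₁ f)) rfl
  have hG : ev₁ (Matrix.of fun i k =>
      hw₁.pderiv (b i) (hw₁.pderiv (d k) (algebraMap A A₁ f))).det ≠ 0 := by
    rw [AlgHom.map_det]
    exact hdet
  have hle₁ : chartIdeal (algebraMap A A₁ f) j₁ (B : Set X) ≤ RingHom.ker ev₁ := by
    rw [hJ₁, hker₁]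
    exact Ideal.map_mono hle
  -- The minor is nonzero at a closed point of `B`, so inverting it leaves a chart that still meets
  -- `B`.
  obtain ⟨A₂, _, _, _, _, hA₂⟩ := exists_isLocalization_away (Matrix.of fun i k =>
      hw₁.pderiv (b i) (hw₁.pderiv (d k) (algebraMap A A₁ f))).det
  obtain ⟨j₂, h₂, hJ₂, hp₂⟩ := h₁.exists_away_isPrime (hJ₁ ▸ hp₁) (fun h' => hG (hle₁ h')) A₂
  have : Algebra.FormallyEtale A₁ A₂ := .of_isLocalization (.powers (Matrix.of fun i k =>
      hw₁.pderiv (b i) (hw₁.pderiv (d k) (algebraMap A A₁ f))).det)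
  have hw₂ := hw₁.algebraMap A₂
  refine h₂.exists_affineOpens_of_hessian hX B hB (hJ₂ ▸ hp₂) hw₂ (hr.trans hρr)
    (hρ.trans_le hρr) b d ?_
  have hu := hA₂.algebraMap_isUnit
  rw [RingHom.map_det] at hu
  convert hu using 3
  ext i k
  simp [pderiv_algebraMap_apply hw₁ hw₂]

/-- Blowing up a subvariety of a smooth variety. -/
theorem IsHypersurfaceChart.exists_affineOpens_of_eq_zero [LocallyOfFiniteType s]
    (h : IsHypersurfaceChart s f j) {r : ℕ} (hX : ∀ x, IsAdmissibleAt s r x) (B : Closeds X)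
    (hJ : (chartIdeal f j (B : Set X)).IsPrime) (hf : f = 0) :
    ∃ U : X.affineOpens, (((U : X.Opens) : Set X) ∩ (B : Set X)).Nonempty ∧
      ∀ y, IsAdmissibleAt (blowupMap B U ≫ s) r y := by
  obtain ⟨T, _, _, _, _, _, j₁, ev, ι, τ, _, _, x, h₁, hJ₁, hle, hx, hxc⟩ := h.exists_adapted hJ
  have := h₁.smooth
  refine h₁.exists_affineOpens hX B hJ₁ hx fun R _ _ _ _ hsurj hker I hI l =>
    hasAdmissibleChart_of_isCoordinateSystem hxc hsurj (fun b => ?_) hI r l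
  rw [hker, hf, map_zero]

/-- A nonsingular point has a chart given by the zero equation in a smooth affine scheme. -/
theorem IsNonsingularAt.exists_isHypersurfaceChart {x : X} (hx : IsNonsingularAt s x) :
    ∃ (A : Type) (_ : CommRing A) (_ : Algebra ℂ A)
      (j : Spec (.of (A ⧸ Ideal.span {(0 : A)})) ⟶ X) (y : Spec (.of (A ⧸ Ideal.span {(0 : A)}))),
      IsHypersurfaceChart s (0 : A) j ∧ j y = x := by
  obtain ⟨V, hxV, _⟩ := hx
  obtain ⟨W, hW, hxW, hWV⟩ := exists_isAffineOpen_mem_and_subset hxV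
  have hrange : Set.range hW.fromSpec ⊆ Set.range V.ι := by
    rw [hW.range_fromSpec, Scheme.Opens.range_ι]
    exact hWV
  let k := IsOpenImmersion.lift V.ι hW.fromSpec hrange
  have hk : k ≫ V.ι = hW.fromSpec := IsOpenImmersion.lift_fac V.ι hW.fromSpec hrange
  have : IsOpenImmersion (k ≫ V.ι) := hk ▸ inferInstance
  have : IsOpenImmersion k := .of_comp k V.ι
  have hsm : Smooth (hW.fromSpec ≫ s) := by
    rw [← hk, Category.assoc]
    infer_instance
  let φ : CommRingCat.of ℂ ⟶ Γ(X, W) := Spec.preimage (hW.fromSpec ≫ s)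
  have hφ : Spec.map φ = hW.fromSpec ≫ s := Spec.map_preimage _
  let _ : Algebra ℂ Γ(X, W) := φ.hom.toAlgebra
  have : Algebra.Smooth ℂ Γ(X, W) := by
    rw [← hφ, HasRingHomProperty.Spec_iff (P := @Smooth)] at hsm
    exact hsm
  let π : Γ(X, W) ⟶ CommRingCat.of (Γ(X, W) ⧸ Ideal.span {(0 : Γ(X, W))}) :=
    CommRingCat.ofHom (Ideal.Quotient.mk _)
  have : IsIso (Spec.map π) := by
    rw [isIso_SpecMap_iff]
    refine ⟨?_, Ideal.Quotient.mk_surjective⟩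
    rw [injective_iff_map_eq_zero]
    intro a ha
    simpa using (Ideal.Quotient.eq_zero_iff_mem.mp ha)
  obtain ⟨p, hp⟩ : x ∈ Set.range hW.fromSpec := by rwa [hW.range_fromSpec]
  obtain ⟨y, rfl⟩ := (Spec.map π).homeomorph.surjective p
  refine ⟨Γ(X, W), inferInstance, inferInstance, Spec.map π ≫ hW.fromSpec, y,
    ⟨inferInstance, inferInstance, ?_⟩, ?_⟩
  · rw [Category.assoc, ← hφ, ← Spec.map_comp]
    rfl
  · rw [Scheme.Hom.comp_apply]
    exact hp

end Main

end QuadraticSingularities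

theorem proposition1p4
    (X : Scheme.{0}) (s : X ⟶ Spec (.of ℂ))
    [IsReduced X] [IsSeparated s] [LocallyOfFiniteType s] [QuasiCompact s]
    (r : ℕ)
    (hquad : QuadraticSingularities.HasAtMostQuadraticSingularities s r)
    (hcodim : (r : ℕ∞) ≤ QuadraticSingularities.codim (QuadraticSingularities.singularLocus s))
    (B : Closeds X) (hB : IsIrreducible (B : Set X)) :
    ∃ U : X.affineOpens, (((U : X.Opens) : Set X) ∩ (B : Set X)).Nonempty ∧
      QuadraticSingularities.HasAtMostQuadraticSingularities
        (QuadraticSingularities.blowupMap B U ≫ s) r ∧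
      (r : ℕ∞) ≤ QuadraticSingularities.codim
        (QuadraticSingularities.singularLocus (QuadraticSingularities.blowupMap B U ≫ s)) := by
  open QuadraticSingularities in
  have hX := (forall_isAdmissibleAt_iff s r).mpr ⟨hquad, hcodim⟩
  simp only [← QuadraticSingularities.forall_isAdmissibleAt_iff]
  by_cases hsing : (B : Set X) ⊆ QuadraticSingularities.singularLocus s
  · have : JacobsonSpace X := LocallyOfFiniteType.jacobsonSpace s
    -- The quadratic form is only given at closed points; `B` contains one because `X` is Jacobson.
    obtain ⟨x, hxB, hx⟩ := nonempty_inter_closedPoints hB.1 B.isClosed.isLocallyClosed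
    obtain ⟨ρ, hρ, A, _, _, f, j, y, hA, hj, hjs, rfl, hm, hf⟩ :=
      (hquad x hx).resolve_left (hsing hxB)
    obtain ⟨ev, hev⟩ := QuadraticSingularities.exists_ker_eq_of_isMaximal
      (y.asIdeal.comap (Ideal.Quotient.mk (Ideal.span {f})))
    rw [← hev] at hf
    have h : QuadraticSingularities.IsHypersurfaceChart s f j := ⟨hA, hj, hjs⟩
    refine h.exists_affineOpens_of_hasQuadraticInitialForm hX B hsing
      (QuadraticSingularities.isPrime_chartIdeal hB hxB) ev (fun a ha => ?_) hρ hf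
    rw [hev]
    exact QuadraticSingularities.mem_chartIdeal.mp ha y hxB
  -- Near a nonsingular point `X` is the hypersurface `0 = 0` in itself, so the same chart machinery
  -- applies.
  · obtain ⟨x, hxB, hx⟩ := Set.not_subset.mp hsing
    obtain ⟨A, _, _, j, y, h, rfl⟩ := (not_not.mp hx).exists_isHypersurfaceChart
    have := h.isOpenImmersion
    exact h.exists_affineOpens_of_eq_zero hX B (QuadraticSingularities.isPrime_chartIdeal hB hxB) rfl
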